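/- **Setting.** Let $n\in\mathbb N$, $s>1$ and $1\le p,q\le\infty$. The Gelfand–Shilov space $\mathcal S_s(\mathbb R^n)$ is the union over $h>0$ of the spaces $\mathcal S_{s,h}(\mathbb R^n)$ of all $\varphi\in C^\infty(\mathbb R^n)$ with $$\|\varphi\|_{s,h}=\sup_{x,\alpha,\beta}\frac{|x^\alpha\partial^\beta\varphi(x)|}{h^{|\alpha|+|\beta|}(\alpha!\,\beta!)^s}<\infty ,$$ and $\mathcal S_s'(\mathbb R^n)$ is the space of linear functionals on $\mathcal S_s(\mathbb R^n)$ whose restriction to each $\mathcal S_{s,h}(\mathbb R^n)$ is bounded. Fix a window $\varphi\in\mathcal S_s(\mathbb R^n)\setminus\{0\}$ such that, for some $\kappa>1$ and $C\ge 0$, its Fourier transform satisfies $|\hat\varphi(\xi)|\le Ce^{-\kappa|\xi|^{1/s}}$ for all $\xi\in\mathbb R^n$. For $U\in\mathcal S_s'(\mathbb R^n)$ put $$V_\varphi U(x,\xi)=(2\pi)^{-n/2}\,U\big(t\mapsto\overline{\varphi(t-x)}\,e^{-it\cdot\xi}\big),\qquad \|U\|_{\mathcal{GM}^{p,q}_s}=\Big(\int_{\mathbb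 R^n}\Big(\int_{\mathbb R^n}|V_\varphi U(x,\xi)|^p\,dx\Big)^{q/p}e^{q|\xi|^{1/s}}\,d\xi\Big)^{1/q},$$ with the usual modifications if $p=\infty$ or $q=\infty$. The Gevrey-modulation space is $\mathcal{GM}^{p,q}_s(\mathbb R^n)=\{U\in\mathcal S_s'(\mathbb R^n):\|U\|_{\mathcal{GM}^{p,q}_s}<\infty\}$. A function $v\in L^\infty(\mathbb R^n)$ is identified with the functional $\psi\mapsto\int_{\mathbb R^n}v\psi\,dx$ in $\mathcal S_s'(\mathbb R^n)$. **Theorem.** Let $\mu$ be a complex measure on $\mathbb R$ with $\mu(\mathbb R)=0$ and $$\int_{\mathbb R}e^{\lambda|\xi|^{1/s}\log|\xi|}\,d|\mu|(\xi)<\infty\quad\text{for every }\lambda>0$$ (the exponent is read as $0$ at $\xi=0$), and let $f(t)=(2\pi)^{-1/2}\int_{\mathbb R}e^{i\xi t}\,d\mu(\xi)$, $t\in\mathbb R$, be its inverse Fourier transform. Then $f\in C^\infty(\mathbb R)$, and the composition operator $T_f:u\mapsto f\circ u$ is well defined on the real-valued elements of $\mathcal{GM}^{p,q}_s(\mathbb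 R^n)$ and maps them into $\mathcal{GM}^{p,q}_s(\mathbb R^n)$. That is: every element of $\mathcal{GM}^{p,q}_s(\mathbb R^n)$ is given by a function in $L^\infty(\mathbb R^n)$, and if $u:\mathbb R^n\to\mathbb R$ belongs to $\mathcal{GM}^{p,q}_s(\mathbb R^n)$, then $f\circ u$ belongs to $\mathcal{GM}^{p,q}_s(\mathbb R^n)$. -/

import Mathlib

open MeasureTheory
open scoped ContDiff

noncomputable section

namespace GevreyModulation

/-- `IsGSBound s h A φ` says that the Gelfand-Shilov norm of `φ` with parameters `s, h` is at most `A`,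
i.e. `‖x‖ ^ m * ‖D ^ k φ (x)‖ ≤ A h ^ (m + k) (m! k!) ^ s` for all `m, k, x`.
This is the coordinate-free form of the multi-index bounds
`|x ^ α ∂ ^ β φ (x)| ≤ A h ^ (|α| + |β|) (α! β!) ^ s`: since `α! ≤ |α|! ≤ n ^ |α| α!`, the two
families of bounds agree up to multiplying `h` by a constant depending only on `n` and `s` (and `A` by an
absolute constant), so they give the same space `S_s` and the same dual `S_s'`. -/
def IsGSBound {n : ℕ} (s h A : ℝ) (φ : EuclideanSpace ℝ (Fin n) → ℂ) : Prop :=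
  ∀ (m k : ℕ) (x : EuclideanSpace ℝ (Fin n)),
    ‖x‖ ^ m * ‖iteratedFDeriv ℝ k φ x‖ ≤
      A * h ^ (m + k) * ((m.factorial : ℝ) * (k.factorial : ℝ)) ^ s

theorem IsGSBound.nonneg {n : ℕ} {s h A : ℝ} {φ : EuclideanSpace ℝ (Fin n) → ℂ}
    (H : IsGSBound s h A φ) : 0 ≤ A := by
  have := H 0 0 0
  simp only [pow_zero, one_mul, add_zero, Nat.factorial_zero, Nat.cast_one, mul_one,
    Real.one_rpow] at this
  exact (norm_nonneg _).trans this

theorem IsGSBound.mono {n : ℕ} {s h h' A : ℝ} {φ : EuclideanSpace ℝ (Fin n) → ℂ}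
    (H : IsGSBound s h A φ) (h0 : 0 ≤ h) (hh : h ≤ h') : IsGSBound s h' A φ := by
  intro m k x
  refine (H m k x).trans ?_
  have hA := H.nonneg
  have hp : h ^ (m + k) ≤ h' ^ (m + k) := pow_le_pow_left₀ h0 hh _
  exact mul_le_mul_of_nonneg_right (mul_le_mul_of_nonneg_left hp hA) (by positivity)

/-- The Gelfand-Shilov space `S_s(ℝⁿ)`, the union over `h > 0` of the spaces of smooth functions
with finite Gelfand-Shilov norm with parameters `s, h`. -/
def gelfandShilov (n : ℕ) (s : ℝ) : Submodule ℂ (EuclideanSpace ℝ (Fin n) → ℂ) where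
  carrier := {φ | ContDiff ℝ ∞ φ ∧ ∃ h : ℝ, 0 < h ∧ ∃ A : ℝ, IsGSBound s h A φ}
  zero_mem' := by
    refine ⟨contDiff_const, 1, one_pos, 0, fun m k x => ?_⟩
    have : iteratedFDeriv ℝ k (0 : EuclideanSpace ℝ (Fin n) → ℂ) x = 0 := by
      simp
    simp [this]
  add_mem' := by
    rintro φ ψ ⟨hφ, h₁, h₁0, A₁, H₁⟩ ⟨hψ, h₂, h₂0, A₂, H₂⟩
    refine ⟨hφ.add hψ, max h₁ h₂, lt_max_of_lt_left h₁0, A₁ + A₂, fun m k x => ?_⟩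
    have e : iteratedFDeriv ℝ k (φ + ψ) x = iteratedFDeriv ℝ k φ x + iteratedFDeriv ℝ k ψ x :=
      iteratedFDeriv_add_apply (hφ.contDiffAt.of_le (by exact_mod_cast le_top))
        (hψ.contDiffAt.of_le (by exact_mod_cast le_top))
    have b₁ := H₁.mono h₁0.le (le_max_left h₁ h₂) m k x
    have b₂ := H₂.mono h₂0.le (le_max_right h₁ h₂) m k x
    rw [e]
    calc ‖x‖ ^ m * ‖iteratedFDeriv ℝ k φ x + iteratedFDeriv ℝ k ψ x‖
        ≤ ‖x‖ ^ m * (‖iteratedFDeriv ℝ k φ x‖ + ‖iteratedFDeriv ℝ k ψ x‖) := by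
          gcongr; exact norm_add_le _ _
      _ ≤ _ := by rw [mul_add, add_mul, add_mul]; exact add_le_add b₁ b₂
  smul_mem' := by
    rintro c φ ⟨hφ, h, h0, A, H⟩
    refine ⟨contDiff_const.smul hφ, h, h0, ‖c‖ * A, fun m k x => ?_⟩
    have e : iteratedFDeriv ℝ k (c • φ) x = c • iteratedFDeriv ℝ k φ x :=
      iteratedFDeriv_const_smul_apply (hφ.contDiffAt.of_le (by exact_mod_cast le_top))
    rw [e, norm_smul]
    calc ‖x‖ ^ m * (‖c‖ * ‖iteratedFDeriv ℝ k φ x‖)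
        = ‖c‖ * (‖x‖ ^ m * ‖iteratedFDeriv ℝ k φ x‖) := by ring
      _ ≤ ‖c‖ * (A * h ^ (m + k) * ((m.factorial : ℝ) * (k.factorial : ℝ)) ^ s) :=
          mul_le_mul_of_nonneg_left (H m k x) (norm_nonneg c)
      _ = _ := by ring

/-- The function `t ↦ conj (M_ξ T_x φ (t)) = conj (φ (t - x)) e^{-i t·ξ}`. -/
def conjShift {n : ℕ} (φ : EuclideanSpace ℝ (Fin n) → ℂ) (x ξ : EuclideanSpace ℝ (Fin n)) :
    EuclideanSpace ℝ (Fin n) → ℂ :=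
  fun t => Complex.exp (-(Complex.I * (inner ℝ t ξ : ℝ))) * (starRingEnd ℂ) (φ (t - x))

theorem norm_iteratedFDeriv_phase_le {n : ℕ} (ξ t : EuclideanSpace ℝ (Fin n)) (k : ℕ) :
    ‖iteratedFDeriv ℝ k (fun t : EuclideanSpace ℝ (Fin n) =>
      Complex.exp (-(Complex.I * (inner ℝ t ξ : ℝ)))) t‖ ≤ ‖ξ‖ ^ k := by
  set g : ℝ → ℂ := fun r => Complex.exp (-(Complex.I * (r : ℂ))) with hg
  have hgd : ∀ r : ℝ, HasDerivAt g (-Complex.I * g r) r := by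
    intro r
    have h1 : HasDerivAt (fun r : ℝ => -(Complex.I * (r : ℂ))) (-(Complex.I * 1)) r :=
      ((Complex.ofRealCLM.hasDerivAt (x := r)).const_mul Complex.I).neg
    have h2 := h1.cexp
    convert h2 using 1
    simp only [hg]; ring
  have hgs : ContDiff ℝ ∞ g :=
    (contDiff_const.mul Complex.ofRealCLM.contDiff).neg.cexp
  have hit : ∀ k : ℕ, iteratedDeriv k g = fun r => (-Complex.I) ^ k * g r := by
    intro k
    induction k with
    | zero => simp
    | succ k ih =>
      rw [iteratedDeriv_succ, ih]
      funext r
      rw [((hgd r).const_mul ((-Complex.I) ^ k)).deriv]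
      ring
  have hcomp : (fun t : EuclideanSpace ℝ (Fin n) =>
      Complex.exp (-(Complex.I * (inner ℝ t ξ : ℝ)))) = g ∘ (innerSL ℝ ξ) := by
    funext t
    simp [hg, real_inner_comm]
  rw [hcomp, (innerSL ℝ ξ).iteratedFDeriv_comp_right hgs t (i := k)
    (by exact_mod_cast le_top)]
  refine (ContinuousMultilinearMap.norm_compContinuousLinearMap_le _ _).trans ?_
  rw [norm_iteratedFDeriv_eq_norm_iteratedDeriv, hit]
  have hn : ‖g ((innerSL ℝ ξ) t)‖ = 1 := by
    simp only [hg, Complex.norm_exp]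
    simp
  beta_reduce
  rw [norm_mul, hn]
  simp

theorem contDiff_phase {n : ℕ} (ξ : EuclideanSpace ℝ (Fin n)) :
    ContDiff ℝ ∞ (fun t : EuclideanSpace ℝ (Fin n) =>
      Complex.exp (-(Complex.I * (inner ℝ t ξ : ℝ)))) := by
  have : ContDiff ℝ ∞ (fun t : EuclideanSpace ℝ (Fin n) => inner ℝ t ξ) :=
    contDiff_id.inner ℝ contDiff_const
  have h2 : ContDiff ℝ ∞ (fun t : EuclideanSpace ℝ (Fin n) => ((inner ℝ t ξ : ℝ) : ℂ)) :=
    Complex.ofRealCLM.contDiff.comp this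
  exact (contDiff_const.mul h2).neg.cexp

/-- `S_s` is invariant under time-frequency shifts and complex conjugation. -/
theorem conjShift_mem {n : ℕ} {s : ℝ} (hs : 1 < s) {φ : EuclideanSpace ℝ (Fin n) → ℂ}
    (hφ : φ ∈ gelfandShilov n s) (x ξ : EuclideanSpace ℝ (Fin n)) :
    conjShift φ x ξ ∈ gelfandShilov n s := by
  obtain ⟨hφs, h, h0, A, H⟩ := hφ
  have hA := H.nonneg
  have hs0 : 0 ≤ s := by linarith
  set ψ : EuclideanSpace ℝ (Fin n) → ℂ := fun t => (starRingEnd ℂ) (φ (t - x)) with hψ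
  have hsh : ContDiff ℝ ∞ (fun t => φ (t - x)) := hφs.comp (contDiff_id.sub contDiff_const)
  have hψs : ContDiff ℝ ∞ ψ := Complex.conjLIE.toContinuousLinearEquiv.contDiff.comp hsh
  have hψn : ∀ (k : ℕ) (t : EuclideanSpace ℝ (Fin n)),
      ‖iteratedFDeriv ℝ k ψ t‖ = ‖iteratedFDeriv ℝ k φ (t - x)‖ := by
    intro k t
    have h1 := LinearIsometryEquiv.norm_iteratedFDeriv_comp_left (𝕜 := ℝ) Complex.conjLIE
      (fun t => φ (t - x)) t k
    rw [iteratedFDeriv_comp_sub] at h1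
    exact h1
  -- binomial expansion of the weight around the new centre
  have hshift : ∀ (m k : ℕ) (t : EuclideanSpace ℝ (Fin n)),
      ‖t‖ ^ m * ‖iteratedFDeriv ℝ k ψ t‖ ≤
        A * (h + ‖x‖) ^ m * h ^ k * ((m.factorial : ℝ) * (k.factorial : ℝ)) ^ s := by
    intro m k t
    rw [hψn]
    have ht : ‖t‖ ≤ ‖t - x‖ + ‖x‖ := by
      simpa using norm_add_le (t - x) x
    calc ‖t‖ ^ m * ‖iteratedFDeriv ℝ k φ (t - x)‖
        ≤ (‖t - x‖ + ‖x‖) ^ m * ‖iteratedFDeriv ℝ k φ (t - x)‖ := by gcongr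
      _ = ∑ j ∈ Finset.range (m + 1), (‖x‖ ^ (m - j) * (m.choose j : ℝ)) *
            (‖t - x‖ ^ j * ‖iteratedFDeriv ℝ k φ (t - x)‖) := by
          rw [add_pow, Finset.sum_mul]
          refine Finset.sum_congr rfl fun j _ => ?_
          ring
      _ ≤ ∑ j ∈ Finset.range (m + 1), (‖x‖ ^ (m - j) * (m.choose j : ℝ)) *
            (A * h ^ (j + k) * ((m.factorial : ℝ) * (k.factorial : ℝ)) ^ s) := by
          refine Finset.sum_le_sum fun j hj => ?_
          have hjm : j ≤ m := Nat.lt_succ_iff.mp (Finset.mem_range.mp hj)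
          have hf : (j.factorial : ℝ) ≤ (m.factorial : ℝ) := by
            exact_mod_cast Nat.factorial_le hjm
          refine mul_le_mul_of_nonneg_left ((H j k (t - x)).trans ?_) (by positivity)
          gcongr
      _ = A * (h + ‖x‖) ^ m * h ^ k * ((m.factorial : ℝ) * (k.factorial : ℝ)) ^ s := by
          rw [add_pow, Finset.mul_sum, Finset.sum_mul, Finset.sum_mul]
          refine Finset.sum_congr rfl fun j _ => ?_
          rw [pow_add]; ring
  refine ⟨(contDiff_phase ξ).mul hψs, h + ‖x‖ + ‖ξ‖, by positivity, A, fun m k t => ?_⟩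
  have hprod := norm_iteratedFDeriv_mul_le (contDiff_phase ξ) hψs t (n := k)
    (by exact_mod_cast le_top)
  calc ‖t‖ ^ m * ‖iteratedFDeriv ℝ k (conjShift φ x ξ) t‖
      ≤ ‖t‖ ^ m * ∑ j ∈ Finset.range (k + 1), (k.choose j : ℝ) * ‖ξ‖ ^ j *
          ‖iteratedFDeriv ℝ (k - j) ψ t‖ := by
        refine mul_le_mul_of_nonneg_left ?_ (by positivity)
        refine le_trans hprod ?_
        refine Finset.sum_le_sum fun j _ => ?_
        refine mul_le_mul_of_nonneg_right (mul_le_mul_of_nonneg_left ?_ (by positivity))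
          (norm_nonneg _)
        exact norm_iteratedFDeriv_phase_le ξ t j
    _ = ∑ j ∈ Finset.range (k + 1), ((k.choose j : ℝ) * ‖ξ‖ ^ j) *
          (‖t‖ ^ m * ‖iteratedFDeriv ℝ (k - j) ψ t‖) := by
        rw [Finset.mul_sum]
        refine Finset.sum_congr rfl fun j _ => ?_
        ring
    _ ≤ ∑ j ∈ Finset.range (k + 1), ((k.choose j : ℝ) * ‖ξ‖ ^ j) *
          (A * (h + ‖x‖) ^ m * h ^ (k - j) *
            ((m.factorial : ℝ) * (k.factorial : ℝ)) ^ s) := by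
        refine Finset.sum_le_sum fun j _ => ?_
        have hf : ((k - j).factorial : ℝ) ≤ (k.factorial : ℝ) := by
          exact_mod_cast Nat.factorial_le (Nat.sub_le k j)
        refine mul_le_mul_of_nonneg_left ((hshift m (k - j) t).trans ?_) (by positivity)
        gcongr
    _ = A * (h + ‖x‖) ^ m * (‖ξ‖ + h) ^ k *
          ((m.factorial : ℝ) * (k.factorial : ℝ)) ^ s := by
        rw [add_pow ‖ξ‖ h k, Finset.mul_sum, Finset.sum_mul]
        refine Finset.sum_congr rfl fun j _ => ?_
        ring
    _ ≤ A * (h + ‖x‖ + ‖ξ‖) ^ m * (h + ‖x‖ + ‖ξ‖) ^ k *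
          ((m.factorial : ℝ) * (k.factorial : ℝ)) ^ s := by
        have := norm_nonneg x
        have := norm_nonneg ξ
        have h₁ : h + ‖x‖ ≤ h + ‖x‖ + ‖ξ‖ := by linarith
        have h₂ : ‖ξ‖ + h ≤ h + ‖x‖ + ‖ξ‖ := by linarith
        have h₃ := pow_le_pow_left₀ (by positivity) h₁ m
        have h₄ := pow_le_pow_left₀ (by positivity) h₂ k
        refine mul_le_mul_of_nonneg_right ?_ (by positivity)
        exact mul_le_mul (mul_le_mul_of_nonneg_left h₃ hA) h₄ (by positivity) (by positivity)
    _ = A * (h + ‖x‖ + ‖ξ‖) ^ (m + k) *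
          ((m.factorial : ℝ) * (k.factorial : ℝ)) ^ s := by
        rw [pow_add]; ring

/-- An element of `S_s'(ℝⁿ)`: a linear functional on `S_s(ℝⁿ)` whose restriction to each Banach space
`S_{s,h}`, `h > 0`, is bounded. -/
structure GSDistribution (n : ℕ) (s : ℝ) where
  toLinearMap : gelfandShilov n s →ₗ[ℂ] ℂ
  bound : ∀ h : ℝ, 0 < h → ∃ C : ℝ, ∀ (A : ℝ) (ψ : gelfandShilov n s),
    IsGSBound s h A (ψ : EuclideanSpace ℝ (Fin n) → ℂ) → ‖toLinearMap ψ‖ ≤ C * A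

/-- The short-time Fourier transform
`V_φ U (x, ξ) = (2π)^{-n/2} (U, M_ξ T_x φ) = (2π)^{-n/2} U (t ↦ conj (φ (t - x)) e^{-i t·ξ})`. -/
def stft {n : ℕ} {s : ℝ} (hs : 1 < s) (φ : gelfandShilov n s) (U : GSDistribution n s)
    (x ξ : EuclideanSpace ℝ (Fin n)) : ℂ :=
  (((2 * Real.pi) ^ (-(n : ℝ) / 2) : ℝ) : ℂ) *
    U.toLinearMap ⟨conjShift φ x ξ, conjShift_mem hs φ.2 x ξ⟩

/-- The norm `‖ e^{|ξ|^{1/s}} ‖V_φ U (·, ξ)‖_{L^p} ‖_{L^q(dξ)}`, with values in `[0, ∞]`. -/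
def gmNorm {n : ℕ} {s : ℝ} (hs : 1 < s) (φ : gelfandShilov n s) (p q : ENNReal)
    (U : GSDistribution n s) : ENNReal :=
  eLpNorm (fun ξ : EuclideanSpace ℝ (Fin n) =>
    ENNReal.ofReal (Real.exp (‖ξ‖ ^ (1 / s))) *
      eLpNorm (fun x : EuclideanSpace ℝ (Fin n) => stft hs φ U x ξ) p volume) q volume

/-- The Gevrey-modulation space `GM^{p,q}_s(ℝⁿ)` with window `φ`. -/
def gevreyModulation {n : ℕ} {s : ℝ} (hs : 1 < s) (φ : gelfandShilov n s) (p q : ENNReal) :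
    Set (GSDistribution n s) :=
  {U | gmNorm hs φ p q U < ⊤}

/-- `U` is the distribution given by the essentially bounded function `v`. -/
def IsRepresentedBy {n : ℕ} {s : ℝ} (U : GSDistribution n s)
    (v : EuclideanSpace ℝ (Fin n) → ℂ) : Prop :=
  MemLp v ⊤ volume ∧ ∀ ψ : gelfandShilov n s,
    U.toLinearMap ψ = ∫ t, v t * (ψ : EuclideanSpace ℝ (Fin n) → ℂ) t

/-- The function `v` belongs to `GM^{p,q}_s(ℝⁿ)`. -/
def IsGMFunction {n : ℕ} {s : ℝ} (hs : 1 < s) (φ : gelfandShilov n s) (p q : ENNReal)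
    (v : EuclideanSpace ℝ (Fin n) → ℂ) : Prop :=
  ∃ U ∈ gevreyModulation hs φ p q, IsRepresentedBy U v

/-- The Fourier transform `φ̂ (ξ) = (2π)^{-n/2} ∫ φ(x) e^{-i x·ξ} dx`. -/
def fourierTransform {n : ℕ} (φ : EuclideanSpace ℝ (Fin n) → ℂ)
    (ξ : EuclideanSpace ℝ (Fin n)) : ℂ :=
  (((2 * Real.pi) ^ (-(n : ℝ) / 2) : ℝ) : ℂ) *
    ∫ x, φ x * Complex.exp (-(Complex.I * (inner ℝ x ξ : ℝ)))

/-- Admissible windows: `φ ≠ 0`, and `φ̂` is dominated by `e^{-κ|ξ|^{1/s}}` for some `κ > 1`, so that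
the decay of the window is strictly better than the inverse of the weight `e^{|ξ|^{1/s}}`. -/
def IsAdmissibleWindow {n : ℕ} {s : ℝ} (φ : gelfandShilov n s) : Prop :=
  φ ≠ 0 ∧ ∃ κ : ℝ, 1 < κ ∧ ∃ C : ℝ, ∀ ξ : EuclideanSpace ℝ (Fin n),
    ‖fourierTransform (φ : EuclideanSpace ℝ (Fin n) → ℂ) ξ‖ ≤ C * Real.exp (-(κ * ‖ξ‖ ^ (1 / s)))

/-- The inverse Fourier transform `t ↦ (2π)^{-1/2} ∫ e^{iξt} dμ(ξ)` of a complex measure on `ℝ`. -/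
def invFourierMeasure (μ : ComplexMeasure ℝ) (t : ℝ) : ℂ :=
  (((2 * Real.pi) ^ (-(1 : ℝ) / 2) : ℝ) : ℂ) *
    VectorMeasure.integral μ (fun ξ : ℝ => Complex.exp (Complex.I * ((ξ * t : ℝ) : ℂ)))
      (ContinuousLinearMap.mul ℝ ℂ)

end GevreyModulation

end

open GevreyModulation

open scoped ENNReal SchwartzMap

/-! Put `r = 1 / s`, so `0 < r < 1`. Up to a constant and a phase, the short-time Fourier transform
of a function `g` is the convolution `cv g (modul ξ θ)`, where `θ` is the reflected conjugate of the
window, and the norm becomes `wnorm`. Because `μ(ℝ) = 0`, the function `f ∘ u` is a superposition of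
the functions `e^{itu} - 1` against `μ`. By Minkowski's inequality
(`wnorm_invFourierMeasure_comp_le`) everything reduces to how the norm of `e^{itu} - 1` grows with
`t`. The bound obtained is `e^{l m^r log m}` with `m = max(2, |t|)`, which is what the moments of
`μ` absorb.

The growth estimate rests on concavity: if `|β| ≤ |α|` then `(|α| + |β|)^r ≤ |α|^r + δ|β|^r` with `δ
= 2^r - 1 < 1` (`add_rpow_le_of_le`). In a product only one factor pays the full weight and the
other pays `e^{δ|·|^r}` (`IsBandWindow.wnorm_mul_le`). Hence the norm of `e^g - 1` is at most the
norm of `g` times the exponential of a weaker norm of `g`. For `g = itu` this would give `e^{C|t|}`,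
which is too much, so `u` is split at a frequency `R` with `R^r` proportional to `log m`. The high
part has weaker norm `O(1/m)`, so multiplication by `t` keeps it bounded. For the low part `v`, the
power `v^k` has frequencies at most about `k(R+1)`. Below a frequency of order `m(R+1)` the
inequality `|e^{itv} - 1| ≤ m|v|` suffices, since the weight costs only `e^{O(m^r log m)}`; above it
only powers beyond a multiple of `m` contribute, and their factorials beat the weight
(`exists_truncCoeff_le`, `wnorm_exp_sub_one_le_truncCoeff`).

Spectra add up exactly for a window with compactly supported Fourier transform. The given window is
therefore exchanged for a band-limited Schwartz window and back; the kernel of the exchange decays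
like `e^{-κ'|·|^r}` with `1 < κ' < κ` and so preserves the weight (`exists_wnorm_window_change`).

For the representation by functions, Hölder's inequality makes `‖V_φ U(·, ξ)‖_p` integrable in `ξ`,
and the inversion formula then produces a bounded continuous function
(`GSDistribution.exists_bddCont`). The functional `U` is exchanged with integrals by embedding test
functions into a space of bounded families of derivatives, extending `U` by Hahn-Banach, and
integrating in the sense of Bochner (`cv_mem`). -/

namespace GevreyModulation

/-! ### Lebesgue norms of functions with values in `[0, ∞]`: Hölder and Minkowski. -/

section ENNRealLp

variable {X Y : Type*} [MeasurableSpace X] [MeasurableSpace Y] {μ : Measure X} {ν : Measure Y}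

theorem eLpNorm_ennreal_mono {p : ℝ≥0∞} {F G : X → ℝ≥0∞} (h : ∀ x, F x ≤ G x) :
    eLpNorm F p μ ≤ eLpNorm G p μ :=
  eLpNorm_mono_enorm (by simpa using h)

theorem eLpNorm_const_mul_le {p c : ℝ≥0∞} (hc : c ≠ ⊤) (F : X → ℝ≥0∞) :
    eLpNorm (fun x => c * F x) p μ ≤ c * eLpNorm F p μ := by
  lift c to NNReal using hc
  exact eLpNorm_le_nnreal_smul_eLpNorm_of_ae_le_mul' (μ := μ) (f := fun x => c * F x) (g := F)
    (c := c) (by simp) p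

theorem eLpNorm_ennreal_ne_top {p : ℝ≥0∞} (hp : p ≠ 0) (hp' : p ≠ ⊤) (F : X → ℝ≥0∞) :
    eLpNorm F p μ = (∫⁻ x, F x ^ p.toReal ∂μ) ^ (1 / p.toReal) := by
  simp [eLpNorm_eq_lintegral_rpow_enorm_toReal hp hp']

theorem eLpNorm_ennreal_one (F : X → ℝ≥0∞) : eLpNorm F 1 μ = ∫⁻ x, F x ∂μ := by
  simp [eLpNorm_one_eq_lintegral_enorm]

theorem eLpNorm_ennreal_top (F : X → ℝ≥0∞) : eLpNorm F ⊤ μ = essSup F μ := by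
  simp [eLpNorm_exponent_top, eLpNormEssSup]

theorem lt_essSup_iff {F : X → ℝ≥0∞} {c : ℝ≥0∞} : c < essSup F μ ↔ 0 < μ {x | c < F x} := by
  constructor
  · intro h
    by_contra h0
    have h1 : F ≤ᵐ[μ] fun _ => c := by
      rw [Filter.EventuallyLE, ae_iff]
      simpa using h0
    exact absurd (essSup_le_of_ae_le c h1) (not_le.2 h)
  · intro h
    by_contra h0
    have h1 := ENNReal.ae_le_essSup (μ := μ) F
    rw [ae_iff] at h1
    refine h.ne' (measure_mono_null ?_ h1)
    intro x hx
    exact not_le.2 (lt_of_le_of_lt (not_lt.1 h0) hx)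

/-- For `p = ⊤`, the essential supremum exceeds `c` exactly when the section of `{F > c}` has
positive measure, and the measure of sections is a measurable function. Finite exponents follow from
Tonelli. -/
theorem measurable_eLpNorm_section [SFinite μ] {F : X → Y → ℝ≥0∞}
    (hF : Measurable (Function.uncurry F)) (p : ℝ≥0∞) :
    Measurable fun y => eLpNorm (fun x => F x y) p μ := by
  rcases eq_or_ne p 0 with rfl | h0
  · simp
  rcases eq_or_ne p ⊤ with rfl | ht
  · simp_rw [eLpNorm_ennreal_top]
    refine measurable_of_Ioi fun c => ?_
    have : (fun y => essSup (fun x => F x y) μ) ⁻¹' Set.Ioi c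
        = (fun y => μ ((fun x => (x, y)) ⁻¹' {z : X × Y | c < F z.1 z.2})) ⁻¹' Set.Ioi 0 := by
      ext y
      simp [lt_essSup_iff]
    rw [this]
    exact (measurable_measure_prodMk_right (measurableSet_lt measurable_const hF)) measurableSet_Ioi
  · simp_rw [eLpNorm_ennreal_ne_top h0 ht]
    refine Measurable.pow_const ?_ _
    exact Measurable.lintegral_prod_left (f := fun y x => F y x ^ p.toReal)
      (hF.pow_const _)

/-- By Fubini for null sets, `F x y` is bounded by the essential supremum of its `y`-section for
almost every pair, hence for almost every `x` and then almost every `y`. -/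
theorem essSup_lintegral_le [SFinite μ] [SFinite ν] {F : X → Y → ℝ≥0∞}
    (hF : Measurable (Function.uncurry F)) :
    essSup (fun x => ∫⁻ y, F x y ∂ν) μ ≤ ∫⁻ y, essSup (fun x => F x y) μ ∂ν := by
  have hm : Measurable fun y => essSup (fun x => F x y) μ := by
    simpa only [eLpNorm_ennreal_top] using measurable_eLpNorm_section (μ := μ) hF ⊤
  refine essSup_le_of_ae_le _ ?_
  have hS : MeasurableSet {z : X × Y | F z.1 z.2 ≤ essSup (fun x => F x z.2) μ} :=
    measurableSet_le hF (hm.comp measurable_snd)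
  have h1 : ∀ᵐ z ∂(μ.prod ν), F z.1 z.2 ≤ essSup (fun x => F x z.2) μ := by
    rw [Measure.ae_prod_iff_ae_ae hS, Measure.ae_ae_comm hS]
    exact Filter.Eventually.of_forall fun y => ENNReal.ae_le_essSup _
  filter_upwards [Measure.ae_ae_of_ae_prod h1] with x hx
  exact lintegral_mono_ae hx

theorem lintegral_mul_le_eLpNorm_mul {p : ℝ≥0∞} (hp : 1 ≤ p) {F G : X → ℝ≥0∞}
    (hF : AEMeasurable F μ) (hG : AEMeasurable G μ) :
    ∫⁻ x, F x * G x ∂μ ≤ eLpNorm F p μ * eLpNorm G p.conjExponent μ := by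
  have hc := ENNReal.HolderConjugate.conjExponent hp
  rcases eq_or_ne p ⊤ with rfl | ht
  · have : ENNReal.conjExponent ⊤ = 1 := by simp [ENNReal.conjExponent]
    rw [this, eLpNorm_ennreal_top, eLpNorm_ennreal_one, ← lintegral_const_mul'' _ hG]
    refine lintegral_mono_ae ?_
    filter_upwards [ENNReal.ae_le_essSup (μ := μ) F] with x hx
    gcongr
  rcases eq_or_ne p 1 with rfl | h1
  · have : ENNReal.conjExponent 1 = ⊤ := by simp [ENNReal.conjExponent]
    rw [this, eLpNorm_ennreal_top, eLpNorm_ennreal_one, ← lintegral_mul_const'' _ hF]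
    refine lintegral_mono_ae ?_
    filter_upwards [ENNReal.ae_le_essSup (μ := μ) G] with x hx
    gcongr
  have h1p : 1 < p := lt_of_le_of_ne hp (Ne.symm h1)
  have hct : p.conjExponent ≠ ⊤ := by
    intro h
    rw [h] at hc
    have h2 := hc.inv_eq
    simp only [inv_one, ENNReal.inv_top, add_zero] at h2
    exact h1 (by rw [← inv_inv p, ← h2, inv_one])
  have hc0 : p.conjExponent ≠ 0 := by
    have := hc.symm.one_le
    intro h; rw [h] at this; simp at this
  have hr : (p.toReal).HolderConjugate (p.conjExponent.toReal) := by
    have := hc.inv_add_inv_eq_one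
    refine ⟨?_, ENNReal.toReal_pos (by positivity) ht, ENNReal.toReal_pos hc0 hct⟩
    have h2 := congrArg ENNReal.toReal this
    rw [ENNReal.toReal_add (by simp; positivity) (by simpa using hc0)] at h2
    simpa using h2
  rw [eLpNorm_ennreal_ne_top (by positivity) ht, eLpNorm_ennreal_ne_top hc0 hct]
  exact ENNReal.lintegral_mul_le_Lp_mul_Lq μ hr hF hG

/-- Minkowski's integral inequality. -/
theorem eLpNorm_lintegral_le [SigmaFinite μ] [SFinite ν] {p : ℝ≥0∞} (hp : 1 ≤ p)
    {F : X → Y → ℝ≥0∞} (hF : Measurable (Function.uncurry F)) :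
    eLpNorm (fun x => ∫⁻ y, F x y ∂ν) p μ ≤ ∫⁻ y, eLpNorm (fun x => F x y) p μ ∂ν := by
  rcases eq_or_ne p ⊤ with rfl | ht
  · simpa only [eLpNorm_ennreal_top] using essSup_lintegral_le hF
  rcases eq_or_ne p 1 with rfl | h1
  · simp_rw [eLpNorm_ennreal_one]
    rw [lintegral_lintegral_swap hF.aemeasurable]
  have h1p : 1 < p := lt_of_le_of_ne hp (Ne.symm h1)
  have hp0 : p ≠ 0 := by positivity
  set P := p.toReal with hP
  have hP1 : 1 < P := by
    rw [hP, ← ENNReal.toReal_one]; exact (ENNReal.toReal_lt_toReal (by simp) ht).2 h1p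
  have hP0 : 0 < P := by linarith
  have hconj : (P / (P - 1)).HolderConjugate P :=
    (Real.HolderConjugate.conjExponent hP1).symm
  set S := ∫⁻ y, eLpNorm (fun x => F x y) p μ ∂ν with hS
  set G : X → ℝ≥0∞ := fun x => ∫⁻ y, F x y ∂ν with hG
  have hGm : Measurable G := hF.lintegral_prod_right
  -- truncations
  set A := spanningSets μ with hA
  let T : ℕ → X → ℝ≥0∞ := fun k => (A k).indicator (fun x => min (G x) k)
  have hTm : ∀ k, Measurable (T k) := fun k =>
    (hGm.min measurable_const).indicator (measurableSet_spanningSets μ k)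
  have hTG : ∀ k x, T k x ≤ G x := fun k x =>
    (Set.indicator_le_self' (by simp) x).trans (min_le_left _ _)
  have hIfin : ∀ k, ∫⁻ x, T k x ^ P ∂μ ≠ ⊤ := by
    intro k
    refine ne_of_lt (lt_of_le_of_lt (b := ∫⁻ x in A k, (k : ℝ≥0∞) ^ P ∂μ) ?_ ?_)
    · rw [← lintegral_indicator (measurableSet_spanningSets μ k)]
      refine lintegral_mono fun x => ?_
      by_cases hx : x ∈ A k
      · simp only [T, Set.indicator_of_mem hx]
        rw [Set.indicator_of_mem (show x ∈ spanningSets μ k from hx)]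
        exact ENNReal.rpow_le_rpow (min_le_right _ _) hP0.le
      · simp [T, Set.indicator_of_notMem hx, hP0]
    · rw [lintegral_const]
      refine ENNReal.mul_lt_top (ENNReal.rpow_lt_top_of_nonneg hP0.le (by simp)) ?_
      simpa using measure_spanningSets_lt_top μ k
  -- Hölder gives `I ≤ I ^ (1 - 1 / P) * S`. Cancelling the power of `I` requires `I` to be finite,
  -- which is the purpose of the truncations.
  have hbound : ∀ k, (∫⁻ x, T k x ^ P ∂μ) ^ (1 / P) ≤ S := by
    intro k
    set I := ∫⁻ x, T k x ^ P ∂μ with hI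
    rcases eq_or_ne I 0 with h0 | h0
    · rw [h0, ENNReal.zero_rpow_of_pos (by positivity)]; exact zero_le
    have hmain : I ≤ I ^ (1 / (P / (P - 1))) * S := by
      calc I ≤ ∫⁻ x, T k x ^ (P - 1) * G x ∂μ := by
            refine lintegral_mono fun x => ?_
            have : T k x ^ P = T k x ^ (P - 1) * T k x := by
              conv_rhs => rw [← ENNReal.rpow_one (T k x), ← ENNReal.rpow_mul, one_mul]
              rw [← ENNReal.rpow_add_of_nonneg _ _ (by linarith) (by norm_num)]
              simp
            rw [this]
            gcongr
            exact hTG k x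
        _ = ∫⁻ x, ∫⁻ y, T k x ^ (P - 1) * F x y ∂ν ∂μ := by
            refine lintegral_congr fun x => ?_
            rw [hG, lintegral_const_mul]
            exact hF.of_uncurry_left
        _ = ∫⁻ y, ∫⁻ x, T k x ^ (P - 1) * F x y ∂μ ∂ν := by
            refine lintegral_lintegral_swap (Measurable.aemeasurable ?_)
            exact (((hTm k).comp measurable_fst).pow_const _).mul hF
        _ ≤ ∫⁻ y, I ^ (1 / (P / (P - 1))) * eLpNorm (fun x => F x y) p μ ∂ν := by
            refine lintegral_mono fun y => ?_
            refine (ENNReal.lintegral_mul_le_Lp_mul_Lq μ hconj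
              ((hTm k).pow_const _).aemeasurable
              (hF.of_uncurry_right (y := y)).aemeasurable).trans ?_
            rw [eLpNorm_ennreal_ne_top hp0 ht]
            gcongr
            refine le_of_eq (lintegral_congr fun x => ?_)
            rw [← ENNReal.rpow_mul]
            congr 1
            have : P - 1 ≠ 0 := by linarith
            field_simp
        _ = I ^ (1 / (P / (P - 1))) * S := by
            rw [lintegral_const_mul _ (measurable_eLpNorm_section hF p)]
    have hsplit : I = I ^ (1 / (P / (P - 1))) * I ^ (1 / P) := by
      rw [← ENNReal.rpow_add _ _ h0 (hIfin k)]
      have : 1 / (P / (P - 1)) + 1 / P = 1 := by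
        have : P - 1 ≠ 0 := by linarith
        field_simp
        ring
      rw [this, ENNReal.rpow_one]
    have hne0 : I ^ (1 / (P / (P - 1))) ≠ 0 := by
      have : 0 < P - 1 := by linarith
      have h2 : ¬ 1 / (P / (P - 1)) < 0 := not_lt.2 (by positivity)
      simp [ENNReal.rpow_eq_zero_iff, h0, h2, -one_div]
    have hnet : I ^ (1 / (P / (P - 1))) ≠ ⊤ :=
      ENNReal.rpow_ne_top_of_nonneg (by
        have : 0 < P - 1 := by linarith
        positivity) (hIfin k)
    conv_lhs at hmain => rw [hsplit]
    exact (ENNReal.mul_le_mul_iff_right hne0 hnet).1 hmain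
  have hsup : ∀ x, ⨆ k, T k x ^ P = G x ^ P := by
    intro x
    have hmono : Monotone fun k => T k x := by
      intro i j hij
      simp only [T]
      refine (Set.indicator_le_indicator_of_subset (monotone_spanningSets μ hij) (by simp) x).trans ?_
      refine Set.indicator_le_indicator ?_
      exact min_le_min_left _ (by exact_mod_cast hij)
    have hT : Filter.Tendsto (fun k => T k x) Filter.atTop (nhds (G x)) := by
      have h2 : Filter.Tendsto (fun k : ℕ => min (G x) (k : ℝ≥0∞)) Filter.atTop (nhds (min (G x) ⊤)) :=
        tendsto_const_nhds.min ENNReal.tendsto_nat_nhds_top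
      rw [min_eq_left le_top] at h2
      refine h2.congr' ?_
      filter_upwards [Filter.eventually_ge_atTop (spanningSetsIndex μ x)] with k hk
      simp only [T]
      rw [Set.indicator_of_mem]
      exact mem_spanningSets_of_index_le μ x hk
    have h3 : Filter.Tendsto (fun k => T k x ^ P) Filter.atTop (nhds (G x ^ P)) :=
      (ENNReal.continuous_rpow_const.tendsto _).comp hT
    exact iSup_eq_of_tendsto (fun i j hij => ENNReal.rpow_le_rpow (hmono hij) hP0.le) h3
  have hmonoT : Monotone fun k x => T k x ^ P := by
    intro i j hij x
    refine ENNReal.rpow_le_rpow ?_ hP0.le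
    simp only [T]
    refine (Set.indicator_le_indicator_of_subset (monotone_spanningSets μ hij) (by simp) x).trans ?_
    refine Set.indicator_le_indicator ?_
    exact min_le_min_left _ (by exact_mod_cast hij)
  rw [eLpNorm_ennreal_ne_top hp0 ht]
  have : ∫⁻ x, G x ^ P ∂μ = ⨆ k, ∫⁻ x, T k x ^ P ∂μ := by
    rw [← lintegral_iSup (fun k => (hTm k).pow_const _) hmonoT]
    exact lintegral_congr fun x => (hsup x).symm
  rw [one_div, ENNReal.rpow_inv_le_iff hP0, this]
  refine iSup_le fun k => ?_
  rw [← ENNReal.rpow_inv_le_iff hP0, ← one_div]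
  exact hbound k

/-- Minkowski's integral inequality for a function dominated by an integral. -/
theorem eLpNorm_le_mul_lintegral [SigmaFinite μ] [SFinite ν] {p : ℝ≥0∞} (hp : 1 ≤ p)
    {ε : Type*} [ENorm ε] {f : X → ε} {c : ℝ≥0∞} (hc : c ≠ ⊤)
    {F : X → Y → ℝ≥0∞} (hF : Measurable (Function.uncurry F))
    (h : ∀ x, ‖f x‖ₑ ≤ c * ∫⁻ y, F x y ∂ν) :
    eLpNorm f p μ ≤ c * ∫⁻ y, eLpNorm (fun x => F x y) p μ ∂ν := by
  have h1 : eLpNorm f p μ ≤ eLpNorm (fun x => c * ∫⁻ y, F x y ∂ν) p μ :=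
    eLpNorm_mono_enorm fun x => by rw [enorm_eq_self]; exact h x
  exact h1.trans ((eLpNorm_const_mul_le hc _).trans
    (mul_le_mul_right (eLpNorm_lintegral_le hp hF) _))

theorem eLpNorm_tsum_le [SigmaFinite μ] {p : ℝ≥0∞} (hp : 1 ≤ p) {F : ℕ → X → ℝ≥0∞}
    (hF : ∀ k, Measurable (F k)) :
    eLpNorm (fun x => ∑' k, F k x) p μ ≤ ∑' k, eLpNorm (F k) p μ := by
  have := eLpNorm_lintegral_le (μ := μ) (ν := Measure.count) hp (F := fun x k => F k x)
    (measurable_from_prod_countable_left fun k => hF k)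
  simpa [lintegral_count] using this

theorem eLpNorm_ennreal_add_le {p : ℝ≥0∞} (hp : 1 ≤ p) {F G : X → ℝ≥0∞}
    (hF : Measurable F) (hG : Measurable G) :
    eLpNorm (fun x => F x + G x) p μ ≤ eLpNorm F p μ + eLpNorm G p μ :=
  eLpNorm_add_le hF.aestronglyMeasurable hG.aestronglyMeasurable hp

end ENNRealLp

/-! ### Young's inequality with one factor in `L¹`. -/

section Young

variable {E : Type*} [AddCommGroup E] [MeasurableSpace E] [MeasurableAdd₂ E] [MeasurableNeg E]
  {μ : Measure E} [μ.IsAddLeftInvariant]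

/-- Young's inequality `‖a * b‖_q ≤ ‖a‖_q ‖b‖_1`. -/
theorem eLpNorm_lconv_le [SigmaFinite μ] {q : ℝ≥0∞} (hq : 1 ≤ q) {a b : E → ℝ≥0∞} (ha : Measurable a)
    (hb : Measurable b) :
    eLpNorm (fun x => ∫⁻ y, a (x - y) * b y ∂μ) q μ ≤ eLpNorm a q μ * ∫⁻ y, b y ∂μ := by
  have hm : Measurable (Function.uncurry fun x y => a (x - y) * b y) :=
    (ha.comp (measurable_fst.sub measurable_snd)).mul (hb.comp measurable_snd)
  refine (eLpNorm_lintegral_le hq hm).trans ?_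
  -- Infinite values are separated because `0 * ⊤ = 0`: if the norm of `a` is infinite while `b`
  -- vanishes almost everywhere, the right side is `0`, and so must be the left.
  by_cases hA : eLpNorm a q μ = ⊤
  · by_cases hB : ∫⁻ y, b y ∂μ = 0
    · rw [lintegral_eq_zero_iff hb] at hB
      rw [lintegral_congr_ae (g := 0)]
      · simp
      · filter_upwards [hB] with y hy
        simp [hy]
    · rw [hA, ENNReal.top_mul hB]; exact le_top
  · rw [← lintegral_const_mul _ hb]
    refine lintegral_mono_ae (Filter.Eventually.of_forall fun y => ?_)
    have h1 : eLpNorm (fun x => a (x - y)) q μ = eLpNorm a q μ :=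
      eLpNorm_comp_measurePreserving (ε := ℝ≥0∞) ha.aestronglyMeasurable
        (measurePreserving_sub_right μ y)
    by_cases hy : b y = ⊤
    · rw [hy]
      by_cases hA0 : eLpNorm a q μ = 0
      · have h2 := (eLpNorm_eq_zero_iff (ε := ℝ≥0∞)
          (ha.comp (measurable_id.sub_const y)).aestronglyMeasurable
          (by positivity)).1 (h1.trans hA0)
        rw [hA0, zero_mul, eLpNorm_congr_ae (g := fun _ => 0)]
        · simp
        · filter_upwards [h2] with x hx
          simp only [Function.comp, id, Pi.zero_apply] at hx
          simp [hx]
      · rw [ENNReal.mul_top hA0]; exact le_top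
    · refine le_trans ?_ ((eLpNorm_const_mul_le hy (fun x => a (x - y))).trans (by rw [h1, mul_comm]))
      exact eLpNorm_ennreal_mono fun x => by rw [mul_comm]

theorem lintegral_conv_comm [μ.IsNegInvariant] (a b : E → ℝ≥0∞) (x : E) :
    ∫⁻ y, a y * b (x - y) ∂μ = ∫⁻ y, a (x - y) * b y ∂μ := by
  rw [← lintegral_sub_left_eq_self _ x]
  simp

end Young

/-! ### Characters, modulations, convolution and Fourier inversion. -/

section Convolution

variable {E : Type*} [NormedAddCommGroup E] [InnerProductSpace ℝ E]

/-- The character `t ↦ e^{i t·ξ}`. -/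
noncomputable def phase (ξ t : E) : ℂ := Complex.exp (Complex.I * (inner ℝ t ξ : ℝ))

theorem norm_phase (ξ t : E) : ‖phase ξ t‖ = 1 := by
  simp [phase, Complex.norm_exp]

theorem enorm_phase (ξ t : E) : ‖phase ξ t‖ₑ = 1 := by
  rw [← ofReal_norm, norm_phase]; simp

theorem phase_add_left (ξ η t : E) : phase (ξ + η) t = phase ξ t * phase η t := by
  simp only [phase, ← Complex.exp_add, inner_add_right]
  push_cast; ring_nf

theorem phase_add_right (ξ t s : E) : phase ξ (t + s) = phase ξ t * phase ξ s := by
  simp only [phase, ← Complex.exp_add, inner_add_left]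
  push_cast; ring_nf

theorem phase_zero_left (t : E) : phase (0 : E) t = 1 := by simp [phase]

theorem phase_zero_right (ξ : E) : phase ξ (0 : E) = 1 := by simp [phase]

theorem phase_neg_left (ξ t : E) : phase (-ξ) t = (starRingEnd ℂ) (phase ξ t) := by
  simp only [phase, ← Complex.exp_conj, inner_neg_right, map_mul, Complex.conj_I,
    Complex.conj_ofReal]
  push_cast; ring_nf

theorem phase_neg_right (ξ t : E) : phase ξ (-t) = phase (-ξ) t := by
  simp [phase]

theorem phase_mul_neg (ξ t : E) : phase ξ t * phase (-ξ) t = 1 := by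
  rw [← phase_add_left]; simp [phase_zero_left]

theorem continuous_phase_uncurry : Continuous fun z : E × E => phase z.1 z.2 := by
  unfold phase
  exact (continuous_const.mul (Complex.continuous_ofReal.comp
    (continuous_snd.inner continuous_fst))).cexp

theorem continuous_phase {X : Type*} [TopologicalSpace X] {f g : X → E} (hf : Continuous f)
    (hg : Continuous g) : Continuous fun x => phase (f x) (g x) :=
  continuous_phase_uncurry.comp (hf.prodMk hg)

/-- Bounded continuous complex functions. -/
structure BddCont {X : Type*} [TopologicalSpace X] (g : X → ℂ) : Prop where
  cont : Continuous g
  bdd : ∃ C, ∀ x, ‖g x‖ ≤ C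

theorem BddCont.mul {X : Type*} [TopologicalSpace X] {g h : X → ℂ} (hg : BddCont g)
    (hh : BddCont h) : BddCont fun x => g x * h x := by
  obtain ⟨C, hC⟩ := hg.bdd
  obtain ⟨D, hD⟩ := hh.bdd
  refine ⟨hg.cont.mul hh.cont, C * D, fun x => ?_⟩
  rw [norm_mul]
  exact mul_le_mul (hC x) (hD x) (norm_nonneg _) ((norm_nonneg _).trans (hC x))

theorem BddCont.add {X : Type*} [TopologicalSpace X] {g h : X → ℂ} (hg : BddCont g)
    (hh : BddCont h) : BddCont fun x => g x + h x := by
  obtain ⟨C, hC⟩ := hg.bdd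
  obtain ⟨D, hD⟩ := hh.bdd
  exact ⟨hg.cont.add hh.cont, C + D, fun x => (norm_add_le _ _).trans (add_le_add (hC x) (hD x))⟩

theorem BddCont.const {X : Type*} [TopologicalSpace X] (c : ℂ) : BddCont fun _ : X => c :=
  ⟨continuous_const, ‖c‖, fun _ => le_rfl⟩

/-- The modulation `M_ξ θ (t) = e^{i t·ξ} θ(t)`. -/
noncomputable def modul (ξ : E) (θ : E → ℂ) (t : E) : ℂ := θ t * phase ξ t

theorem norm_modul (ξ : E) (θ : E → ℂ) (t : E) : ‖modul ξ θ t‖ = ‖θ t‖ := by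
  simp [modul, norm_phase]

theorem enorm_modul (ξ : E) (θ : E → ℂ) (t : E) : ‖modul ξ θ t‖ₑ = ‖θ t‖ₑ := by
  simp [modul, enorm_phase, enorm_mul]

variable [FiniteDimensional ℝ E] [MeasurableSpace E] [BorelSpace E]

/-- Continuous integrable functions. -/
structure IsWindow (θ : E → ℂ) : Prop where
  cont : Continuous θ
  int : Integrable θ

/-- Convolution of functions on `E`. -/
noncomputable def cv (g a : E → ℂ) (x : E) : ℂ := ∫ t, g (x - t) * a t

theorem IsWindow.modul {θ : E → ℂ} (hθ : IsWindow θ) (ξ : E) : IsWindow (modul ξ θ) := by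
  have hc : Continuous (GevreyModulation.modul ξ θ) :=
    hθ.cont.mul (continuous_phase continuous_const continuous_id)
  refine ⟨hc, ?_⟩
  rw [← integrable_norm_iff hc.aestronglyMeasurable]
  simpa only [norm_modul] using hθ.int.norm

variable {g a b θ ϑ : E → ℂ}

theorem integrable_cv_integrand (hg : BddCont g) (ha : Integrable a) (x : E) :
    Integrable fun t => g (x - t) * a t := by
  obtain ⟨C, hC⟩ := hg.bdd
  refine ha.bdd_mul (c := C) ?_ (Filter.Eventually.of_forall fun t => hC _)
  exact (hg.cont.comp (continuous_const.sub continuous_id)).aestronglyMeasurable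

theorem norm_cv_le {C : ℝ} (hC : ∀ x, ‖g x‖ ≤ C) (ha : Integrable a) (x : E) :
    ‖cv g a x‖ ≤ C * ∫ t, ‖a t‖ := by
  rw [cv, ← integral_const_mul]
  refine norm_integral_le_of_norm_le (ha.norm.const_mul C) (Filter.Eventually.of_forall fun t => ?_)
  rw [norm_mul]
  exact mul_le_mul_of_nonneg_right (hC _) (norm_nonneg _)

theorem BddCont.cv (hg : BddCont g) (ha : Integrable a) : BddCont (cv g a) := by
  obtain ⟨C, hC⟩ := hg.bdd
  refine ⟨?_, _, norm_cv_le hC ha⟩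
  refine continuous_of_dominated (bound := fun t => C * ‖a t‖)
    (fun x => (integrable_cv_integrand hg ha x).aestronglyMeasurable) (fun x => ?_)
    (ha.norm.const_mul C) ?_
  · refine Filter.Eventually.of_forall fun t => ?_
    rw [norm_mul]
    exact mul_le_mul_of_nonneg_right (hC _) (norm_nonneg _)
  · refine Filter.Eventually.of_forall fun t => ?_
    exact (hg.cont.comp (continuous_id.sub continuous_const)).mul continuous_const

theorem continuous_cv_modul (hg : BddCont g) (hθ : IsWindow θ) :
    Continuous fun z : E × E => cv g (modul z.2 θ) z.1 := by
  obtain ⟨C, hC⟩ := hg.bdd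
  refine continuous_of_dominated (bound := fun t => C * ‖θ t‖)
    (fun z => (integrable_cv_integrand hg (hθ.modul z.2).int z.1).aestronglyMeasurable) (fun x => ?_)
    (hθ.int.norm.const_mul C) ?_
  · refine Filter.Eventually.of_forall fun t => ?_
    rw [norm_mul, norm_modul]
    exact mul_le_mul_of_nonneg_right (hC _) (norm_nonneg _)
  · refine Filter.Eventually.of_forall fun t => ?_
    exact (hg.cont.comp (continuous_fst.sub continuous_const)).mul
      (continuous_const.mul (continuous_phase continuous_snd continuous_const))

theorem enorm_cv_le (g a : E → ℂ) (x : E) : ‖cv g a x‖ₑ ≤ ∫⁻ t, ‖g (x - t)‖ₑ * ‖a t‖ₑ := by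
  refine (enorm_integral_le_lintegral_enorm _).trans_eq ?_
  simp_rw [enorm_mul]

theorem eLpNorm_cv_le {p : ℝ≥0∞} (hp : 1 ≤ p) (hg : Measurable g) (ha : Measurable a) :
    eLpNorm (cv g a) p ≤ eLpNorm g p * ∫⁻ t, ‖a t‖ₑ := by
  rw [← eLpNorm_enorm g]
  refine le_trans ?_ (eLpNorm_lconv_le hp hg.enorm ha.enorm)
  exact eLpNorm_mono_enorm fun x => by simpa using enorm_cv_le g a x

theorem enorm_cv_le_mul {p : ℝ≥0∞} (hp : 1 ≤ p) (hg : Measurable g) (ha : Measurable a) (x : E) :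
    ‖cv g a x‖ₑ ≤ eLpNorm g p * eLpNorm a p.conjExponent := by
  refine (enorm_cv_le g a x).trans ?_
  refine (lintegral_mul_le_eLpNorm_mul hp (F := fun t => ‖g (x - t)‖ₑ)
    (hg.enorm.comp (measurable_const.sub measurable_id)).aemeasurable
    ha.enorm.aemeasurable).trans_eq ?_
  rw [eLpNorm_enorm a]
  congr 1
  have := eLpNorm_comp_measurePreserving (p := p) (hg.aestronglyMeasurable (μ := volume))
    (Measure.measurePreserving_sub_left (volume : Measure E) x)
  rw [← this, ← eLpNorm_enorm]
  rfl

theorem cv_comm (a b : E → ℂ) (x : E) : cv a b x = cv b a x := by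
  rw [cv, ← integral_sub_left_eq_self _ _ x, cv]
  simp [mul_comm]

theorem integrable_conv_prod (ha : Integrable a) (hb : Integrable b) :
    Integrable (fun z : E × E => a (z.1 - z.2) * b z.2) (volume.prod volume) := by
  have := (hb.convolution_integrand (ContinuousLinearMap.mul ℝ ℂ) (ha))
  simpa [mul_comm] using this

theorem Integrable.cv (ha : Integrable a) (hb : Integrable b) :
    Integrable (cv a b) :=
  (integrable_conv_prod ha hb).integral_prod_left

theorem cv_assoc (hg : BddCont g) (ha : Integrable a) (hb : Integrable b) (x : E) :
    cv (cv g a) b x = cv g (cv a b) x := by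
  obtain ⟨C, hC⟩ := hg.bdd
  have h1 : cv (cv g a) b x = ∫ t, ∫ r, g (x - r) * (a (r - t) * b t) := by
    unfold cv
    refine integral_congr_ae (Filter.Eventually.of_forall fun t => ?_)
    beta_reduce
    rw [← integral_mul_const, ← integral_sub_right_eq_self _ t]
    refine integral_congr_ae (Filter.Eventually.of_forall fun r => ?_)
    beta_reduce
    rw [mul_assoc]
    congr 2
    abel
  rw [h1, integral_integral_swap]
  · unfold cv
    simp_rw [integral_const_mul]
  · have h2 : Integrable (fun z : E × E => g (x - z.1) * (a (z.1 - z.2) * b z.2))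
        (volume.prod volume) :=
      (integrable_conv_prod ha hb).bdd_mul (c := C)
        (hg.cont.comp (continuous_const.sub continuous_fst)).aestronglyMeasurable
        (Filter.Eventually.of_forall fun z => hC _)
    exact h2.swap

theorem modul_cv (ξ : E) (a b : E → ℂ) : modul ξ (cv a b) = cv (modul ξ a) (modul ξ b) := by
  funext x
  unfold modul cv
  rw [← integral_mul_const]
  refine integral_congr_ae (Filter.Eventually.of_forall fun t => ?_)
  beta_reduce
  have : phase ξ x = phase ξ (x - t) * phase ξ t := by rw [← phase_add_right]; simp
  rw [this]; ring

/-- Fourier inversion at the origin. -/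
theorem integral_integral_mul_phase {F : E → ℂ} (hc : Continuous F) (hF : Integrable F)
    (hF' : Integrable fun ξ => ∫ t, F t * phase ξ t) :
    ∫ ξ, ∫ t, F t * phase ξ t = ((2 * Real.pi) ^ Module.finrank ℝ E : ℝ) * F 0 := by
  have hpi : (2 * Real.pi) ≠ 0 := by positivity
  -- The standard Fourier kernel carries `2π` in the exponent and `phase` does not. The Jacobian of
  -- this dilation produces the factor `(2π)^d`.
  have h1 : ∀ w : E, FourierTransformInv.fourierInv F w
      = (fun ξ => ∫ t, F t * phase ξ t) ((2 * Real.pi) • w) := by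
    intro w
    rw [Real.fourierInv_eq']
    refine integral_congr_ae (Filter.Eventually.of_forall fun t => ?_)
    simp only [phase, smul_eq_mul, inner_smul_right]
    rw [mul_comm]
    congr 2
    push_cast; ring
  have h2 : Integrable (FourierTransformInv.fourierInv F) := by
    rw [show FourierTransformInv.fourierInv F
      = fun w => (fun ξ => ∫ t, F t * phase ξ t) ((2 * Real.pi) • w) from funext h1]
    exact (integrable_comp_smul_iff volume _ hpi).2 hF'
  have h3 : Integrable (FourierTransform.fourier F) := by
    have : FourierTransform.fourier F = fun w => FourierTransformInv.fourierInv F (-w) := by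
      funext w
      rw [Real.fourierInv_eq_fourier_neg, neg_neg]
    rw [this]
    exact h2.comp_neg
  have h4 : FourierTransform.fourier (FourierTransformInv.fourierInv F) 0 = F 0 :=
    hF.fourier_fourierInv_eq h3 hc.continuousAt
  rw [← h4, Real.fourier_eq']
  simp only [inner_zero_right, mul_zero, Complex.ofReal_zero, zero_mul, Complex.exp_zero, one_smul]
  simp_rw [h1]
  rw [Measure.integral_comp_smul volume (fun ξ => ∫ t, F t * phase ξ t), abs_of_pos (by positivity), Complex.real_smul, ← mul_assoc]
  rw [← Complex.ofReal_mul, mul_inv_cancel₀ (by positivity)]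
  simp

theorem integral_cv_modul (hg : BddCont g) (hθ : IsWindow θ) (x : E)
    (hi : Integrable fun ξ => cv g (modul ξ θ) x) :
    ∫ ξ, cv g (modul ξ θ) x = ((2 * Real.pi) ^ Module.finrank ℝ E : ℝ) * (g x * θ 0) := by
  have h1 : ∀ ξ, cv g (modul ξ θ) x = ∫ t, (g (x - t) * θ t) * phase ξ t := by
    intro ξ
    simp only [cv, modul, mul_assoc]
  simp_rw [h1] at hi ⊢
  rw [integral_integral_mul_phase _ (integrable_cv_integrand hg hθ.int x) hi]
  · simp
  · exact (hg.cont.comp (continuous_const.sub continuous_id)).mul hθ.cont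

/-- Either the integrand is integrable and the inversion formula applies, or the right side is
infinite. No integrability is assumed, so windows can be compared before any norm is known to be
finite. -/
theorem enorm_mul_le_lintegral_cv_modul (hg : BddCont g) (hθ : IsWindow θ) (x : E) :
    ENNReal.ofReal ((2 * Real.pi) ^ Module.finrank ℝ E) * (‖g x‖ₑ * ‖θ 0‖ₑ) ≤
      ∫⁻ ξ, ‖cv g (modul ξ θ) x‖ₑ := by
  by_cases hi : Integrable fun ξ => cv g (modul ξ θ) x
  · refine le_trans (le_of_eq ?_) (enorm_integral_le_lintegral_enorm _)
    rw [integral_cv_modul hg hθ x hi, enorm_mul, enorm_mul]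
    congr 1
    rw [← ofReal_norm, Complex.norm_real, Real.norm_of_nonneg (by positivity)]
  · have hm : AEStronglyMeasurable (fun ξ => cv g (modul ξ θ) x) volume :=
      ((continuous_cv_modul hg hθ).comp (continuous_const.prodMk continuous_id)).aestronglyMeasurable
    have : ∫⁻ ξ, ‖cv g (modul ξ θ) x‖ₑ = ⊤ := by
      by_contra h
      exact hi ⟨hm, lt_top_iff_ne_top.2 h⟩
    rw [this]; exact le_top

end Convolution

/-! ### Polynomial and subexponential decay, and interpolation between them. -/

section Decay

theorem eLpNorm_lt_top_of_le_one {X : Type*} [MeasurableSpace X] {μ : Measure X} {F : X → ℝ≥0∞}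
    (h1 : ∀ x, F x ≤ 1) (hF : ∫⁻ x, F x ∂μ < ⊤) {p : ℝ≥0∞} (hp : 1 ≤ p) :
    eLpNorm F p μ < ⊤ := by
  rcases eq_or_ne p ⊤ with rfl | ht
  · rw [eLpNorm_ennreal_top]
    exact (essSup_le_of_ae_le 1 (Filter.Eventually.of_forall h1)).trans_lt (by simp)
  have hp0 : p ≠ 0 := (zero_lt_one.trans_le hp).ne'
  have hP : 1 ≤ p.toReal := by
    rw [← ENNReal.toReal_one]; exact (ENNReal.toReal_le_toReal (by simp) ht).2 hp
  rw [eLpNorm_ennreal_ne_top hp0 ht]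
  refine ENNReal.rpow_lt_top_of_nonneg (by positivity) (ne_of_lt (lt_of_le_of_lt ?_ hF))
  exact lintegral_mono fun x => ENNReal.rpow_le_self_of_le_one (h1 x) hP

theorem exists_pow_mul_exp_neg_rpow_le {r c : ℝ} (hr : 0 < r) (hc : 0 < c) (N : ℕ) :
    ∃ C : ℝ, 0 < C ∧ ∀ t : ℝ, 0 ≤ t → (1 + t) ^ N * Real.exp (-(c * t ^ r)) ≤ C := by
  -- Since `k * r ≥ N`, for `t ≥ 1` the power `t ^ N` is dominated by `(t ^ r) ^ k`, hence by a
  -- single term of the exponential series.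
  obtain ⟨k, hk⟩ := exists_nat_ge (N / r)
  refine ⟨2 ^ N * (1 + k.factorial / c ^ k), by positivity, fun t ht => ?_⟩
  rcases le_or_gt t 1 with h1 | h1
  · have h2 : Real.exp (-(c * t ^ r)) ≤ 1 := Real.exp_le_one_iff.2 (by
      have := Real.rpow_nonneg ht r
      nlinarith)
    have h3 : (1 + t) ^ N ≤ 2 ^ N := pow_le_pow_left₀ (by linarith) (by linarith) N
    calc (1 + t) ^ N * Real.exp (-(c * t ^ r)) ≤ 2 ^ N * 1 := by gcongr
      _ ≤ _ := by
        gcongr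
        have : 0 ≤ (k.factorial : ℝ) / c ^ k := by positivity
        linarith
  · have hx : 0 ≤ c * t ^ r := by positivity
    have h2 := Real.pow_div_factorial_le_exp (c * t ^ r) hx k
    have h3 : t ^ N ≤ (t ^ r) ^ k := by
      rw [← Real.rpow_natCast, ← Real.rpow_natCast (t ^ r), ← Real.rpow_mul ht]
      refine Real.rpow_le_rpow_of_exponent_le h1.le ?_
      rwa [div_le_iff₀ hr, mul_comm] at hk
    have h4 : (1 + t) ^ N ≤ 2 ^ N * t ^ N := by
      rw [← mul_pow]; exact pow_le_pow_left₀ (by linarith) (by linarith) N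
    have h5 : t ^ N ≤ k.factorial / c ^ k * Real.exp (c * t ^ r) := by
      rw [mul_pow, div_le_iff₀ (by positivity)] at h2
      calc t ^ N ≤ (t ^ r) ^ k := h3
        _ = (c ^ k * (t ^ r) ^ k) / c ^ k := by field_simp
        _ ≤ (Real.exp (c * t ^ r) * k.factorial) / c ^ k := by gcongr
        _ = _ := by ring
    rw [Real.exp_neg]
    calc (1 + t) ^ N * (Real.exp (c * t ^ r))⁻¹
        ≤ (2 ^ N * (k.factorial / c ^ k * Real.exp (c * t ^ r))) * (Real.exp (c * t ^ r))⁻¹ := by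
          gcongr
          exact h4.trans (by gcongr)
      _ = 2 ^ N * (k.factorial / c ^ k) := by
          field_simp
      _ ≤ _ := by gcongr; linarith

theorem norm_rpow_le_add {r : ℝ} (hr : 0 < r) (hr1 : r < 1) {E : Type*} [NormedAddCommGroup E] (x y : E) :
    ‖x + y‖ ^ r ≤ ‖x‖ ^ r + ‖y‖ ^ r :=
  (Real.rpow_le_rpow (norm_nonneg _) (norm_add_le x y) hr.le).trans
    (Real.rpow_add_le_add_rpow (norm_nonneg _) (norm_nonneg _) hr.le hr1.le)

theorem schwartz_pow_le {E : Type*} [NormedAddCommGroup E] [NormedSpace ℝ E] (θ : 𝓢(E, ℂ)) (N : ℕ) :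
    ∃ C : ℝ, 0 < C ∧ ∀ x, (1 + ‖x‖) ^ N * ‖θ x‖ ≤ C := by
  have h := SchwartzMap.one_add_le_sup_seminorm_apply (𝕜 := ℝ) (m := (N, 0)) (k := N) (n := 0)
    le_rfl le_rfl θ
  simp only [norm_iteratedFDeriv_zero] at h
  exact ⟨max _ 1, lt_max_of_lt_right one_pos, fun x => (h x).trans (le_max_left _ _)⟩

theorem bddCont_schwartz {E : Type*} [NormedAddCommGroup E] [NormedSpace ℝ E] (θ : 𝓢(E, ℂ)) : BddCont θ := by
  obtain ⟨C, _, hC⟩ := schwartz_pow_le θ 0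
  exact ⟨θ.continuous, C, fun x => by simpa using hC x⟩

/-- Interpolation between rapid decay in space and subexponential decay in frequency. -/
theorem exists_kernel_bound {E : Type*} [NormedAddCommGroup E]
    {V : E → E → E → ℂ} (d : ℕ) {r κ κ' C : ℝ} (hκ' : 0 ≤ κ') (hκ : κ' < κ)
    (h1 : ∀ N : ℕ, ∃ C : ℝ, 0 < C ∧ ∀ ξ η y, (1 + ‖y‖) ^ N * ‖V ξ η y‖ ≤ C)
    (h2 : ∀ ξ η y, ‖V ξ η y‖ ≤ C * Real.exp (-(κ * ‖ξ - η‖ ^ r))) :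
    ∃ D : ℝ, 0 < D ∧ ∀ ξ η y, ‖V ξ η y‖ₑ ≤
      ENNReal.ofReal ((1 + ‖y‖) ^ (-((d + 1 : ℕ) : ℝ))) *
      ENNReal.ofReal (D * Real.exp (-(κ' * ‖ξ - η‖ ^ r))) := by
  have hκ0 : 0 < κ := by linarith
  -- The kernel is at most the geometric mean of its two bounds with exponents `τ` and `1 - τ = κ' /
  -- κ`. The second turns the rate `κ` into `κ'`, and `N` is taken with `N * τ ≥ d + 1` so that the
  -- first keeps integrable decay in space.
  set τ : ℝ := (κ - κ') / κ with hτ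
  have hτ0 : 0 < τ := by have : 0 < κ - κ' := by linarith
                         positivity
  have hτ1 : 1 - τ = κ' / κ := by rw [hτ]; field_simp; ring
  obtain ⟨N, hN⟩ := exists_nat_ge ((d + 1 : ℕ) / τ)
  obtain ⟨C₁, hC₁, hV⟩ := h1 N
  have hτ2 : 0 ≤ 1 - τ := by rw [hτ1]; positivity
  set D := C₁ ^ τ * (max C 1) ^ (1 - τ) with hD
  have hmax : 0 < max C 1 := lt_max_of_lt_right one_pos
  refine ⟨D, by positivity, fun ξ η y => ?_⟩
  rw [← ofReal_norm, ← ENNReal.ofReal_mul (by positivity)]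
  refine ENNReal.ofReal_le_ofReal ?_
  have hy : 1 ≤ 1 + ‖y‖ := by linarith [norm_nonneg y]
  have ha : ‖V ξ η y‖ ≤ C₁ * (1 + ‖y‖) ^ (-(N : ℝ)) := by
    rw [Real.rpow_neg (by positivity), Real.rpow_natCast, ← div_eq_mul_inv,
      le_div_iff₀ (by positivity), mul_comm]
    exact hV ξ η y
  have hb : ‖V ξ η y‖ ≤ max C 1 * Real.exp (-(κ * ‖ξ - η‖ ^ r)) :=
    (h2 ξ η y).trans (by gcongr; exact le_max_left _ _)
  calc ‖V ξ η y‖ = ‖V ξ η y‖ ^ τ * ‖V ξ η y‖ ^ (1 - τ) := by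
        rw [← Real.rpow_add_of_nonneg (norm_nonneg _) hτ0.le hτ2]; simp
    _ ≤ (C₁ * (1 + ‖y‖) ^ (-(N : ℝ))) ^ τ *
        (max C 1 * Real.exp (-(κ * ‖ξ - η‖ ^ r))) ^ (1 - τ) := by
        gcongr
    _ = D * ((1 + ‖y‖) ^ (-(N : ℝ) * τ)) * Real.exp (-(κ' * ‖ξ - η‖ ^ r)) := by
        rw [Real.mul_rpow hC₁.le (by positivity), Real.mul_rpow hmax.le (by positivity),
          ← Real.rpow_mul (by positivity), ← Real.exp_mul]
        have : -(κ * ‖ξ - η‖ ^ r) * (1 - τ) = -(κ' * ‖ξ - η‖ ^ r) := by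
          rw [hτ1]; field_simp
        rw [this, hD]; ring
    _ ≤ D * ((1 + ‖y‖) ^ (-((d + 1 : ℕ) : ℝ))) *
        Real.exp (-(κ' * ‖ξ - η‖ ^ r)) := by
        gcongr
        rw [div_le_iff₀ hτ0] at hN
        linarith
    _ = _ := by ring

variable {E : Type*} [NormedAddCommGroup E] [InnerProductSpace ℝ E] [FiniteDimensional ℝ E]
  [MeasurableSpace E] [BorelSpace E]

theorem lintegral_ofReal_lt_top_of_pow_le {F : E → ℝ} {C : ℝ}
    (h : ∀ x, (1 + ‖x‖) ^ (Module.finrank ℝ E + 1) * F x ≤ C) :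
    ∫⁻ x, ENNReal.ofReal (F x) < ⊤ := by
  have hi := integrable_one_add_norm (E := E) (μ := volume)
    (r := (Module.finrank ℝ E + 1 : ℕ)) (by push_cast; linarith)
  have hi2 := (hi.const_mul (max C 0)).lintegral_lt_top
  refine lt_of_le_of_lt (lintegral_mono fun x => ENNReal.ofReal_le_ofReal ?_) hi2
  rw [Real.rpow_neg (by positivity), Real.rpow_natCast, ← div_eq_mul_inv,
    le_div_iff₀ (by positivity), mul_comm]
  exact (h x).trans (le_max_left _ _)

theorem lintegral_exp_neg_rpow_lt_top {r c : ℝ} (hr : 0 < r) (hc : 0 < c) :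
    ∫⁻ x : E, ENNReal.ofReal (Real.exp (-(c * ‖x‖ ^ r))) < ⊤ := by
  obtain ⟨C, _, hC⟩ := exists_pow_mul_exp_neg_rpow_le hr hc (Module.finrank ℝ E + 1)
  exact lintegral_ofReal_lt_top_of_pow_le fun x => hC _ (norm_nonneg x)

theorem eLpNorm_exp_neg_rpow_lt_top {r c : ℝ} (hr : 0 < r) (hc : 0 < c) {p : ℝ≥0∞} (hp : 1 ≤ p) :
    eLpNorm (fun x : E => ENNReal.ofReal (Real.exp (-(c * ‖x‖ ^ r)))) p < ⊤ := by
  refine eLpNorm_lt_top_of_le_one (fun x => ?_) (lintegral_exp_neg_rpow_lt_top hr hc) hp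
  rw [ENNReal.ofReal_le_one, Real.exp_le_one_iff, neg_nonpos]
  positivity

theorem isWindow_schwartz (θ : 𝓢(E, ℂ)) : IsWindow θ := ⟨θ.continuous, θ.integrable⟩

end Decay

/-! ### A band-limited Schwartz window. -/

section BandWindow

variable {E : Type*} [NormedAddCommGroup E] [InnerProductSpace ℝ E] [FiniteDimensional ℝ E]
  [MeasurableSpace E] [BorelSpace E]

/-- A real, even Schwartz window `ψ` with Fourier transform supported in the unit ball. -/
structure IsBandWindow (ψ b : 𝓢(E, ℂ)) : Prop where
  synth : ∀ t, ψ t = ∫ ζ, b ζ * phase ((2 * Real.pi) • ζ) t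
  supp : ∀ ζ, b ζ ≠ 0 → ‖(2 * Real.pi) • ζ‖ ≤ 1
  vanish : ∀ ξ : E, 1 ≤ ‖ξ‖ → ∫ t, ψ t * phase ξ t = 0
  ne_zero : ψ 0 ≠ 0
  real : ∀ t, (starRingEnd ℂ) (ψ t) = ψ t
  even : ∀ t, ψ (-t) = ψ t

-- `ψ` is the inverse Fourier transform of a bump of radius `1 / (2π)`, which is the unit ball in
-- the frequency variable of `phase`. The bump is real and even, hence so is `ψ`, and `ψ 0` is the
-- integral of the bump, which is positive.
open scoped FourierTransform in
theorem exists_isBandWindow (E : Type*) [NormedAddCommGroup E] [InnerProductSpace ℝ E]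
    [FiniteDimensional ℝ E] [MeasurableSpace E] [BorelSpace E] :
    ∃ ψ b : 𝓢(E, ℂ), IsBandWindow ψ b := by
  have hpi : 0 < 2 * Real.pi := by positivity
  let β : ContDiffBump (0 : E) :=
    ⟨(2 * (2 * Real.pi))⁻¹, (2 * Real.pi)⁻¹, by positivity, by
      rw [inv_lt_inv₀ (by positivity) hpi]; linarith⟩
  have hcs : HasCompactSupport (fun x => (β x : ℂ)) :=
    β.hasCompactSupport.comp_left (g := fun x : ℝ => (x : ℂ)) (by simp)
  have hcd : ContDiff ℝ ∞ (fun x => (β x : ℂ)) := Complex.ofRealCLM.contDiff.comp β.contDiff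
  let b : 𝓢(E, ℂ) := hcs.toSchwartzMap hcd
  have hb : ∀ x, b x = (β x : ℂ) := fun x => rfl
  let ψ : 𝓢(E, ℂ) := 𝓕⁻ b
  have hψ : ∀ t, ψ t = ∫ ζ, b ζ * phase ((2 * Real.pi) • ζ) t := by
    intro t
    change (𝓕⁻ b) t = _
    rw [SchwartzMap.fourierInv_coe, Real.fourierInv_eq']
    refine integral_congr_ae (Filter.Eventually.of_forall fun ζ => ?_)
    simp only [phase, smul_eq_mul, inner_smul_right, mul_comm (b ζ)]
    rw [real_inner_comm]
    congr 2
    push_cast; ring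
  have hsupp : ∀ ζ, b ζ ≠ 0 → ‖(2 * Real.pi) • ζ‖ < 1 := by
    intro ζ h
    have h1 : β ζ ≠ 0 := fun h0 => h (by rw [hb, h0]; simp)
    have h2 : ζ ∈ Function.support β := h1
    rw [β.support_eq, mem_ball_zero_iff] at h2
    have h3 : ‖ζ‖ < (2 * Real.pi)⁻¹ := h2
    rw [norm_smul, Real.norm_of_nonneg hpi.le]
    calc 2 * Real.pi * ‖ζ‖ < 2 * Real.pi * (2 * Real.pi)⁻¹ := by gcongr
      _ = 1 := mul_inv_cancel₀ hpi.ne'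
  have heven : ∀ ζ, b (-ζ) = b ζ := fun ζ => by rw [hb, hb, β.neg]
  refine ⟨ψ, b, hψ, fun ζ h => (hsupp ζ h).le, ?_, ?_, ?_, ?_⟩
  · intro ξ hξ
    have h1 : (𝓕 ψ) (-((2 * Real.pi)⁻¹ • ξ)) = b (-((2 * Real.pi)⁻¹ • ξ)) := by
      change (𝓕 (𝓕⁻ b)) _ = _
      rw [FourierInvPair.fourier_fourierInv_eq b]
    rw [SchwartzMap.fourier_coe, Real.fourier_eq'] at h1
    have h2 : b (-((2 * Real.pi)⁻¹ • ξ)) = 0 := by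
      by_contra h
      have := hsupp _ h
      rw [smul_neg, norm_neg, smul_smul, mul_inv_cancel₀ hpi.ne', one_smul] at this
      linarith
    rw [h2] at h1
    rw [← h1]
    refine integral_congr_ae (Filter.Eventually.of_forall fun t => ?_)
    simp only [phase, smul_eq_mul, inner_neg_right, inner_smul_right, mul_comm (ψ t)]
    congr 2
    push_cast
    field_simp
  · rw [hψ]
    simp only [phase_zero_right, mul_one, hb]
    rw [integral_complex_ofReal]
    exact_mod_cast (β.integral_pos (μ := volume)).ne'
  · intro t
    rw [hψ, ← integral_conj, ← integral_neg_eq_self]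
    refine integral_congr_ae (Filter.Eventually.of_forall fun ζ => ?_)
    beta_reduce
    rw [map_mul, heven, hb, Complex.conj_ofReal, smul_neg, phase_neg_left, Complex.conj_conj]
  · intro t
    rw [hψ, hψ, ← integral_neg_eq_self]
    refine integral_congr_ae (Filter.Eventually.of_forall fun ζ => ?_)
    beta_reduce
    rw [heven, smul_neg, phase_neg_right, neg_neg]

end BandWindow

/-! ### Comparison of short-time Fourier transforms for two windows. -/

section WindowChange

variable {E : Type*} [NormedAddCommGroup E] [InnerProductSpace ℝ E] [FiniteDimensional ℝ E]
  [MeasurableSpace E] [BorelSpace E]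

/-- The reflected conjugate `t ↦ conj (θ (-t))`. -/
noncomputable def refl (θ : E → ℂ) (t : E) : ℂ := (starRingEnd ℂ) (θ (-t))

theorem IsWindow.refl {θ : E → ℂ} (h : IsWindow θ) : IsWindow (refl θ) := by
  refine ⟨Complex.continuous_conj.comp (h.cont.comp continuous_neg), ?_⟩
  exact (Complex.conjCLE.toContinuousLinearMap.integrable_comp (h.int.comp_neg))

/-- The value is the square of the `L²` norm of `θ`. It is the constant by which a change of windows
divides. -/
theorem cv_refl_zero_ne_zero {θ : E → ℂ} (hθ : IsWindow θ) (hb : BddCont θ) (h0 : θ ≠ 0) :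
    cv θ (refl θ) 0 ≠ 0 := by
  have h1 : cv θ (refl θ) 0 = ((∫ t, ‖θ (-t)‖ ^ 2 : ℝ) : ℂ) := by
    rw [← integral_complex_ofReal, cv]
    refine integral_congr_ae (Filter.Eventually.of_forall fun t => ?_)
    simp only [zero_sub, refl]
    rw [Complex.mul_conj, Complex.normSq_eq_norm_sq]
  rw [h1, integral_neg_eq_self (fun t => ‖θ t‖ ^ 2)]
  obtain ⟨x, hx⟩ := Function.ne_iff.1 h0
  obtain ⟨C, hC⟩ := hb.bdd
  have hint : Integrable fun t => ‖θ t‖ ^ 2 := by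
    simp_rw [pow_two]
    exact hθ.int.norm.bdd_mul (c := C) hθ.cont.norm.aestronglyMeasurable
      (Filter.Eventually.of_forall fun t => by simpa using hC t)
  have hpos : 0 < ∫ t, ‖θ t‖ ^ 2 := by
    rw [integral_pos_iff_support_of_nonneg (fun t => by positivity) hint]
    refine IsOpen.measure_pos volume ?_ ⟨x, ?_⟩
    · exact (hθ.cont.norm.pow 2).isOpen_support
    · simpa using hx
  exact_mod_cast hpos.ne'

variable {g θ ϑ : E → ℂ}

/-- The inversion formula with the window `cv θ (refl θ)` is applied to `cv g (modul ξ ϑ)`.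
Associativity and commutativity of convolution regroup each integrand as the transform of `g` at `η`
with window `θ`, convolved with a kernel that depends only on the two windows. -/
theorem enorm_cv_window_change (hg : BddCont g) (hθ : IsWindow θ) (hθb : BddCont θ)
    (hϑ : IsWindow ϑ) {k m : E → ℝ≥0∞} (hk : Measurable k)
    (hK : ∀ ξ η y, ‖cv (modul η (refl θ)) (modul ξ ϑ) y‖ₑ ≤ k y * m (ξ - η)) (ξ x : E) :
    ENNReal.ofReal ((2 * Real.pi) ^ Module.finrank ℝ E) * ‖cv θ (refl θ) 0‖ₑ *
      ‖cv g (modul ξ ϑ) x‖ₑ ≤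
      ∫⁻ η, (∫⁻ y, ‖cv g (modul η θ) (x - y)‖ₑ * k y) * m (ξ - η) := by
  have hΘ : IsWindow (cv θ (refl θ)) :=
    ⟨(hθb.cv hθ.refl.int).cont, Integrable.cv hθ.int hθ.refl.int⟩
  have h1 := enorm_mul_le_lintegral_cv_modul (hg.cv (hϑ.modul ξ).int) hΘ x
  rw [mul_assoc, mul_comm ‖cv θ (refl θ) 0‖ₑ]
  refine h1.trans (lintegral_mono fun η => ?_)
  have hθη : BddCont (modul η θ) := hθb.mul
    ⟨continuous_phase continuous_const continuous_id, 1, fun x => (norm_phase _ _).le⟩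
  have e : cv (cv g (modul ξ ϑ)) (modul η (cv θ (refl θ))) x
      = cv (cv g (modul η θ)) (cv (modul η (refl θ)) (modul ξ ϑ)) x := by
    rw [modul_cv, cv_assoc hg (hϑ.modul ξ).int
        (Integrable.cv (hθ.modul η).int (hθ.refl.modul η).int),
      cv_assoc hg (hθ.modul η).int (Integrable.cv (hθ.refl.modul η).int (hϑ.modul ξ).int)]
    congr 1
    funext y
    rw [cv_comm, cv_assoc hθη (hθ.refl.modul η).int (hϑ.modul ξ).int]
  rw [e]
  refine (enorm_cv_le _ _ x).trans ?_
  have hcm : Measurable fun y => ‖cv g (modul η θ) (x - y)‖ₑ * k y :=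
    ((hg.cv (hθ.modul η).int).cont.comp
      (continuous_const.sub continuous_id)).measurable.enorm.mul hk
  rw [← lintegral_mul_const _ hcm]
  refine lintegral_mono fun y => ?_
  rw [mul_assoc]
  gcongr
  exact hK ξ η y

/-- Change of windows in the short-time Fourier transform. -/
theorem eLpNorm_window_change (hθ : IsWindow θ) (hθb : BddCont θ) (h0 : θ ≠ 0)
    (hϑ : IsWindow ϑ) {k m : E → ℝ≥0∞} (hm : Measurable m) (hmt : ∀ x, m x ≠ ⊤)
    (hk : Measurable k) (hk1 : ∀ x, k x ≤ 1) (hki : ∫⁻ x, k x < ⊤)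
    (hK : ∀ ξ η y, ‖cv (modul η (refl θ)) (modul ξ ϑ) y‖ₑ ≤ k y * m (ξ - η))
    {p : ℝ≥0∞} (hp : 1 ≤ p) :
    ∃ C : ℝ≥0∞, C ≠ ⊤ ∧
      (∀ g : E → ℂ, BddCont g → ∀ ξ, eLpNorm (cv g (modul ξ ϑ)) p ≤
        C * ∫⁻ η, eLpNorm (cv g (modul η θ)) p * m (ξ - η)) ∧
      (∀ g : E → ℂ, BddCont g → ∀ ξ, eLpNorm (cv g (modul ξ ϑ)) ⊤ ≤
        C * ∫⁻ η, eLpNorm (cv g (modul η θ)) p * m (ξ - η)) := by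
  set c := ENNReal.ofReal ((2 * Real.pi) ^ Module.finrank ℝ E) * ‖cv θ (refl θ) 0‖ₑ with hc
  have hc0 : c ≠ 0 := mul_ne_zero (by simp; positivity)
    (by simpa using cv_refl_zero_ne_zero hθ hθb h0)
  have hct : c ≠ ⊤ := ENNReal.mul_ne_top (by simp) (by simp)
  clear_value c
  have hkp : eLpNorm k p.conjExponent < ⊤ :=
    eLpNorm_lt_top_of_le_one hk1 hki (ENNReal.HolderConjugate.conjExponent hp).symm.one_le
  have hjm : ∀ g : E → ℂ, BddCont g →
      Measurable (Function.uncurry fun x η => ‖cv g (modul η θ) x‖ₑ) := fun g hg =>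
    (continuous_cv_modul hg hθ).measurable.enorm
  have hci : c⁻¹ ≠ ⊤ := by simpa using hc0
  have key : ∀ {a b : ℝ≥0∞}, c * a ≤ b → a ≤ c⁻¹ * b := by
    intro a b h
    calc a = c⁻¹ * (c * a) := by rw [← mul_assoc, ENNReal.inv_mul_cancel hc0 hct, one_mul]
      _ ≤ c⁻¹ * b := by gcongr
  have hpt := fun (g : E → ℂ) (hg : BddCont g) (ξ x : E) =>
    hc ▸ enorm_cv_window_change hg hθ hθb hϑ hk hK ξ x
  have hPm : ∀ g : E → ℂ, BddCont g → ∀ ξ, Measurable fun η =>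
      eLpNorm (cv g (modul η θ)) p * m (ξ - η) := by
    intro g hg ξ
    refine Measurable.mul ?_ (hm.comp (measurable_const.sub measurable_id))
    simpa only [eLpNorm_enorm] using measurable_eLpNorm_section (μ := volume) (hjm g hg) p
  -- The integral of `k` serves the bound from `L^p` to `L^p` by Young, and its dual norm the bound
  -- from `L^p` to `L^∞` by Hölder.
  refine ⟨c⁻¹ * ((∫⁻ x, k x) + eLpNorm k p.conjExponent), ?_, fun g hg ξ => ?_, fun g hg ξ => ?_⟩
  · refine ENNReal.mul_ne_top (by simpa using hc0) (ENNReal.add_lt_top.2 ⟨hki, hkp⟩).ne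
  · have hA : Measurable (Function.uncurry fun x η =>
        (∫⁻ y, ‖cv g (modul η θ) (x - y)‖ₑ * k y) * m (ξ - η)) := by
      refine Measurable.mul ?_ (hm.comp (measurable_const.sub measurable_snd))
      have h1 : Measurable fun z : (E × E) × E => (z.1.1 - z.2, z.1.2) := by fun_prop
      have h2 : Measurable fun z : (E × E) × E =>
          ‖cv g (modul z.1.2 θ) (z.1.1 - z.2)‖ₑ * k z.2 :=
        (((continuous_cv_modul hg hθ).measurable.enorm).comp h1).mul (hk.comp measurable_snd)
      exact h2.lintegral_prod_right'
    have h5 := eLpNorm_le_mul_lintegral (μ := volume) hp hci hA fun x => key (hpt g hg ξ x)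
    have h6 : ∀ η, eLpNorm (fun x => (∫⁻ y, ‖cv g (modul η θ) (x - y)‖ₑ * k y) * m (ξ - η)) p volume
        ≤ (∫⁻ x, k x) * (eLpNorm (cv g (modul η θ)) p volume * m (ξ - η)) := by
      intro η
      simp_rw [mul_comm _ (m (ξ - η))]
      refine (eLpNorm_const_mul_le (hmt _) _).trans ?_
      rw [mul_left_comm]
      refine mul_le_mul' le_rfl ?_
      rw [mul_comm, ← eLpNorm_enorm (cv g (modul η θ))]
      exact eLpNorm_lconv_le (a := fun x => ‖cv g (modul η θ) x‖ₑ) (b := k) hp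
        (hg.cv (hθ.modul η).int).cont.measurable.enorm hk
    refine (h5.trans (mul_le_mul' le_rfl (lintegral_mono h6))).trans ?_
    rw [lintegral_const_mul _ (hPm g hg ξ), ← mul_assoc]
    exact mul_le_mul' (mul_le_mul' le_rfl le_self_add) le_rfl
  · rw [eLpNorm_exponent_top]
    refine essSup_le_of_ae_le _ (Filter.Eventually.of_forall fun x => ?_)
    refine (key (hpt g hg ξ x)).trans ?_
    rw [mul_assoc]
    refine mul_le_mul_right ?_ _
    have hle : eLpNorm k p.conjExponent ≤ (∫⁻ x, k x) + eLpNorm k p.conjExponent := le_add_self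
    refine le_trans ?_ (mul_le_mul' hle le_rfl)
    rw [← lintegral_const_mul _ (hPm g hg ξ)]
    refine lintegral_mono fun η => ?_
    rw [← mul_assoc]
    gcongr
    rw [mul_comm]
    have hgm := (hg.cv (hθ.modul η).int).cont.measurable
    refine (lintegral_mul_le_eLpNorm_mul hp (F := fun y => ‖cv g (modul η θ) (x - y)‖ₑ)
      (hgm.enorm.comp (measurable_const.sub measurable_id)).aemeasurable
      hk.aemeasurable).trans_eq ?_
    congr 1
    have := eLpNorm_comp_measurePreserving (p := p) (hgm.aestronglyMeasurable (μ := volume))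
      (Measure.measurePreserving_sub_left (volume : Measure E) x)
    rw [← this, ← eLpNorm_enorm]
    rfl

theorem norm_cv_modul_modul (a b : E → ℂ) (ξ η y : E) :
    ‖cv (modul η a) (modul ξ b) y‖ = ‖∫ t, a (y - t) * b t * phase (ξ - η) t‖ := by
  have : cv (modul η a) (modul ξ b) y = phase η y * ∫ t, a (y - t) * b t * phase (ξ - η) t := by
    rw [← integral_const_mul, cv]
    refine integral_congr_ae (Filter.Eventually.of_forall fun t => ?_)
    simp only [modul]
    have h1 : phase η (y - t) = phase η y * phase (-η) t := by
      rw [sub_eq_add_neg, phase_add_right, phase_neg_right]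
    rw [h1, sub_eq_add_neg ξ η, phase_add_left]
    ring
  rw [this, norm_mul, norm_phase, one_mul]

/-- Modulations have modulus one, so the bound is uniform in `ξ` and `η`. The weight is
submultiplicative, `1 + |y| ≤ (1 + |y - t|)(1 + |t|)`, and each window absorbs one factor. -/
theorem norm_cv_modul_modul_le_pow (θ ϑ : 𝓢(E, ℂ)) (N : ℕ) :
    ∃ C : ℝ, 0 < C ∧ ∀ ξ η y, (1 + ‖y‖) ^ N * ‖cv (modul η θ) (modul ξ ϑ) y‖ ≤ C := by
  obtain ⟨C₁, h₁, hC₁⟩ := schwartz_pow_le θ N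
  obtain ⟨C₂, h₂, hC₂⟩ := schwartz_pow_le ϑ (N + (Module.finrank ℝ E + 1))
  have hi := integrable_one_add_norm (E := E) (μ := volume)
    (r := (Module.finrank ℝ E + 1 : ℕ)) (by push_cast; linarith)
  refine ⟨C₁ * C₂ * (1 + ∫ t : E, (1 + ‖t‖) ^ (-((Module.finrank ℝ E + 1 : ℕ) : ℝ))), ?_,
    fun ξ η y => ?_⟩
  · have : 0 ≤ ∫ t : E, (1 + ‖t‖) ^ (-((Module.finrank ℝ E + 1 : ℕ) : ℝ)) :=
      integral_nonneg fun t => by positivity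
    positivity
  rw [norm_cv_modul_modul]
  have h3 : ‖∫ t, (((1 + ‖y‖) ^ N : ℝ) : ℂ) * (θ (y - t) * ϑ t * phase (ξ - η) t)‖ ≤
      ∫ t : E, C₁ * C₂ * (1 + ‖t‖) ^ (-((Module.finrank ℝ E + 1 : ℕ) : ℝ)) := by
    refine norm_integral_le_of_norm_le (hi.const_mul _) (Filter.Eventually.of_forall fun t => ?_)
    rw [norm_mul, norm_mul, norm_mul, norm_phase, mul_one, Complex.norm_real,
      Real.norm_of_nonneg (by positivity), Real.rpow_neg (by positivity), Real.rpow_natCast,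
      ← div_eq_mul_inv, le_div_iff₀ (by positivity)]
    have h4 : (1 + ‖y‖) ^ N ≤ (1 + ‖y - t‖) ^ N * (1 + ‖t‖) ^ N := by
      rw [← mul_pow]
      refine pow_le_pow_left₀ (by positivity) ?_ _
      have : ‖y‖ ≤ ‖y - t‖ + ‖t‖ := by simpa using norm_add_le (y - t) t
      nlinarith [norm_nonneg (y - t), norm_nonneg t]
    calc (1 + ‖y‖) ^ N * (‖θ (y - t)‖ * ‖ϑ t‖) * (1 + ‖t‖) ^ (Module.finrank ℝ E + 1)
        ≤ ((1 + ‖y - t‖) ^ N * (1 + ‖t‖) ^ N) * (‖θ (y - t)‖ * ‖ϑ t‖) *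
            (1 + ‖t‖) ^ (Module.finrank ℝ E + 1) := by gcongr
      _ = ((1 + ‖y - t‖) ^ N * ‖θ (y - t)‖) *
            ((1 + ‖t‖) ^ (N + (Module.finrank ℝ E + 1)) * ‖ϑ t‖) := by rw [pow_add]; ring
      _ ≤ C₁ * C₂ := mul_le_mul (hC₁ _) (hC₂ _) (by positivity) h₁.le
  rw [integral_const_mul, norm_mul, Complex.norm_real, Real.norm_of_nonneg (by positivity)] at h3
  refine h3.trans ?_
  rw [integral_const_mul]
  gcongr
  linarith

/-- Expanding `ψ` in characters of frequency at most `1` turns the convolution into an average of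
the Fourier transform of `a` over the unit ball around `ξ - η`. A shift of length at most `1`
changes `|·|^r` by at most `1`, which costs the factor `e^κ`. -/
theorem IsBandWindow.norm_cv_modul_modul_le_exp {ψ b : 𝓢(E, ℂ)} (hψ : IsBandWindow ψ b) {a : E → ℂ}
    (ha : IsWindow a) {r κ C : ℝ} (hr : 0 < r) (hr1 : r < 1) (hκ : 0 ≤ κ)
    (hC : ∀ w, ‖∫ t, a t * phase w t‖ ≤ C * Real.exp (-(κ * ‖w‖ ^ r))) (ξ η y : E) :
    ‖cv (modul η ψ) (modul ξ a) y‖ ≤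
      (C * Real.exp κ * ∫ ζ, ‖b ζ‖) * Real.exp (-(κ * ‖ξ - η‖ ^ r)) := by
  have hC0 : 0 ≤ C := by
    have := (norm_nonneg _).trans (hC 0)
    by_contra h
    have h2 := mul_neg_of_neg_of_pos (not_le.1 h) (Real.exp_pos (-(κ * ‖(0 : E)‖ ^ r)))
    linarith
  rw [norm_cv_modul_modul]
  set w := ξ - η
  have e : ∫ t, ψ (y - t) * a t * phase w t =
      ∫ ζ, b ζ * phase ((2 * Real.pi) • ζ) y * ∫ t, a t * phase (w + -((2 * Real.pi) • ζ)) t := by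
    have h1 : ∀ t, ψ (y - t) * a t * phase w t =
        ∫ ζ, b ζ * phase ((2 * Real.pi) • ζ) y * (a t * phase (w + -((2 * Real.pi) • ζ)) t) := by
      intro t
      rw [hψ.synth, mul_assoc, ← integral_mul_const]
      refine integral_congr_ae (Filter.Eventually.of_forall fun ζ => ?_)
      beta_reduce
      rw [phase_add_left, sub_eq_add_neg, phase_add_right, phase_neg_right]
      ring
    simp_rw [h1]
    rw [integral_integral_swap]
    · simp_rw [integral_const_mul]
    · have h2 : Integrable (fun z : E × E => a z.1 * b z.2) (volume.prod volume) :=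
        ha.int.mul_prod b.integrable
      have h3 : Continuous fun z : E × E => phase ((2 * Real.pi) • z.2) y *
          phase (w + -((2 * Real.pi) • z.2)) z.1 :=
        (continuous_phase (by fun_prop) (by fun_prop)).mul
          (continuous_phase (by fun_prop) (by fun_prop))
      refine (h2.bdd_mul (c := 1) h3.aestronglyMeasurable (Filter.Eventually.of_forall fun z => ?_)).congr
        (Filter.Eventually.of_forall fun z => ?_)
      · simp [norm_phase]
      · simp only [Function.uncurry]; ring
  rw [e, mul_right_comm, mul_assoc, ← integral_const_mul]
  rw [← integral_const_mul]
  refine norm_integral_le_of_norm_le ((b.integrable.norm.const_mul _).const_mul _)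
    (Filter.Eventually.of_forall fun ζ => ?_)
  rw [norm_mul, norm_mul, norm_phase, mul_one]
  by_cases hb : b ζ = 0
  · simp [hb]
  have h5 := hψ.supp ζ hb
  have h6 : ‖w‖ ^ r ≤ ‖w + -((2 * Real.pi) • ζ)‖ ^ r + 1 := by
    have := norm_rpow_le_add hr hr1 (w + -((2 * Real.pi) • ζ)) ((2 * Real.pi) • ζ)
    rw [neg_add_cancel_right] at this
    have h7 : ‖(2 * Real.pi) • ζ‖ ^ r ≤ 1 := Real.rpow_le_one (norm_nonneg _) h5 hr.le
    linarith
  calc ‖b ζ‖ * ‖∫ t, a t * phase (w + -((2 * Real.pi) • ζ)) t‖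
      ≤ ‖b ζ‖ * (C * Real.exp (κ + -(κ * ‖w‖ ^ r))) := by
        gcongr
        refine (hC _).trans ?_
        gcongr
        nlinarith
    _ = _ := by rw [Real.exp_add]; ring

end WindowChange

theorem lintegral_prod_mul_mul_lt_top {X Y Z : Type*} [MeasureSpace X] [MeasureSpace Y]
    [MeasureSpace Z] [SFinite (volume : Measure X)] [SFinite (volume : Measure Y)]
    [SFinite (volume : Measure Z)] {F : X → ℝ≥0∞} {G : Y → ℝ≥0∞} {H : Z → ℝ≥0∞}
    (hF : Measurable F) (hG : Measurable G) (hH : Measurable H)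
    (hF1 : ∫⁻ x, F x < ⊤) (hG1 : ∫⁻ x, G x < ⊤) (hH1 : ∫⁻ x, H x < ⊤) :
    ∫⁻ w, F w.1 * (G w.2.1 * H w.2.2) ∂((volume : Measure X).prod (volume : Measure (Y × Z))) < ⊤ := by
  have h : Measurable fun z : Y × Z => G z.1 * H z.2 :=
    (hG.comp measurable_fst).mul (hH.comp measurable_snd)
  have := lintegral_prod_mul (μ := (volume : Measure X)) (ν := (volume : Measure (Y × Z)))
    hF.aemeasurable h.aemeasurable
  beta_reduce at this
  rw [this, Measure.volume_eq_prod, lintegral_prod_mul hG.aemeasurable hH.aemeasurable]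
  exact ENNReal.mul_lt_top hF1 (ENNReal.mul_lt_top hG1 hH1)

/-! ### Spectra of products, and the product formula for the transform. -/

section Spectrum

variable {E : Type*} [NormedAddCommGroup E] [InnerProductSpace ℝ E] [FiniteDimensional ℝ E]
  [MeasurableSpace E] [BorelSpace E]

theorem enorm_le_eLpNorm_top {f : E → ℂ} (hf : Continuous f) (x : E) :
    ‖f x‖ₑ ≤ eLpNorm f ⊤ volume := by
  have h1 : ∀ᵐ y ∂(volume : Measure E), ‖f y‖ₑ ≤ eLpNorm f ⊤ volume := by
    rw [eLpNorm_exponent_top]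
    exact enorm_ae_le_eLpNormEssSup f volume
  have h2 : Dense {y | ‖f y‖ₑ ≤ eLpNorm f ⊤ volume} := Measure.dense_of_ae h1
  have h3 : IsClosed {y | ‖f y‖ₑ ≤ eLpNorm f ⊤ volume} :=
    isClosed_le hf.enorm continuous_const
  have : x ∈ closure {y | ‖f y‖ₑ ≤ eLpNorm f ⊤ volume} := h2 x
  rwa [h3.closure_eq] at this

/-- `g` has its spectrum in the closed ball of radius `ρ` around `α`, as seen by the window `ψ`. -/
def HasSpec (ψ : E → ℂ) (g : E → ℂ) (α : E) (ρ : ℝ) : Prop :=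
  ∀ ξ x, ρ + 1 ≤ ‖ξ - α‖ → cv g (modul ξ ψ) x = 0

variable {ψ b : 𝓢(E, ℂ)} {g h : E → ℂ}

theorem IsBandWindow.hasSpec_one (hψ : IsBandWindow ψ b) : HasSpec ψ (fun _ => 1) 0 0 := by
  intro ξ x h
  simp only [cv, modul, one_mul]
  exact hψ.vanish ξ (by simpa using h)

/-- The second factor is a superposition of characters with frequencies in the unit ball around `β`,
so multiplication by it translates the spectrum by `β` and enlarges its radius by `1`. The
additional `1` in `HasSpec` is the bandwidth of the window. -/
theorem IsBandWindow.hasSpec_mul (hψ : IsBandWindow ψ b) (hg : BddCont g) (hh : BddCont h)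
    {α β : E} {ρ : ℝ} (H : HasSpec ψ g α ρ) :
    HasSpec ψ (fun x => g x * cv h (modul β ψ) x) (α + β) (ρ + 1) := by
  intro ξ x hξ
  obtain ⟨C, hC⟩ := hg.bdd
  obtain ⟨D, hD⟩ := hh.bdd
  have hψw := isWindow_schwartz ψ
  -- Expanding `ψ (c - t)` in characters leaves, for each `ζ`, the transform of `g` at `ξ - β -
  -- 2πζ`. Since `|2πζ| ≤ 1`, this frequency is still at distance at least `ρ + 1` from `α`.
  have hJ : ∀ c : E, ∫ t, g (x - t) * (modul β ψ (c - t) * modul ξ ψ t) = 0 := by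
    intro c
    have h1 : ∀ t, g (x - t) * (modul β ψ (c - t) * modul ξ ψ t) =
        ∫ ζ, b ζ * phase ((2 * Real.pi) • ζ + β) c *
          (g (x - t) * modul (ξ + -((2 * Real.pi) • ζ + β)) ψ t) := by
      intro t
      have h2 : modul β ψ (c - t) = ∫ ζ, b ζ * (phase ((2 * Real.pi) • ζ) (c - t) *
          phase β (c - t)) := by
        rw [modul, hψ.synth, ← integral_mul_const]
        simp only [mul_assoc]
      rw [h2, ← integral_mul_const, ← integral_const_mul]
      refine integral_congr_ae (Filter.Eventually.of_forall fun ζ => ?_)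
      simp only [modul]
      rw [← phase_add_left, sub_eq_add_neg c t, phase_add_right, phase_neg_right, phase_add_left ξ]
      ring
    simp_rw [h1]
    rw [integral_integral_swap]
    · simp_rw [integral_const_mul]
      refine integral_eq_zero_of_ae (Filter.Eventually.of_forall fun ζ => ?_)
      by_cases hb : b ζ = 0
      · simp [hb]
      have h3 := hψ.supp ζ hb
      have h4 : cv g (modul (ξ + -((2 * Real.pi) • ζ + β)) ψ) x = 0 := by
        refine H _ _ ?_
        have h5 : ξ - (α + β) = (ξ + -((2 * Real.pi) • ζ + β) - α) + (2 * Real.pi) • ζ := by abel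
        have := norm_add_le (ξ + -((2 * Real.pi) • ζ + β) - α) ((2 * Real.pi) • ζ)
        rw [← h5] at this
        linarith
      rw [cv] at h4
      simp only [h4, mul_zero, Pi.zero_apply]
    · have h2 : Integrable (fun z : E × E => ψ z.1 * b z.2) (volume.prod volume) :=
        hψw.int.mul_prod b.integrable
      have h3 : Continuous fun z : E × E => phase ((2 * Real.pi) • z.2 + β) c *
          (g (x - z.1) * phase (ξ + -((2 * Real.pi) • z.2 + β)) z.1) :=
        (continuous_phase (by fun_prop) (by fun_prop)).mul
          ((hg.cont.comp (by fun_prop)).mul (continuous_phase (by fun_prop) (by fun_prop)))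
      refine (h2.bdd_mul (c := C) h3.aestronglyMeasurable (Filter.Eventually.of_forall fun z => ?_)).congr
        (Filter.Eventually.of_forall fun z => ?_)
      · simpa [norm_phase] using hC _
      · simp only [Function.uncurry, modul]; ring
  have h1 : ∀ t, (g (x - t) * cv h (modul β ψ) (x - t)) * modul ξ ψ t =
      ∫ y, h y * (g (x - t) * (modul β ψ ((x - y) - t) * modul ξ ψ t)) := by
    intro t
    rw [cv_comm, cv, mul_assoc, ← integral_mul_const, ← integral_const_mul]
    refine integral_congr_ae (Filter.Eventually.of_forall fun y => ?_)
    beta_reduce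
    rw [sub_right_comm]
    ring
  rw [cv]
  simp_rw [h1]
  rw [integral_integral_swap]
  · simp_rw [integral_const_mul, hJ]
    simp
  · have h2 := integrable_conv_prod (hψw.modul β).int (hψw.modul ξ).int
    have h3 : MeasurePreserving (fun z : E × E => (x - z.1, z.2)) (volume.prod volume)
        (volume.prod volume) :=
      (Measure.measurePreserving_sub_left volume x).prod (MeasurePreserving.id volume)
    have h4 := (h3.integrable_comp h2.aestronglyMeasurable).2 h2
    have h5 := h4.bdd_mul (f := fun z : E × E => h z.1 * g (x - z.2)) (c := D * C)
      ((hh.cont.comp (by fun_prop)).mul (hg.cont.comp (by fun_prop))).aestronglyMeasurable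
      (Filter.Eventually.of_forall fun z => by
        rw [norm_mul]
        exact mul_le_mul (hD _) (hC _) (norm_nonneg _) ((norm_nonneg _).trans (hD 0)))
    refine h5.swap.congr (Filter.Eventually.of_forall fun z => ?_)
    simp only [Function.comp, Function.uncurry, Prod.swap]
    ring

theorem IsBandWindow.hasSpec_cv (hψ : IsBandWindow ψ b) (hh : BddCont h) (β : E) :
    HasSpec ψ (cv h (modul β ψ)) β 1 := by
  have := hψ.hasSpec_mul (BddCont.const 1) hh (β := β) hψ.hasSpec_one
  simpa using this

theorem IsBandWindow.hasSpec_cv_mul_cv (hψ : IsBandWindow ψ b) (hg : BddCont g) (hh : BddCont h)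
    (α β : E) :
    HasSpec ψ (fun x => cv g (modul α ψ) x * cv h (modul β ψ) x) (α + β) 2 := by
  have := hψ.hasSpec_mul (hg.cv ((isWindow_schwartz ψ).modul α).int) hh (β := β)
    (hψ.hasSpec_cv hg α)
  norm_num at this
  exact this

theorem integrable_cv_modul (hg : BddCont g) {θ : E → ℂ} (hθ : IsWindow θ)
    (hQ : ∫⁻ ξ, eLpNorm (cv g (modul ξ θ)) ⊤ < ⊤) (x : E) :
    Integrable fun ξ => cv g (modul ξ θ) x := by
  refine ⟨((continuous_cv_modul hg hθ).comp
    (continuous_const.prodMk continuous_id)).aestronglyMeasurable, lt_of_le_of_lt ?_ hQ⟩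
  exact lintegral_mono fun ξ => enorm_le_eLpNorm_top (hg.cv (hθ.modul ξ).int).cont x

theorem measurable_eLpNorm_cv (hg : BddCont g) {θ : E → ℂ} (hθ : IsWindow θ) (p : ℝ≥0∞) :
    Measurable fun ξ => eLpNorm (cv g (modul ξ θ)) p := by
  have h1 : Measurable (Function.uncurry fun x η => ‖cv g (modul η θ) x‖ₑ) :=
    (continuous_cv_modul hg hθ).measurable.enorm
  simpa only [eLpNorm_enorm] using measurable_eLpNorm_section (μ := volume) h1 p

/-- Both factors are reconstructed by the inversion formula, which accounts for the square of its
constant. Absolute integrability of the transforms in the supremum norm justifies Fubini. -/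
theorem enorm_cv_mul_le (hg : BddCont g) (hh : BddCont h)
    (hQg : ∫⁻ ξ, eLpNorm (cv g (modul ξ ψ)) ⊤ < ⊤)
    (hQh : ∫⁻ ξ, eLpNorm (cv h (modul ξ ψ)) ⊤ < ⊤) (ξ x : E) :
    (ENNReal.ofReal ((2 * Real.pi) ^ Module.finrank ℝ E) * ‖ψ 0‖ₑ) ^ 2 *
      ‖cv (fun y => g y * h y) (modul ξ ψ) x‖ₑ ≤
    ∫⁻ z : E × E, ‖cv (fun y => cv g (modul z.1 ψ) y * cv h (modul z.2 ψ) y) (modul ξ ψ) x‖ₑ := by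
  have hψw := isWindow_schwartz ψ
  set c : ℂ := ((2 * Real.pi) ^ Module.finrank ℝ E : ℝ) * ψ 0 with hc
  have hce : ‖c‖ₑ = ENNReal.ofReal ((2 * Real.pi) ^ Module.finrank ℝ E) * ‖ψ 0‖ₑ := by
    rw [hc, enorm_mul]
    congr 1
    rw [← ofReal_norm, Complex.norm_real, Real.norm_of_nonneg (by positivity)]
  rw [← hce, ← enorm_pow, ← enorm_mul]
  have e : c ^ 2 * cv (fun y => g y * h y) (modul ξ ψ) x =
      ∫ z : E × E, cv (fun y => cv g (modul z.1 ψ) y * cv h (modul z.2 ψ) y) (modul ξ ψ) x := by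
    have h1 : ∀ y, c ^ 2 * (g y * h y) =
        ∫ z : E × E, cv g (modul z.1 ψ) y * cv h (modul z.2 ψ) y := by
      intro y
      have := integral_prod_mul (μ := (volume : Measure E)) (ν := (volume : Measure E))
        (fun α => cv g (modul α ψ) y) (fun β => cv h (modul β ψ) y)
      rw [Measure.volume_eq_prod, this,
        integral_cv_modul hg hψw y (integrable_cv_modul hg hψw hQg y),
        integral_cv_modul hh hψw y (integrable_cv_modul hh hψw hQh y), hc]
      ring
    have h2 : c ^ 2 * cv (fun y => g y * h y) (modul ξ ψ) x =
        ∫ t, ∫ z : E × E, cv g (modul z.1 ψ) (x - t) * cv h (modul z.2 ψ) (x - t) *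
          modul ξ ψ t := by
      rw [cv, ← integral_const_mul]
      refine integral_congr_ae (Filter.Eventually.of_forall fun t => ?_)
      beta_reduce
      rw [integral_mul_const, ← h1]
      ring
    rw [h2, integral_integral_swap]
    · rfl
    · have hcg : Continuous fun w : E × (E × E) => cv g (modul w.2.1 ψ) (x - w.1) :=
        (continuous_cv_modul hg hψw).comp (f := fun w : E × (E × E) => (x - w.1, w.2.1))
          (by fun_prop)
      have hch : Continuous fun w : E × (E × E) => cv h (modul w.2.2 ψ) (x - w.1) :=
        (continuous_cv_modul hh hψw).comp (f := fun w : E × (E × E) => (x - w.1, w.2.2))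
          (by fun_prop)
      refine ⟨((hcg.mul hch).mul ((hψw.modul ξ).cont.comp continuous_fst)).aestronglyMeasurable, ?_⟩
      refine lt_of_le_of_lt (lintegral_mono fun w => ?_) (lintegral_prod_mul_mul_lt_top
        (hψw.modul ξ).cont.measurable.enorm
        (measurable_eLpNorm_cv hg hψw ⊤) (measurable_eLpNorm_cv hh hψw ⊤) (hψw.modul ξ).int.2 hQg hQh)
      simp only [Function.uncurry]
      rw [enorm_mul, enorm_mul, mul_comm]
      refine mul_le_mul' le_rfl (mul_le_mul' ?_ ?_)
      · exact enorm_le_eLpNorm_top (hg.cv (hψw.modul _).int).cont _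
      · exact enorm_le_eLpNorm_top (hh.cv (hψw.modul _).int).cont _
  rw [e]
  exact enorm_integral_le_lintegral_enorm _

/-- The weighted modulation norm with window `ψ` and weight `W`. -/
noncomputable def wnorm (ψ : E → ℂ) (W : E → ℝ≥0∞) (p q : ℝ≥0∞) (g : E → ℂ) : ℝ≥0∞ :=
  eLpNorm (fun ξ => W ξ * eLpNorm (cv g (modul ξ ψ)) p volume) q volume

theorem eLpNorm_mul_le_min {g h : E → ℂ} (hg : Continuous g) (hh : Continuous h) (p : ℝ≥0∞) :
    eLpNorm (fun x => g x * h x) p ≤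
      min (eLpNorm g p * eLpNorm h ⊤) (eLpNorm g ⊤ * eLpNorm h p) := by
  refine le_min ?_ ?_
  · have := eLpNorm_le_eLpNorm_mul_eLpNorm_of_nnnorm (p := p) (q := ⊤) (r := p) (μ := volume)
      hg.aestronglyMeasurable hh.aestronglyMeasurable (fun a b : ℂ => a * b) 1
      (Filter.Eventually.of_forall fun x => by simp)
    simpa using this
  · have := eLpNorm_le_eLpNorm_mul_eLpNorm_of_nnnorm (p := ⊤) (q := p) (r := p) (μ := volume)
      hg.aestronglyMeasurable hh.aestronglyMeasurable (fun a b : ℂ => a * b) 1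
      (Filter.Eventually.of_forall fun x => by simp)
    simpa using this

end Spectrum

theorem BddCont.pow {X : Type*} [TopologicalSpace X] {g : X → ℂ} (hg : BddCont g) (k : ℕ) :
    BddCont fun x => g x ^ k := by
  induction k with
  | zero => simpa using BddCont.const 1
  | succ k ih => simpa only [pow_succ] using ih.mul hg

/-! ### The weighted norms and the product estimate. -/

section WeightedNorms

variable {E : Type*} [NormedAddCommGroup E] [InnerProductSpace ℝ E] [FiniteDimensional ℝ E]
  [MeasurableSpace E] [BorelSpace E]

theorem eLpNorm_lconv_prod_le {q : ℝ≥0∞} (hq : 1 ≤ q) {k F G : E → ℝ≥0∞} (hk : Measurable k)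
    (hF : Measurable F) (hG : Measurable G) :
    eLpNorm (fun ξ => ∫⁻ z : E × E, k (ξ - z.1 - z.2) * (F z.1 * G z.2)) q (volume : Measure E) ≤
      (eLpNorm F q (volume : Measure E) * ∫⁻ x, k x) * ∫⁻ x, G x := by
  have hA : Measurable fun y => ∫⁻ a, F (y - a) * k a := by
    have h : Measurable fun z : E × E => F (z.1 - z.2) * k z.2 :=
      (hF.comp (measurable_fst.sub measurable_snd)).mul (hk.comp measurable_snd)
    exact h.lintegral_prod_right'
  have h1 : ∀ ξ, ∫⁻ z : E × E, k (ξ - z.1 - z.2) * (F z.1 * G z.2) =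
      ∫⁻ β, (∫⁻ a, F ((ξ - β) - a) * k a) * G β := by
    intro ξ
    have hm : Measurable fun z : E × E => k (ξ - z.1 - z.2) * (F z.1 * G z.2) :=
      (hk.comp ((measurable_const.sub measurable_fst).sub measurable_snd)).mul
        ((hF.comp measurable_fst).mul (hG.comp measurable_snd))
    rw [Measure.volume_eq_prod, lintegral_prod_symm _ hm.aemeasurable]
    refine lintegral_congr fun β => ?_
    rw [← lintegral_conv_comm F k (ξ - β), ← lintegral_mul_const]
    · refine lintegral_congr fun a => ?_
      rw [sub_right_comm]
      ring
    · exact hF.mul (hk.comp (measurable_const.sub measurable_id))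
  simp_rw [h1]
  refine (eLpNorm_lconv_le hq (a := fun y => ∫⁻ a, F (y - a) * k a) hA hG).trans ?_
  exact mul_le_mul' (eLpNorm_lconv_le hq (a := F) (b := k) hF hk) le_rfl

theorem cv_const_mul (c : ℂ) (g a : E → ℂ) (x : E) :
    cv (fun y => c * g y) a x = c * cv g a x := by
  simp only [cv, mul_assoc, integral_const_mul]

theorem cv_tsum {f : ℕ → E → ℂ} {a : ℕ → ℝ} {θ : E → ℂ} (hf : ∀ k, Continuous (f k))
    (hfa : ∀ k x, ‖f k x‖ ≤ a k) (ha : Summable a) (hθ : IsWindow θ) (x : E) :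
    cv (fun y => ∑' k, f k y) θ x = ∑' k, cv (f k) θ x := by
  simp only [cv]
  have hg : ∀ k, BddCont (f k) := fun k => ⟨hf k, a k, hfa k⟩
  simp_rw [← tsum_mul_right]
  refine (integral_tsum_of_summable_integral_norm
    (fun k => integrable_cv_integrand (hg k) hθ.int x) ?_).symm
  refine (ha.mul_right (∫ t, ‖θ t‖)).of_nonneg_of_le (fun k => integral_nonneg fun t => norm_nonneg _)
    fun k => ?_
  rw [← integral_const_mul]
  refine integral_mono (integrable_cv_integrand (hg k) hθ.int x).norm (hθ.int.norm.const_mul _)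
    fun t => ?_
  simp only [norm_mul]
  exact mul_le_mul_of_nonneg_right (hfa _ _) (norm_nonneg _)

theorem eLpNorm_cv_tsum_le {f : ℕ → E → ℂ} {a : ℕ → ℝ} {θ : E → ℂ} (hf : ∀ k, Continuous (f k))
    (hfa : ∀ k x, ‖f k x‖ ≤ a k) (ha : Summable a) (hθ : IsWindow θ) {p : ℝ≥0∞} (hp : 1 ≤ p) :
    eLpNorm (cv (fun y => ∑' k, f k y) θ) p ≤ ∑' k, eLpNorm (cv (f k) θ) p := by
  have h1 : eLpNorm (cv (fun y => ∑' k, f k y) θ) p volume ≤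
      eLpNorm (fun x => ∑' k, ‖cv (f k) θ x‖ₑ) p volume := by
    refine eLpNorm_mono_enorm fun x => ?_
    rw [cv_tsum hf hfa ha hθ, enorm_eq_self]
    exact enorm_tsum_le_tsum_enorm
  refine h1.trans ((eLpNorm_tsum_le hp fun k => ?_).trans_eq ?_)
  · exact ((BddCont.mk (hf k) ⟨a k, hfa k⟩).cv hθ.int).cont.measurable.enorm
  · simp only [eLpNorm_enorm]

variable {ψ b : 𝓢(E, ℂ)} {g h : E → ℂ}

theorem measurable_wnorm_integrand (hg : BddCont g) {θ : E → ℂ} (hθ : IsWindow θ) {W : E → ℝ≥0∞}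
    (hW : Measurable W) (p : ℝ≥0∞) :
    Measurable fun ξ => W ξ * eLpNorm (cv g (modul ξ θ)) p :=
  hW.mul (measurable_eLpNorm_cv hg hθ p)

theorem wnorm_one {θ : E → ℂ} {W : E → ℝ≥0∞} {p : ℝ≥0∞} :
    wnorm θ W p 1 g = ∫⁻ ξ, W ξ * eLpNorm (cv g (modul ξ θ)) p := eLpNorm_ennreal_one _

theorem wnorm_tsum_le {f : ℕ → E → ℂ} {a : ℕ → ℝ} {θ : E → ℂ} (hf : ∀ k, Continuous (f k))
    (hfa : ∀ k x, ‖f k x‖ ≤ a k) (ha : Summable a) (hθ : IsWindow θ) {W : E → ℝ≥0∞}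
    (hW : Measurable W) {p q : ℝ≥0∞} (hp : 1 ≤ p) (hq : 1 ≤ q) :
    wnorm θ W p q (fun y => ∑' k, f k y) ≤ ∑' k, wnorm θ W p q (f k) := by
  have hg : ∀ k, BddCont (f k) := fun k => ⟨hf k, a k, hfa k⟩
  refine le_trans (eLpNorm_ennreal_mono fun ξ => ?_)
    (eLpNorm_tsum_le hq fun k => measurable_wnorm_integrand (hg k) hθ hW p)
  rw [ENNReal.tsum_mul_left]
  exact mul_le_mul' le_rfl (eLpNorm_cv_tsum_le hf hfa ha (hθ.modul ξ) hp)

theorem eLpNorm_cv_const_mul (c : ℂ) (θ : E → ℂ) (p : ℝ≥0∞) :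
    eLpNorm (cv (fun y => c * g y) θ) p volume = ‖c‖ₑ * eLpNorm (cv g θ) p volume := by
  have : cv (fun y => c * g y) θ = c • cv g θ := by
    funext x
    simp [cv_const_mul]
  rw [this, eLpNorm_const_smul]

theorem wnorm_const_mul_le (c : ℂ) (θ : E → ℂ) (W : E → ℝ≥0∞) (p q : ℝ≥0∞) :
    wnorm θ W p q (fun y => c * g y) ≤ ‖c‖ₑ * wnorm θ W p q g := by
  refine le_trans (eLpNorm_ennreal_mono fun ξ => ?_) (eLpNorm_const_mul_le (enorm_ne_top (x := c)) _)
  rw [eLpNorm_cv_const_mul]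
  exact le_of_eq (by ring)

theorem wnorm_add_le (hg : BddCont g) (hh : BddCont h) {θ : E → ℂ} (hθ : IsWindow θ)
    {W : E → ℝ≥0∞} (hW : Measurable W) {p q : ℝ≥0∞} (hp : 1 ≤ p) (hq : 1 ≤ q) :
    wnorm θ W p q (fun y => g y + h y) ≤ wnorm θ W p q g + wnorm θ W p q h := by
  refine le_trans (eLpNorm_ennreal_mono fun ξ => ?_)
    (eLpNorm_ennreal_add_le hq (measurable_wnorm_integrand hg hθ hW p)
      (measurable_wnorm_integrand hh hθ hW p))
  rw [← mul_add]
  refine mul_le_mul' le_rfl ?_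
  have : cv (fun y => g y + h y) (modul ξ θ) = cv g (modul ξ θ) + cv h (modul ξ θ) := by
    funext x
    simp only [cv, add_mul, Pi.add_apply]
    exact integral_add (integrable_cv_integrand hg (hθ.modul ξ).int x)
      (integrable_cv_integrand hh (hθ.modul ξ).int x)
  rw [this]
  exact eLpNorm_add_le (hg.cv (hθ.modul ξ).int).cont.aestronglyMeasurable
    (hh.cv (hθ.modul ξ).int).cont.aestronglyMeasurable hp

/-- The constant of the product estimate. -/
noncomputable def prodConst (ψ : 𝓢(E, ℂ)) : ℝ≥0∞ :=
  ((ENNReal.ofReal ((2 * Real.pi) ^ Module.finrank ℝ E) * ‖ψ 0‖ₑ) ^ 2)⁻¹ * (∫⁻ t, ‖ψ t‖ₑ)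

theorem IsBandWindow.inv_ne_top (hψ : IsBandWindow ψ b) :
    (ENNReal.ofReal ((2 * Real.pi) ^ Module.finrank ℝ E) * ‖ψ 0‖ₑ) ≠ 0 := by
  refine mul_ne_zero ?_ (by simpa using hψ.ne_zero)
  simp only [ne_eq, ENNReal.ofReal_eq_zero, not_le]
  positivity

theorem IsBandWindow.prodConst_ne_top (hψ : IsBandWindow ψ b) : prodConst ψ ≠ ⊤ := by
  refine ENNReal.mul_ne_top ?_ (isWindow_schwartz ψ).int.2.ne
  simpa using hψ.inv_ne_top

/-- The product of the pieces at `α` and `β` has spectrum of radius `2` about `α + β`, and the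
window sees one unit further. Only pairs with `|ξ - α - β| < 3` contribute. -/
theorem IsBandWindow.eLpNorm_cv_mul_le (hψ : IsBandWindow ψ b) (hg : BddCont g) (hh : BddCont h)
    (hQg : ∫⁻ ξ, eLpNorm (cv g (modul ξ ψ)) ⊤ < ⊤)
    (hQh : ∫⁻ ξ, eLpNorm (cv h (modul ξ ψ)) ⊤ < ⊤) {p : ℝ≥0∞} (hp : 1 ≤ p) (ξ : E) :
    eLpNorm (cv (fun y => g y * h y) (modul ξ ψ)) p ≤ prodConst ψ *
      ∫⁻ z : E × E, (Metric.ball (0 : E) 3).indicator 1 (ξ - z.1 - z.2) *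
        eLpNorm (fun y => cv g (modul z.1 ψ) y * cv h (modul z.2 ψ) y) p := by
  have hψw := isWindow_schwartz ψ
  set c := (ENNReal.ofReal ((2 * Real.pi) ^ Module.finrank ℝ E) * ‖ψ 0‖ₑ) with hc
  have hc0 : c ^ 2 ≠ 0 := pow_ne_zero _ hψ.inv_ne_top
  have hct : c ^ 2 ≠ ⊤ := ENNReal.pow_ne_top (ENNReal.mul_ne_top ENNReal.ofReal_ne_top enorm_ne_top)
  have hprod : ∀ z : E × E, BddCont fun y => cv g (modul z.1 ψ) y * cv h (modul z.2 ψ) y :=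
    fun z => (hg.cv (hψw.modul z.1).int).mul (hh.cv (hψw.modul z.2).int)
  have hm : Measurable (Function.uncurry fun (x : E) (z : E × E) =>
      ‖cv (fun y => cv g (modul z.1 ψ) y * cv h (modul z.2 ψ) y) (modul ξ ψ) x‖ₑ) := by
    have h1 : Continuous fun w : (E × (E × E)) × E => cv g (modul w.1.2.1 ψ) (w.1.1 - w.2) :=
      (continuous_cv_modul hg hψw).comp
        (f := fun w : (E × (E × E)) × E => (w.1.1 - w.2, w.1.2.1)) (by fun_prop)
    have h2 : Continuous fun w : (E × (E × E)) × E => cv h (modul w.1.2.2 ψ) (w.1.1 - w.2) :=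
      (continuous_cv_modul hh hψw).comp
        (f := fun w : (E × (E × E)) × E => (w.1.1 - w.2, w.1.2.2)) (by fun_prop)
    have h3 := (h1.mul h2).mul ((hψw.modul ξ).cont.comp
      (continuous_snd (X := E × (E × E)) (Y := E)))
    exact (h3.stronglyMeasurable.integral_prod_right' (ν := volume)).measurable.enorm
  have key := eLpNorm_le_mul_lintegral (μ := (volume : Measure E)) (ν := (volume : Measure (E × E)))
    hp (f := cv (fun y => g y * h y) (modul ξ ψ)) (c := (c ^ 2)⁻¹) (ENNReal.inv_ne_top.2 hc0) hm
    (fun x => by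
      have := enorm_cv_mul_le hg hh hQg hQh ξ x
      rw [← hc] at this
      calc ‖cv (fun y => g y * h y) (modul ξ ψ) x‖ₑ
          = (c ^ 2)⁻¹ * (c ^ 2 * ‖cv (fun y => g y * h y) (modul ξ ψ) x‖ₑ) := by
            rw [← mul_assoc, ENNReal.inv_mul_cancel hc0 hct, one_mul]
        _ ≤ _ := mul_le_mul' le_rfl this)
  refine key.trans ?_
  rw [prodConst, ← hc, mul_assoc, ← lintegral_const_mul' _ _ hψw.int.2.ne]
  refine mul_le_mul' le_rfl (lintegral_mono fun z => ?_)
  rw [eLpNorm_enorm (cv (fun y => cv g (modul z.1 ψ) y * cv h (modul z.2 ψ) y) (modul ξ ψ))]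
  by_cases hz : ξ - z.1 - z.2 ∈ Metric.ball (0 : E) 3
  · rw [Set.indicator_of_mem hz, Pi.one_apply, one_mul, mul_comm]
    refine (eLpNorm_cv_le hp (hprod z).cont.measurable (hψw.modul ξ).cont.measurable).trans_eq ?_
    simp only [enorm_modul]
  · have : cv (fun y => cv g (modul z.1 ψ) y * cv h (modul z.2 ψ) y) (modul ξ ψ) = 0 := by
      funext x
      refine hψ.hasSpec_cv_mul_cv hg hh z.1 z.2 ξ x ?_
      rw [mem_ball_zero_iff, not_lt] at hz
      rw [← sub_sub]
      linarith
    rw [this]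
    simp

/-- `W` is controlled by products of `W` and `V` under addition of frequencies. -/
structure IsWeightPair (W V : E → ℝ≥0∞) (K : ℝ≥0∞) : Prop where
  measW : Measurable W
  measV : Measurable V
  one_le : ∀ ξ, 1 ≤ V ξ
  ne_top : K ≠ ⊤
  le : ∀ ξ α β, ‖ξ - α - β‖ < 3 → W ξ ≤ K * (W α * V β + V α * W β)

theorem lintegral_lt_top_of_wnorm {V : E → ℝ≥0∞} (hV : ∀ ξ, 1 ≤ V ξ) {θ : E → ℂ}
    (h : wnorm θ V ⊤ 1 g < ⊤) : ∫⁻ ξ, eLpNorm (cv g (modul ξ θ)) ⊤ < ⊤ := by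
  rw [wnorm_one] at h
  exact lt_of_le_of_lt (lintegral_mono fun ξ => le_mul_of_one_le_left' (hV ξ)) h

/-- The weight inequality produces two terms, each placing `W` on one factor and `V` on the other.
In each term Hölder gives the `L^p` norm to the factor carrying `W` and the supremum norm to the one
carrying `V`. Young's inequality in frequency then puts the former in `L^q` and the latter in `L¹`.
-/
theorem IsBandWindow.wnorm_mul_le (hψ : IsBandWindow ψ b) {W V : E → ℝ≥0∞} {K : ℝ≥0∞}
    (hWV : IsWeightPair W V K) (hg : BddCont g) (hh : BddCont h)
    (hMg : wnorm ψ V ⊤ 1 g < ⊤) (hMh : wnorm ψ V ⊤ 1 h < ⊤) {p q : ℝ≥0∞} (hp : 1 ≤ p)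
    (hq : 1 ≤ q) :
    wnorm ψ W p q (fun y => g y * h y) ≤ (K * prodConst ψ * volume (Metric.ball (0 : E) 3)) *
      (wnorm ψ W p q g * wnorm ψ V ⊤ 1 h + wnorm ψ V ⊤ 1 g * wnorm ψ W p q h) := by
  have hψw := isWindow_schwartz ψ
  have hQg := lintegral_lt_top_of_wnorm hWV.one_le hMg
  have hQh := lintegral_lt_top_of_wnorm hWV.one_le hMh
  set k : E → ℝ≥0∞ := (Metric.ball (0 : E) 3).indicator 1 with hk
  have hkm : Measurable k := measurable_one.indicator measurableSet_ball
  have hk1 : ∫⁻ x, k x = volume (Metric.ball (0 : E) 3) := by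
    rw [hk, lintegral_indicator_one measurableSet_ball]
  set F := fun ξ => W ξ * eLpNorm (cv g (modul ξ ψ)) p volume with hF
  set F' := fun ξ => W ξ * eLpNorm (cv h (modul ξ ψ)) p volume with hF'
  set G := fun ξ => V ξ * eLpNorm (cv g (modul ξ ψ)) ⊤ volume with hG
  set G' := fun ξ => V ξ * eLpNorm (cv h (modul ξ ψ)) ⊤ volume with hG'
  have hFm : Measurable F := measurable_wnorm_integrand hg hψw hWV.measW p
  have hFm' : Measurable F' := measurable_wnorm_integrand hh hψw hWV.measW p
  have hGm : Measurable G := measurable_wnorm_integrand hg hψw hWV.measV ⊤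
  have hGm' : Measurable G' := measurable_wnorm_integrand hh hψw hWV.measV ⊤
  have hkp : Measurable fun z : E × (E × E) => k (z.1 - z.2.1 - z.2.2) := hkm.comp (by fun_prop)
  have hm1 : Measurable fun z : E × (E × E) => k (z.1 - z.2.1 - z.2.2) * (F z.2.1 * G' z.2.2) :=
    hkp.mul ((hFm.comp (by fun_prop)).mul (hGm'.comp (by fun_prop)))
  have hm2 : Measurable fun z : E × (E × E) => k (z.1 - z.2.1 - z.2.2) * (G z.2.1 * F' z.2.2) :=
    hkp.mul ((hGm.comp (by fun_prop)).mul (hFm'.comp (by fun_prop)))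
  set T1 := fun ξ => ∫⁻ z : E × E, k (ξ - z.1 - z.2) * (F z.1 * G' z.2) with hT1
  set T2 := fun ξ => ∫⁻ z : E × E, k (ξ - z.1 - z.2) * (G z.1 * F' z.2) with hT2
  have hpt : ∀ ξ, W ξ * eLpNorm (cv (fun y => g y * h y) (modul ξ ψ)) p volume ≤
      (K * prodConst ψ) * (T1 ξ + T2 ξ) := by
    intro ξ
    have hm1' : Measurable fun z : E × E => k (ξ - z.1 - z.2) * (F z.1 * G' z.2) :=
      hm1.comp measurable_prodMk_left
    have hm3 : Measurable fun z : E × E =>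
        k (ξ - z.1 - z.2) * (F z.1 * G' z.2) + k (ξ - z.1 - z.2) * (G z.1 * F' z.2) :=
      hm1'.add (hm2.comp measurable_prodMk_left)
    refine (mul_le_mul' le_rfl (hψ.eLpNorm_cv_mul_le hg hh hQg hQh hp ξ)).trans ?_
    rw [hT1, hT2]
    beta_reduce
    rw [← lintegral_add_left hm1', mul_comm K, mul_assoc, ← lintegral_const_mul _ hm3,
      ← mul_assoc, mul_comm (W ξ), mul_assoc]
    refine mul_le_mul' le_rfl ?_
    refine (lintegral_const_mul_le _ _).trans (lintegral_mono fun z => ?_)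
    by_cases hz : ξ - z.1 - z.2 ∈ Metric.ball (0 : E) 3
    · have hz' : k (ξ - z.1 - z.2) = 1 := by rw [hk, Set.indicator_of_mem hz, Pi.one_apply]
      have h1 := eLpNorm_mul_le_min (hg.cv (hψw.modul z.1).int).cont
        (hh.cv (hψw.modul z.2).int).cont p
      have h2 := h1.trans (min_le_left _ _)
      have h3 := h1.trans (min_le_right _ _)
      rw [← hk, hz', one_mul, one_mul, one_mul]
      calc W ξ * _ ≤ (K * (W z.1 * V z.2 + V z.1 * W z.2)) *
            eLpNorm (fun y => cv g (modul z.1 ψ) y * cv h (modul z.2 ψ) y) p volume :=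
            mul_le_mul' (hWV.le _ _ _ (by simpa using hz)) le_rfl
        _ = K * ((W z.1 * V z.2) *
              eLpNorm (fun y => cv g (modul z.1 ψ) y * cv h (modul z.2 ψ) y) p volume +
            (V z.1 * W z.2) *
              eLpNorm (fun y => cv g (modul z.1 ψ) y * cv h (modul z.2 ψ) y) p volume) := by ring
        _ ≤ K * ((W z.1 * V z.2) * (eLpNorm (cv g (modul z.1 ψ)) p volume *
              eLpNorm (cv h (modul z.2 ψ)) ⊤ volume) +
            (V z.1 * W z.2) * (eLpNorm (cv g (modul z.1 ψ)) ⊤ volume *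
              eLpNorm (cv h (modul z.2 ψ)) p volume)) :=
            mul_le_mul' le_rfl (add_le_add (mul_le_mul' le_rfl h2) (mul_le_mul' le_rfl h3))
        _ = _ := by simp only [hF, hF', hG, hG']; ring
    · have hz' : k (ξ - z.1 - z.2) = 0 := by rw [hk, Set.indicator_of_notMem hz]
      rw [← hk, hz']
      simp
  have hC : K * prodConst ψ ≠ ⊤ := ENNReal.mul_ne_top hWV.ne_top hψ.prodConst_ne_top
  have hT1m : Measurable T1 := hm1.lintegral_prod_right'
  have hT2m : Measurable T2 := hm2.lintegral_prod_right'
  have hN1 : eLpNorm T1 q volume ≤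
      (wnorm ψ W p q g * volume (Metric.ball (0 : E) 3)) * wnorm ψ V ⊤ 1 h := by
    rw [← hk1, wnorm_one]
    exact eLpNorm_lconv_prod_le hq hkm hFm hGm'
  have hN2 : eLpNorm T2 q volume ≤
      (wnorm ψ W p q h * volume (Metric.ball (0 : E) 3)) * wnorm ψ V ⊤ 1 g := by
    rw [← hk1, wnorm_one]
    have hs : T2 = fun ξ => ∫⁻ z : E × E, k (ξ - z.1 - z.2) * (F' z.1 * G z.2) := by
      funext ξ
      rw [hT2]
      beta_reduce
      have hm2' : Measurable fun z : E × E => k (ξ - z.1 - z.2) * (G z.1 * F' z.2) :=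
        hm2.comp measurable_prodMk_left
      rw [Measure.volume_eq_prod, ← lintegral_prod_swap]
      refine lintegral_congr fun z => ?_
      simp only [Prod.fst_swap, Prod.snd_swap]
      rw [sub_right_comm, mul_comm (G z.2)]
    rw [hs]
    exact eLpNorm_lconv_prod_le hq hkm hFm' hGm
  calc wnorm ψ W p q (fun y => g y * h y)
      ≤ eLpNorm (fun ξ => (K * prodConst ψ) * (T1 ξ + T2 ξ)) q volume :=
        eLpNorm_ennreal_mono hpt
    _ ≤ (K * prodConst ψ) * eLpNorm (fun ξ => T1 ξ + T2 ξ) q volume := eLpNorm_const_mul_le hC _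
    _ ≤ (K * prodConst ψ) * (eLpNorm T1 q volume + eLpNorm T2 q volume) :=
        mul_le_mul' le_rfl (eLpNorm_ennreal_add_le hq hT1m hT2m)
    _ ≤ _ := mul_le_mul' le_rfl (add_le_add hN1 hN2)
    _ = _ := by ring

end WeightedNorms

/-- The exponential series in `[0, ∞]`. -/
noncomputable def expSum (a : ℝ≥0∞) : ℝ≥0∞ := ∑' k : ℕ, a ^ k * (k.factorial : ℝ≥0∞)⁻¹

theorem ofReal_pow_mul_inv_factorial {a : ℝ} (ha : 0 ≤ a) (k : ℕ) :
    ENNReal.ofReal a ^ k * (k.factorial : ℝ≥0∞)⁻¹ = ENNReal.ofReal (a ^ k / k.factorial) := by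
  rw [div_eq_mul_inv, ENNReal.ofReal_mul (by positivity), ENNReal.ofReal_pow ha,
    ENNReal.ofReal_inv_of_pos (by positivity), ENNReal.ofReal_natCast]

theorem expSum_ofReal {a : ℝ} (ha : 0 ≤ a) :
    expSum (ENNReal.ofReal a) = ENNReal.ofReal (Real.exp a) := by
  have h : HasSum (fun k : ℕ => a ^ k / k.factorial) (Real.exp a) := by
    rw [Real.exp_eq_exp_ℝ]
    exact NormedSpace.expSeries_div_hasSum_exp a
  simp only [expSum, ofReal_pow_mul_inv_factorial ha]
  rw [← ENNReal.ofReal_tsum_of_nonneg (fun k => by positivity) h.summable, h.tsum_eq]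

theorem expSum_ne_top {a : ℝ≥0∞} (ha : a ≠ ⊤) : expSum a ≠ ⊤ := by
  rw [← ENNReal.ofReal_toReal ha, expSum_ofReal ENNReal.toReal_nonneg]
  exact ENNReal.ofReal_ne_top

theorem expSum_mono {a c : ℝ≥0∞} (h : a ≤ c) : expSum a ≤ expSum c :=
  ENNReal.tsum_le_tsum fun k => mul_le_mul' (pow_le_pow_left' h k) le_rfl

theorem hasSum_exp_sub_one (z : ℂ) :
    HasSum (fun k : ℕ => (((k + 1).factorial : ℂ))⁻¹ * z ^ (k + 1)) (Complex.exp z - 1) := by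
  have h : HasSum (fun k : ℕ => z ^ k / k.factorial) (Complex.exp z) := by
    rw [Complex.exp_eq_exp_ℂ]
    exact NormedSpace.expSeries_div_hasSum_exp z
  have := (hasSum_nat_add_iff' 1).2 h
  simp only [Finset.range_one, Finset.sum_singleton, pow_zero, Nat.factorial_zero, Nat.cast_one,
    div_one] at this
  simpa only [div_eq_mul_inv, mul_comm] using this

theorem BddCont.exp_sub_one {X : Type*} [TopologicalSpace X] {g : X → ℂ} (hg : BddCont g) :
    BddCont fun x => Complex.exp (g x) - 1 := by
  obtain ⟨C, hC⟩ := hg.bdd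
  refine ⟨hg.cont.cexp.sub continuous_const, Real.exp C + 1, fun x => ?_⟩
  refine (norm_sub_le _ _).trans ?_
  rw [Complex.norm_exp, norm_one]
  gcongr
  exact (Complex.re_le_norm _).trans (hC x)

theorem BddCont.exp_sub_one_eq {X : Type*} [TopologicalSpace X] {g : X → ℂ} (hg : BddCont g) :
    ∃ a : ℕ → ℝ, Summable a ∧
      (∀ k x, ‖(((k + 1).factorial : ℂ))⁻¹ * g x ^ (k + 1)‖ ≤ a k) ∧
      (fun x => Complex.exp (g x) - 1) =
        fun x => ∑' k : ℕ, (((k + 1).factorial : ℂ))⁻¹ * g x ^ (k + 1) := by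
  obtain ⟨C, hC⟩ := hg.bdd
  refine ⟨fun k => C ^ (k + 1) / (k + 1).factorial,
    (summable_nat_add_iff 1).2 (Real.summable_pow_div_factorial C), fun k x => ?_, ?_⟩
  · rw [norm_mul, norm_pow, norm_inv, Complex.norm_natCast]
    beta_reduce
    rw [div_eq_inv_mul]
    gcongr
    exact hC x
  · funext x
    exact (hasSum_exp_sub_one (g x)).tsum_eq.symm

/-! ### Powers and exponentials in the weighted norms. -/

section Exponential

variable {E : Type*} [NormedAddCommGroup E] [InnerProductSpace ℝ E] [FiniteDimensional ℝ E]
  [MeasurableSpace E] [BorelSpace E]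

variable {ψ b : 𝓢(E, ℂ)} {g : E → ℂ}

/-- The constant of the algebra estimate. -/
noncomputable def algConst (ψ : 𝓢(E, ℂ)) (K : ℝ≥0∞) : ℝ≥0∞ :=
  2 * (K * prodConst ψ * volume (Metric.ball (0 : E) 3))

theorem IsBandWindow.algConst_ne_top (hψ : IsBandWindow ψ b) {K : ℝ≥0∞} (hK : K ≠ ⊤) :
    algConst ψ K ≠ ⊤ :=
  ENNReal.mul_ne_top (by simp) (ENNReal.mul_ne_top (ENNReal.mul_ne_top hK hψ.prodConst_ne_top)
    measure_ball_lt_top.ne)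

theorem IsBandWindow.wnorm_mul_le_algConst (hψ : IsBandWindow ψ b) {W V : E → ℝ≥0∞} {K : ℝ≥0∞}
    (hWV : IsWeightPair W V K) {h : E → ℂ} (hg : BddCont g) (hh : BddCont h)
    (hMg : wnorm ψ V ⊤ 1 g < ⊤) (hMh : wnorm ψ V ⊤ 1 h < ⊤) {p q : ℝ≥0∞} (hp : 1 ≤ p)
    (hq : 1 ≤ q) :
    wnorm ψ W p q (fun y => g y * h y) ≤ algConst ψ K *
      (wnorm ψ W p q g * wnorm ψ V ⊤ 1 h + wnorm ψ V ⊤ 1 g * wnorm ψ W p q h) := by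
  refine (hψ.wnorm_mul_le hWV hg hh hMg hMh hp hq).trans (mul_le_mul' ?_ le_rfl)
  rw [algConst, two_mul]
  exact le_self_add

/-- For `W = V` the two terms of the product estimate coincide, which is the origin of the factor
`2` in `algConst`. -/
theorem IsBandWindow.wnorm_mul_self_le (hψ : IsBandWindow ψ b) {V : E → ℝ≥0∞} {K : ℝ≥0∞}
    (hV : IsWeightPair V V K) {h : E → ℂ} (hg : BddCont g) (hh : BddCont h)
    (hMg : wnorm ψ V ⊤ 1 g < ⊤) (hMh : wnorm ψ V ⊤ 1 h < ⊤) :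
    wnorm ψ V ⊤ 1 (fun y => g y * h y) ≤
      algConst ψ K * (wnorm ψ V ⊤ 1 g * wnorm ψ V ⊤ 1 h) := by
  refine (hψ.wnorm_mul_le hV hg hh hMg hMh le_top le_rfl).trans (le_of_eq ?_)
  rw [algConst]
  ring

theorem IsBandWindow.wnorm_pow_self_le (hψ : IsBandWindow ψ b) {V : E → ℝ≥0∞} {K : ℝ≥0∞}
    (hV : IsWeightPair V V K) (hg : BddCont g) (hMg : wnorm ψ V ⊤ 1 g < ⊤) (k : ℕ) :
    wnorm ψ V ⊤ 1 (fun y => g y ^ (k + 1)) ≤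
      algConst ψ K ^ k * wnorm ψ V ⊤ 1 g ^ (k + 1) := by
  induction k with
  | zero => simp
  | succ k ih =>
    have hf : wnorm ψ V ⊤ 1 (fun y => g y ^ (k + 1)) < ⊤ :=
      lt_of_le_of_lt ih (ENNReal.mul_lt_top
        (ENNReal.pow_ne_top (hψ.algConst_ne_top hV.ne_top)).lt_top
        (ENNReal.pow_ne_top hMg.ne).lt_top)
    have h1 := hψ.wnorm_mul_self_le hV (hg.pow (k + 1)) hg hf hMg
    simp_rw [pow_succ _ (k + 1)]
    refine h1.trans ((mul_le_mul' le_rfl (mul_le_mul' ih le_rfl)).trans (le_of_eq ?_))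
    rw [pow_succ (algConst ψ K) k]
    ring

/-- As in the Leibniz rule, exactly one of the `k + 1` factors carries `W`, so the constant grows
only linearly apart from the geometric part. In the exponential series the factor `k + 1` cancels
against `(k + 1)!`. -/
theorem IsBandWindow.wnorm_pow_le (hψ : IsBandWindow ψ b) {W V : E → ℝ≥0∞} {K : ℝ≥0∞}
    (hWV : IsWeightPair W V K) (hV : IsWeightPair V V K) (hg : BddCont g)
    (hMg : wnorm ψ V ⊤ 1 g < ⊤) {p q : ℝ≥0∞} (hp : 1 ≤ p) (hq : 1 ≤ q) (k : ℕ) :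
    wnorm ψ W p q (fun y => g y ^ (k + 1)) ≤
      (k + 1 : ℕ) * (wnorm ψ W p q g * (algConst ψ K * wnorm ψ V ⊤ 1 g) ^ k) := by
  induction k with
  | zero => simp
  | succ k ih =>
    have hM := hψ.wnorm_pow_self_le hV hg hMg k
    have hf : wnorm ψ V ⊤ 1 (fun y => g y ^ (k + 1)) < ⊤ :=
      lt_of_le_of_lt hM (ENNReal.mul_lt_top
        (ENNReal.pow_ne_top (hψ.algConst_ne_top hV.ne_top)).lt_top
        (ENNReal.pow_ne_top hMg.ne).lt_top)
    have h1 := hψ.wnorm_mul_le_algConst hWV (hg.pow (k + 1)) hg hf hMg hp hq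
    simp_rw [pow_succ _ (k + 1)]
    refine h1.trans ((mul_le_mul' le_rfl (add_le_add (mul_le_mul' ih le_rfl)
      (mul_le_mul' hM le_rfl))).trans (le_of_eq ?_))
    rw [pow_succ _ k, mul_pow]
    push_cast
    ring

/-- Exponentials in weighted modulation spaces. -/
theorem IsBandWindow.wnorm_exp_sub_one_le (hψ : IsBandWindow ψ b) {W V : E → ℝ≥0∞} {K : ℝ≥0∞}
    (hWV : IsWeightPair W V K) (hV : IsWeightPair V V K) (hg : BddCont g)
    (hMg : wnorm ψ V ⊤ 1 g < ⊤) {p q : ℝ≥0∞} (hp : 1 ≤ p) (hq : 1 ≤ q) :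
    wnorm ψ W p q (fun y => Complex.exp (g y) - 1) ≤
      wnorm ψ W p q g * expSum (algConst ψ K * wnorm ψ V ⊤ 1 g) := by
  obtain ⟨a, ha, hga, he⟩ := hg.exp_sub_one_eq
  rw [he]
  refine (wnorm_tsum_le (f := fun k y => (((k + 1).factorial : ℂ))⁻¹ * g y ^ (k + 1))
    (fun k => continuous_const.mul (hg.pow _).cont) hga ha
    (isWindow_schwartz ψ) hWV.measW hp hq).trans ?_
  rw [expSum, ← ENNReal.tsum_mul_left]
  refine ENNReal.tsum_le_tsum fun k => ?_
  refine (wnorm_const_mul_le _ _ _ _ _).trans ?_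
  refine (mul_le_mul' le_rfl (hψ.wnorm_pow_le hWV hV hg hMg hp hq k)).trans (le_of_eq ?_)
  have h1 : ‖(((k + 1).factorial : ℂ))⁻¹‖ₑ = ((k + 1 : ℕ) : ℝ≥0∞)⁻¹ * (k.factorial : ℝ≥0∞)⁻¹ := by
    rw [enorm_inv (by exact_mod_cast (k + 1).factorial_ne_zero), Nat.factorial_succ]
    rw [← ofReal_norm, Complex.norm_natCast, ENNReal.ofReal_natCast, Nat.cast_mul,
      ENNReal.mul_inv (by simp) (by simp)]
  rw [h1]
  have h2 : ((k + 1 : ℕ) : ℝ≥0∞)⁻¹ * ((k + 1 : ℕ) : ℝ≥0∞) = 1 :=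
    ENNReal.inv_mul_cancel (by simp) (by simp)
  calc ((k + 1 : ℕ) : ℝ≥0∞)⁻¹ * (k.factorial : ℝ≥0∞)⁻¹ * (((k + 1 : ℕ) : ℝ≥0∞) *
        (wnorm ψ W p q g * (algConst ψ K * wnorm ψ V ⊤ 1 g) ^ k))
      = (((k + 1 : ℕ) : ℝ≥0∞)⁻¹ * ((k + 1 : ℕ) : ℝ≥0∞)) * (wnorm ψ W p q g *
        ((algConst ψ K * wnorm ψ V ⊤ 1 g) ^ k * (k.factorial : ℝ≥0∞)⁻¹)) := by ring
    _ = _ := by rw [h2, one_mul]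

end Exponential

/-! ### Concavity of `t ↦ t^r` and the pairs of weights derived from it. -/

section Weights

/-- The numbers `x` and `2y` are convex combinations of `y` and `x + y` with complementary
coefficients, so concavity gives `(x + y)^r + y^r ≤ x^r + (2y)^r`. The gain is that `2^r - 1 < 1`:
the smaller frequency needs a strictly weaker weight. -/
theorem add_rpow_le_of_le {r : ℝ} (hr : 0 < r) (hr1 : r < 1) {x y : ℝ} (hy : 0 ≤ y) (hxy : y ≤ x) :
    (x + y) ^ r ≤ x ^ r + (2 ^ r - 1) * y ^ r := by
  rcases eq_or_lt_of_le (hy.trans hxy) with h0 | h0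
  · have : y = 0 := by linarith
    subst h0 this
    simp [Real.zero_rpow hr.ne']
  have hc := (Real.concaveOn_rpow hr.le hr1.le).2
  have ha : 0 ≤ y / x := by positivity
  have hb : 0 ≤ 1 - y / x := by rw [sub_nonneg, div_le_one h0]; exact hxy
  have h1 := hc (x := y) (y := x + y) hy (by simp; linarith) ha hb (by ring)
  have h2 := hc (x := x + y) (y := y) (by simp; linarith) hy ha hb (by ring)
  simp only [smul_eq_mul] at h1 h2
  have e1 : y / x * y + (1 - y / x) * (x + y) = x := by field_simp; ring
  have e2 : y / x * (x + y) + (1 - y / x) * y = 2 * y := by field_simp; ring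
  rw [e1] at h1
  rw [e2, Real.mul_rpow (by norm_num) hy] at h2
  linarith

variable {E : Type*} [NormedAddCommGroup E]

/-- The weight `e^{δ|ξ|^r}`. -/
noncomputable def expWeight (r δ : ℝ) (ξ : E) : ℝ≥0∞ := ENNReal.ofReal (Real.exp (δ * ‖ξ‖ ^ r))

theorem expWeight_mono {r δ δ' : ℝ} (h : δ ≤ δ') (ξ : E) :
    expWeight r δ ξ ≤ expWeight r δ' ξ := by
  unfold expWeight
  gcongr

theorem one_le_expWeight {r δ : ℝ} (hδ : 0 ≤ δ) (ξ : E) : 1 ≤ expWeight r δ ξ := by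
  rw [expWeight, ENNReal.one_le_ofReal, Real.one_le_exp_iff]
  positivity

variable [MeasurableSpace E] [BorelSpace E]

theorem measurable_expWeight (r δ : ℝ) : Measurable (expWeight r δ : E → ℝ≥0∞) := by
  unfold expWeight
  fun_prop

theorem isWeightPair_self {r δ : ℝ} (hr : 0 < r) (hr1 : r < 1) (hδ : 0 ≤ δ) (hδ1 : δ ≤ 1) :
    IsWeightPair (expWeight r δ : E → ℝ≥0∞) (expWeight r δ) (ENNReal.ofReal (Real.exp (3 ^ r))) := by
  refine ⟨measurable_expWeight r δ, measurable_expWeight r δ, one_le_expWeight hδ,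
    ENNReal.ofReal_ne_top, fun ξ α β h => ?_⟩
  have h1 : expWeight r δ ξ ≤
      ENNReal.ofReal (Real.exp (3 ^ r)) * (expWeight r δ α * expWeight r δ β) := by
    unfold expWeight
    rw [← ENNReal.ofReal_mul (by positivity), ← ENNReal.ofReal_mul (by positivity), ← Real.exp_add,
      ← Real.exp_add]
    gcongr
    have e1 := norm_rpow_le_add hr hr1 (ξ - α - β) (α + β)
    have e2 := norm_rpow_le_add hr hr1 α β
    rw [show ξ - α - β + (α + β) = ξ by abel] at e1
    have e3 : ‖ξ - α - β‖ ^ r ≤ 3 ^ r := Real.rpow_le_rpow (norm_nonneg _) h.le hr.le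
    have e4 : (0 : ℝ) ≤ 3 ^ r := by positivity
    calc δ * ‖ξ‖ ^ r ≤ δ * (3 ^ r + (‖α‖ ^ r + ‖β‖ ^ r)) := by gcongr; linarith
      _ ≤ _ := by nlinarith
  refine h1.trans (mul_le_mul' le_rfl le_self_add)

/-- The larger of the two frequencies carries the full weight and the smaller one the weight with
exponent `δ`. The error `|ξ - α - β| < 3` costs `e^{3^r}`. -/
theorem isWeightPair_one {r δ : ℝ} (hr : 0 < r) (hr1 : r < 1) (hδ : 2 ^ r - 1 ≤ δ) :
    IsWeightPair (expWeight r 1 : E → ℝ≥0∞) (expWeight r δ) (ENNReal.ofReal (Real.exp (3 ^ r))) := by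
  have h2r : (1 : ℝ) ≤ 2 ^ r := Real.one_le_rpow (by norm_num) hr.le
  refine ⟨measurable_expWeight r 1, measurable_expWeight r δ, one_le_expWeight (by linarith),
    ENNReal.ofReal_ne_top, ?_⟩
  have h1 : ∀ ξ α β : E, ‖ξ - α - β‖ < 3 → ‖β‖ ≤ ‖α‖ → expWeight r 1 ξ ≤
      ENNReal.ofReal (Real.exp (3 ^ r)) * (expWeight r 1 α * expWeight r δ β) := by
    intro ξ α β h hba
    unfold expWeight
    rw [← ENNReal.ofReal_mul (by positivity), ← ENNReal.ofReal_mul (by positivity), ← Real.exp_add,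
      ← Real.exp_add]
    gcongr
    have e1 := norm_rpow_le_add hr hr1 (ξ - α - β) (α + β)
    rw [show ξ - α - β + (α + β) = ξ by abel] at e1
    have e2 : ‖α + β‖ ^ r ≤ (‖α‖ + ‖β‖) ^ r :=
      Real.rpow_le_rpow (norm_nonneg _) (norm_add_le _ _) hr.le
    have e5 := add_rpow_le_of_le hr hr1 (norm_nonneg β) hba
    have e3 : ‖ξ - α - β‖ ^ r ≤ 3 ^ r := Real.rpow_le_rpow (norm_nonneg _) h.le hr.le
    have e4 : (2 ^ r - 1) * ‖β‖ ^ r ≤ δ * ‖β‖ ^ r := by gcongr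
    linarith
  intro ξ α β h
  rcases le_total ‖β‖ ‖α‖ with hba | hba
  · exact (h1 ξ α β h hba).trans (mul_le_mul' le_rfl le_self_add)
  · refine (h1 ξ β α (by rwa [sub_right_comm]) hba).trans (mul_le_mul' le_rfl ?_)
    rw [mul_comm]
    exact le_add_self

end Weights

/-! ### Sharp frequency cut-offs. -/

section FrequencyParts

variable {E : Type*} [NormedAddCommGroup E] [InnerProductSpace ℝ E] [FiniteDimensional ℝ E]
  [MeasurableSpace E] [BorelSpace E]

/-- The normalising constant in the inversion formula. -/
noncomputable def invConst (ψ : 𝓢(E, ℂ)) : ℂ :=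
  ((2 * Real.pi) ^ Module.finrank ℝ E : ℝ) * ψ 0

/-- The part of `g` with frequencies in `S`. -/
noncomputable def spart (ψ : 𝓢(E, ℂ)) (g : E → ℂ) (S : Set E) (x : E) : ℂ :=
  (invConst ψ)⁻¹ * ∫ ξ in S, cv g (modul ξ ψ) x

variable {ψ b : 𝓢(E, ℂ)} {g h : E → ℂ} {S : Set E}

theorem IsBandWindow.invConst_ne_zero (hψ : IsBandWindow ψ b) : invConst ψ ≠ 0 := by
  refine mul_ne_zero ?_ hψ.ne_zero
  have : ((2 * Real.pi) ^ Module.finrank ℝ E : ℝ) ≠ 0 := by positivity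
  exact_mod_cast this

theorem norm_cv_le_toReal (hg : BddCont g) {θ : E → ℂ} (hθ : IsWindow θ) (x : E) :
    ‖cv g θ x‖ ≤ (eLpNorm (cv g θ) ⊤ volume).toReal := by
  have hb := hg.cv hθ.int
  obtain ⟨C, hC⟩ := hb.bdd
  have h1 : eLpNorm (cv g θ) ⊤ volume ≠ ⊤ := by
    rw [eLpNorm_exponent_top]
    exact (eLpNormEssSup_lt_top_of_ae_bound (Filter.Eventually.of_forall hC)).ne
  rw [← toReal_enorm]
  exact ENNReal.toReal_mono h1 (enorm_le_eLpNorm_top hb.cont x)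

theorem integrable_toReal_eLpNorm_cv (hg : BddCont g)
    (hQ : ∫⁻ ξ, eLpNorm (cv g (modul ξ ψ)) ⊤ < ⊤) :
    Integrable fun ξ => (eLpNorm (cv g (modul ξ ψ)) ⊤ volume).toReal :=
  integrable_toReal_of_lintegral_ne_top
    (measurable_eLpNorm_cv hg (isWindow_schwartz ψ) ⊤).aemeasurable hQ.ne

theorem bddCont_spart (hg : BddCont g) (hQ : ∫⁻ ξ, eLpNorm (cv g (modul ξ ψ)) ⊤ < ⊤) (S : Set E) :
    BddCont (spart ψ g S) := by
  have hψw := isWindow_schwartz ψ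
  have hi := (integrable_toReal_eLpNorm_cv hg hQ).restrict (s := S)
  have hc : Continuous fun x => ∫ ξ in S, cv g (modul ξ ψ) x := by
    refine continuous_of_dominated (bound := fun ξ => (eLpNorm (cv g (modul ξ ψ)) ⊤ volume).toReal)
      (fun x => ?_) (fun x => ?_) hi ?_
    · exact ((continuous_cv_modul hg hψw).comp
        (continuous_const.prodMk continuous_id)).aestronglyMeasurable
    · exact Filter.Eventually.of_forall fun ξ => norm_cv_le_toReal hg (hψw.modul ξ) x
    · exact Filter.Eventually.of_forall fun ξ => (hg.cv (hψw.modul ξ).int).cont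
  refine (BddCont.const (invConst ψ)⁻¹).mul ⟨hc,
    ∫ ξ in S, (eLpNorm (cv g (modul ξ ψ)) ⊤ volume).toReal, fun x => ?_⟩
  exact norm_integral_le_of_norm_le hi
    (Filter.Eventually.of_forall fun ξ => norm_cv_le_toReal hg (hψw.modul ξ) x)

theorem IsBandWindow.spart_add_compl (hψ : IsBandWindow ψ b) (hg : BddCont g)
    (hQ : ∫⁻ ξ, eLpNorm (cv g (modul ξ ψ)) ⊤ < ⊤) (hS : MeasurableSet S) (x : E) :
    spart ψ g S x + spart ψ g Sᶜ x = g x := by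
  have hψw := isWindow_schwartz ψ
  have hi := integrable_cv_modul hg hψw hQ x
  have h0 := hψ.invConst_ne_zero
  rw [spart, spart, ← mul_add, integral_add_compl hS hi, integral_cv_modul hg hψw x hi]
  have : ((((2 * Real.pi) ^ Module.finrank ℝ E : ℝ) : ℂ) * (g x * ψ 0)) = invConst ψ * g x := by
    rw [invConst]; ring
  rw [this, inv_mul_cancel_left₀ h0]

/-- For real `g` and `ψ`, conjugating the transform at `ξ` gives the transform at `-ξ`, so a
symmetric set of frequencies cuts out a real function. Reality is needed later for `|e^{itv} - 1| ≤
|tv|`. -/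
theorem IsBandWindow.conj_spart (hψ : IsBandWindow ψ b)
    (hr : ∀ x, (starRingEnd ℂ) (g x) = g x) (hS : MeasurableSet S) (hneg : ∀ ξ, -ξ ∈ S ↔ ξ ∈ S)
    (x : E) : (starRingEnd ℂ) (spart ψ g S x) = spart ψ g S x := by
  have h1 : ∀ ξ, (starRingEnd ℂ) (cv g (modul ξ ψ) x) = cv g (modul (-ξ) ψ) x := by
    intro ξ
    rw [cv, ← integral_conj]
    refine integral_congr_ae (Filter.Eventually.of_forall fun t => ?_)
    simp only [map_mul, hr, modul, hψ.real, phase_neg_left]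
  rw [spart, map_mul, ← integral_conj]
  congr 1
  · simp only [invConst, map_inv₀, map_mul, hψ.real, Complex.conj_ofReal]
  · simp_rw [h1]
    rw [← integral_indicator hS, ← integral_indicator hS,
      ← integral_neg_eq_self (S.indicator fun ξ => cv g (modul ξ ψ) x)]
    refine integral_congr_ae (Filter.Eventually.of_forall fun ξ => ?_)
    by_cases hξ : ξ ∈ S <;> simp [hξ, hneg]

theorem cv_mul_spart (hg : BddCont g) (hQ : ∫⁻ ξ, eLpNorm (cv g (modul ξ ψ)) ⊤ < ⊤)
    (hh : BddCont h) {θ : E → ℂ} (hθ : IsWindow θ) (S : Set E) (x : E) :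
    cv (fun y => h y * spart ψ g S y) θ x =
      (invConst ψ)⁻¹ * ∫ ξ in S, cv (fun y => h y * cv g (modul ξ ψ) y) θ x := by
  have hψw := isWindow_schwartz ψ
  obtain ⟨C, hC⟩ := hh.bdd
  have hi := (integrable_toReal_eLpNorm_cv hg hQ).restrict (s := S)
  have h1 : cv (fun y => h y * spart ψ g S y) θ x =
      (invConst ψ)⁻¹ * ∫ t, ∫ ξ in S, h (x - t) * cv g (modul ξ ψ) (x - t) * θ t := by
    rw [cv, ← integral_const_mul]
    refine integral_congr_ae (Filter.Eventually.of_forall fun t => ?_)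
    simp only [spart]
    rw [integral_mul_const, integral_const_mul]
    ring
  rw [h1, integral_integral_swap]
  · rfl
  have hc : Continuous fun z : E × E => h (x - z.1) * cv g (modul z.2 ψ) (x - z.1) * θ z.1 :=
    ((hh.cont.comp (by fun_prop)).mul ((continuous_cv_modul hg hψw).comp
      (f := fun z : E × E => (x - z.1, z.2)) (by fun_prop))).mul (hθ.cont.comp continuous_fst)
  refine ((hθ.int.norm.mul_prod hi).const_mul C).mono' hc.aestronglyMeasurable
    (Filter.Eventually.of_forall fun z => ?_)
  simp only [Function.uncurry, norm_mul]
  calc ‖h (x - z.1)‖ * ‖cv g (modul z.2 ψ) (x - z.1)‖ * ‖θ z.1‖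
      ≤ C * (eLpNorm (cv g (modul z.2 ψ)) ⊤ volume).toReal * ‖θ z.1‖ := by
        refine mul_le_mul_of_nonneg_right ?_ (norm_nonneg _)
        exact mul_le_mul (hC _) (norm_cv_le_toReal hg (hψw.modul _) _) (norm_nonneg _)
          ((norm_nonneg _).trans (hC 0))
    _ = _ := by ring

theorem cv_spart (hg : BddCont g) (hQ : ∫⁻ ξ, eLpNorm (cv g (modul ξ ψ)) ⊤ < ⊤)
    {θ : E → ℂ} (hθ : IsWindow θ) (S : Set E) (x : E) :
    cv (spart ψ g S) θ x = (invConst ψ)⁻¹ * ∫ ξ in S, cv (cv g (modul ξ ψ)) θ x := by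
  simpa using cv_mul_spart hg hQ (BddCont.const 1) hθ S x

/-- Multiplication by a part of frequency at most `R` enlarges the spectrum by `R + 1`. -/
theorem IsBandWindow.hasSpec_mul_spart (hψ : IsBandWindow ψ b) (hg : BddCont g)
    (hQ : ∫⁻ ξ, eLpNorm (cv g (modul ξ ψ)) ⊤ < ⊤) (hh : BddCont h) {ρ R : ℝ}
    (H : HasSpec ψ h 0 ρ) (hR : ∀ ξ ∈ S, ‖ξ‖ ≤ R) :
    HasSpec ψ (fun x => h x * spart ψ g S x) 0 (ρ + R + 1) := by
  intro η x hη
  rw [cv_mul_spart hg hQ hh ((isWindow_schwartz ψ).modul η)]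
  rw [setIntegral_eq_zero_of_forall_eq_zero, mul_zero]
  intro ξ hξ
  refine hψ.hasSpec_mul hh hg (β := ξ) H η x ?_
  have h1 := hR ξ hξ
  have h2 := norm_sub_norm_le η ξ
  rw [sub_zero] at hη
  rw [zero_add]
  linarith

theorem IsBandWindow.hasSpec_spart_pow (hψ : IsBandWindow ψ b) (hg : BddCont g)
    (hQ : ∫⁻ ξ, eLpNorm (cv g (modul ξ ψ)) ⊤ < ⊤) {R : ℝ}
    (hR : ∀ ξ ∈ S, ‖ξ‖ ≤ R) (k : ℕ) :
    HasSpec ψ (fun x => spart ψ g S x ^ k) 0 (k * (R + 1)) := by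
  induction k with
  | zero => simpa using hψ.hasSpec_one
  | succ k ih =>
    have := hψ.hasSpec_mul_spart hg hQ ((bddCont_spart hg hQ S).pow k) ih hR
    simp_rw [pow_succ]
    convert this using 1
    push_cast; ring

theorem eLpNorm_spart_le (hg : BddCont g) {p : ℝ≥0∞} (hp : 1 ≤ p)
    (S : Set E) :
    eLpNorm (spart ψ g S) p ≤ ‖(invConst ψ)⁻¹‖ₑ * ∫⁻ ξ, eLpNorm (cv g (modul ξ ψ)) p := by
  have hψw := isWindow_schwartz ψ
  have h1 : Measurable (Function.uncurry fun x η => ‖cv g (modul η ψ) x‖ₑ) :=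
    (continuous_cv_modul hg hψw).measurable.enorm
  have := eLpNorm_le_mul_lintegral (μ := (volume : Measure E)) (ν := (volume.restrict S)) hp
    (f := spart ψ g S) (c := ‖(invConst ψ)⁻¹‖ₑ) enorm_ne_top h1 (fun x => by
      rw [spart, enorm_mul]
      exact mul_le_mul' le_rfl (enorm_integral_le_lintegral_enorm _))
  refine this.trans (mul_le_mul' le_rfl ?_)
  simp only [eLpNorm_enorm]
  exact setLIntegral_le_lintegral S _

/-- The constant of the estimate for frequency parts. -/
noncomputable def partConst (ψ : 𝓢(E, ℂ)) : ℝ≥0∞ :=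
  ‖(invConst ψ)⁻¹‖ₑ * (∫⁻ t, ‖ψ t‖ₑ) * volume (Metric.ball (0 : E) 2)

theorem partConst_ne_top (ψ : 𝓢(E, ℂ)) : partConst ψ ≠ ⊤ :=
  ENNReal.mul_ne_top (ENNReal.mul_ne_top enorm_ne_top (isWindow_schwartz ψ).int.2.ne)
    measure_ball_lt_top.ne

/-- The piece of `g` at `ξ` has spectrum of radius `1` about `ξ` and the window adds another unit,
so a cut-off mixes only frequencies at distance less than `2`. -/
theorem IsBandWindow.eLpNorm_cv_spart_le (hψ : IsBandWindow ψ b) (hg : BddCont g)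
    (hQ : ∫⁻ ξ, eLpNorm (cv g (modul ξ ψ)) ⊤ < ⊤) {p : ℝ≥0∞} (hp : 1 ≤ p)
    (hS : MeasurableSet S) (η : E) :
    eLpNorm (cv (spart ψ g S) (modul η ψ)) p ≤ (‖(invConst ψ)⁻¹‖ₑ * ∫⁻ t, ‖ψ t‖ₑ) *
      ∫⁻ ξ, (Metric.ball (0 : E) 2).indicator 1 (η - ξ) *
        S.indicator (fun ξ => eLpNorm (cv g (modul ξ ψ)) p) ξ := by
  have hψw := isWindow_schwartz ψ
  have hm : Measurable (Function.uncurry fun (x : E) (ξ : E) =>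
      ‖cv (cv g (modul ξ ψ)) (modul η ψ) x‖ₑ) := by
    have h1 : Continuous fun w : (E × E) × E => cv g (modul w.1.2 ψ) (w.1.1 - w.2) :=
      (continuous_cv_modul hg hψw).comp
        (f := fun w : (E × E) × E => (w.1.1 - w.2, w.1.2)) (by fun_prop)
    have h3 := h1.mul ((hψw.modul η).cont.comp (continuous_snd (X := E × E) (Y := E)))
    exact (h3.stronglyMeasurable.integral_prod_right' (ν := volume)).measurable.enorm
  have := eLpNorm_le_mul_lintegral (μ := (volume : Measure E)) (ν := (volume.restrict S)) hp
    (f := cv (spart ψ g S) (modul η ψ)) (c := ‖(invConst ψ)⁻¹‖ₑ) enorm_ne_top hm (fun x => by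
      rw [cv_spart hg hQ (hψw.modul η), enorm_mul]
      exact mul_le_mul' le_rfl (enorm_integral_le_lintegral_enorm _))
  refine this.trans ?_
  rw [mul_assoc, ← lintegral_const_mul' _ _ hψw.int.2.ne, ← lintegral_indicator hS]
  refine mul_le_mul' le_rfl (lintegral_mono fun ξ => ?_)
  by_cases hξ : ξ ∈ S
  · rw [Set.indicator_of_mem hξ, Set.indicator_of_mem hξ,
      eLpNorm_enorm (cv (cv g (modul ξ ψ)) (modul η ψ))]
    by_cases hz : η - ξ ∈ Metric.ball (0 : E) 2
    · rw [Set.indicator_of_mem hz, Pi.one_apply, one_mul, mul_comm]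
      refine (eLpNorm_cv_le hp (hg.cv (hψw.modul ξ).int).cont.measurable
        (hψw.modul η).cont.measurable).trans_eq ?_
      simp only [enorm_modul]
    · have : cv (cv g (modul ξ ψ)) (modul η ψ) = 0 := by
        funext x
        refine hψ.hasSpec_cv hg ξ η x ?_
        rw [mem_ball_zero_iff, not_lt] at hz
        linarith
      rw [this]
      simp
  · rw [Set.indicator_of_notMem hξ]
    exact zero_le

/-- The two weights need to be compared only for `ξ ∈ S`. When `S` consists of high frequencies and
`W` is weaker than `W'`, the constant `K` can be small. -/
theorem IsBandWindow.wnorm_spart_le (hψ : IsBandWindow ψ b) (hg : BddCont g)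
    (hQ : ∫⁻ ξ, eLpNorm (cv g (modul ξ ψ)) ⊤ < ⊤) {p q : ℝ≥0∞} (hp : 1 ≤ p) (hq : 1 ≤ q)
    (hS : MeasurableSet S) {W W' : E → ℝ≥0∞} {K : ℝ≥0∞} (hW' : Measurable W') (hK : K ≠ ⊤)
    (h : ∀ η, ∀ ξ ∈ S, ‖η - ξ‖ < 2 → W η ≤ K * W' ξ) :
    wnorm ψ W p q (spart ψ g S) ≤ (partConst ψ * K) * wnorm ψ W' p q g := by
  have hψw := isWindow_schwartz ψ
  set k : E → ℝ≥0∞ := (Metric.ball (0 : E) 2).indicator 1 with hk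
  have hkm : Measurable k := measurable_one.indicator measurableSet_ball
  have hk1 : ∫⁻ x, k x = volume (Metric.ball (0 : E) 2) := by
    rw [hk, lintegral_indicator_one measurableSet_ball]
  set F := fun ξ => W' ξ * eLpNorm (cv g (modul ξ ψ)) p volume with hF
  have hFm : Measurable F := measurable_wnorm_integrand hg hψw hW' p
  set c := (‖(invConst ψ)⁻¹‖ₑ * ∫⁻ t, ‖ψ t‖ₑ) with hc
  have hct : c ≠ ⊤ := ENNReal.mul_ne_top enorm_ne_top hψw.int.2.ne
  have hpt : ∀ η, W η * eLpNorm (cv (spart ψ g S) (modul η ψ)) p volume ≤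
      (c * K) * ∫⁻ ξ, F (η - ξ) * k ξ := by
    intro η
    have hm : Measurable fun ξ => F ξ * k (η - ξ) :=
      hFm.mul (hkm.comp (measurable_const.sub measurable_id))
    refine (mul_le_mul' le_rfl (hψ.eLpNorm_cv_spart_le hg hQ hp hS η)).trans ?_
    rw [← hc, ← lintegral_conv_comm F k η, mul_assoc c K, ← lintegral_const_mul K hm,
      ← mul_assoc (W η), mul_comm (W η), mul_assoc c]
    refine mul_le_mul' le_rfl ((lintegral_const_mul_le _ _).trans (lintegral_mono fun ξ => ?_))
    beta_reduce
    rw [← hk]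
    by_cases hξ : ξ ∈ S
    · rw [Set.indicator_of_mem hξ]
      by_cases hz : η - ξ ∈ Metric.ball (0 : E) 2
      · have hz' : k (η - ξ) = 1 := by rw [hk, Set.indicator_of_mem hz, Pi.one_apply]
        rw [hz', one_mul, mul_one, hF]
        beta_reduce
        rw [← mul_assoc]
        exact mul_le_mul' (h η ξ hξ (by simpa using hz)) le_rfl
      · have hz' : k (η - ξ) = 0 := by rw [hk, Set.indicator_of_notMem hz]
        rw [hz']
        simp
    · rw [Set.indicator_of_notMem hξ]
      simp
  have h2 : eLpNorm (fun η => ∫⁻ ξ, F (η - ξ) * k ξ) q volume ≤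
      wnorm ψ W' p q g * volume (Metric.ball (0 : E) 2) := by
    rw [← hk1]
    exact eLpNorm_lconv_le hq (a := F) (b := k) hFm hkm
  calc wnorm ψ W p q (spart ψ g S) ≤ eLpNorm (fun η => (c * K) * ∫⁻ ξ, F (η - ξ) * k ξ) q volume :=
        eLpNorm_ennreal_mono hpt
    _ ≤ (c * K) * eLpNorm (fun η => ∫⁻ ξ, F (η - ξ) * k ξ) q volume :=
        eLpNorm_const_mul_le (ENNReal.mul_ne_top hct hK) _
    _ ≤ _ := mul_le_mul' le_rfl h2
    _ = _ := by rw [partConst, ← hc]; ring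

end FrequencyParts

/-! ### Exponentials of band-limited functions. -/

section Truncation

open Filter Asymptotics in
-- Since `r < 1`, `j^r log j = o(j)` and the exponent is eventually below `2 - j / 2`.
theorem summable_exp_rpow_mul_log_sub {r : ℝ} (hr1 : r < 1) (a : ℝ) :
    Summable fun j : ℕ => Real.exp (2 * ((j : ℝ) ^ r * (a * Real.log j + 1)) + 2 - j) := by
  have h1 : (fun x : ℝ => a * Real.log x + 1) =o[atTop] fun x => x ^ (1 - r) := by
    have hr : 0 < 1 - r := by linarith
    refine ((isLittleO_log_rpow_atTop hr).const_mul_left a).add ?_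
    exact isLittleO_const_left.2 (Or.inr (tendsto_norm_atTop_atTop.comp (tendsto_rpow_atTop hr)))
  have h2 : (fun x : ℝ => x ^ r * (a * Real.log x + 1)) =o[atTop] fun x => x := by
    refine ((isBigO_refl (fun x : ℝ => x ^ r) atTop).mul_isLittleO h1).congr' EventuallyEq.rfl ?_
    filter_upwards [eventually_gt_atTop 0] with x hx
    rw [← Real.rpow_add hx]
    simp
  have h3 := (h2.bound (c := 1 / 4) (by norm_num)).and (eventually_ge_atTop 0)
  have h4 := tendsto_natCast_atTop_atTop (R := ℝ) |>.eventually h3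
  have hg : Summable fun j : ℕ => Real.exp 2 * Real.exp (-(1 / 2)) ^ j :=
    (summable_geometric_of_lt_one (by positivity)
      (by rw [Real.exp_lt_one_iff]; norm_num)).mul_left _
  refine Summable.of_norm_bounded_eventually_nat hg ?_
  filter_upwards [h4] with j hj
  obtain ⟨hj1, hj0⟩ := hj
  rw [Real.norm_of_nonneg (Real.exp_pos _).le, ← Real.exp_nat_mul, ← Real.exp_add]
  gcongr
  rw [Real.norm_of_nonneg hj0] at hj1
  have := (Real.le_norm_self _).trans hj1
  linarith

theorem pow_div_factorial_le_exp_neg {y : ℝ} (hy : 0 ≤ y) {j : ℕ} (hj : Real.exp 2 * y ≤ j) :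
    y ^ j / j.factorial ≤ Real.exp (-j) := by
  have h1 := Real.pow_div_factorial_le_exp (j : ℝ) (by positivity) j
  have h2 : y ≤ Real.exp (-2) * j := by
    rw [Real.exp_neg, inv_mul_eq_div, le_div_iff₀ (Real.exp_pos _)]
    linarith
  calc y ^ j / j.factorial ≤ (Real.exp (-2) * j) ^ j / j.factorial := by gcongr
    _ = Real.exp (-2) ^ j * ((j : ℝ) ^ j / j.factorial) := by rw [mul_pow, mul_div_assoc]
    _ ≤ Real.exp (-2) ^ j * Real.exp j := by gcongr
    _ = Real.exp (-j) := by
      rw [← Real.exp_nat_mul, ← Real.exp_add]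
      congr 1
      ring

/-- The coefficient in the truncated exponential estimate. -/
noncomputable def truncCoeff (r R m B : ℝ) (k₀ : ℕ) : ℝ≥0∞ :=
  ENNReal.ofReal (m * Real.exp (2 * ((k₀ : ℝ) * (R + 1) + 1) ^ r)) +
    ∑' k : ℕ, if k₀ ≤ k then ENNReal.ofReal
      (Real.exp (2 * (((k + 1 : ℕ) : ℝ) * (R + 1) + 1) ^ r) *
        (m ^ (k + 1) * B ^ k / (k + 1).factorial)) else 0

theorem mul_add_one_rpow_le {r : ℝ} (hr : 0 < r) (hr1 : r < 1) {R j : ℝ} (hR : 0 ≤ R)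
    (hj : 0 ≤ j) : (j * (R + 1) + 1) ^ r ≤ j ^ r * (R ^ r + 1) + 1 := by
  have h1 := Real.rpow_add_le_add_rpow (p := r) (by positivity : 0 ≤ j * (R + 1)) zero_le_one
    hr.le hr1.le
  have h2 := Real.rpow_add_le_add_rpow (p := r) hR zero_le_one hr.le hr1.le
  rw [Real.one_rpow] at h1 h2
  rw [Real.mul_rpow hj (by positivity)] at h1
  have : j ^ r * (R + 1) ^ r ≤ j ^ r * (R ^ r + 1) := by gcongr
  linarith

/-- The cut is at `k₀ ≈ e² B m`. Below it, `(k₀(R + 1))^r` is of order `m^r log m` because `R^r = a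
log m`. Beyond it, `(mB)^j / j! ≤ e^{-j}`, which outweighs the subexponential weight. -/
theorem exists_truncCoeff_le {r : ℝ} (hr : 0 < r) (hr1 : r < 1) {a B : ℝ} (ha : 0 ≤ a)
    (hB : 1 ≤ B) :
    ∃ C l : ℝ, 0 ≤ C ∧ 0 ≤ l ∧ ∀ m : ℝ, 2 ≤ m → ∃ k₀ : ℕ,
      truncCoeff r ((a * Real.log m) ^ (1 / r)) m B k₀ ≤
        ENNReal.ofReal (C * Real.exp (l * (m ^ r * Real.log m))) := by
  set D := Real.exp 2 * B + 1 with hD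
  have hD0 : 0 ≤ D := by positivity
  set S := ∑' j : ℕ, Real.exp (2 * ((j : ℝ) ^ r * (a * Real.log j + 1)) + 2 - j) with hS
  have hsum := summable_exp_rpow_mul_log_sub hr1 a
  have hS0 : 0 ≤ S := tsum_nonneg fun j => (Real.exp_pos _).le
  have hlog2 : 0 < Real.log 2 := Real.log_pos (by norm_num)
  -- `S` bounds the tail uniformly in `m`, and `D` satisfies `k₀ ≤ D * m`. The term `1 / log 2`
  -- comes from `m^r ≤ m^r log m / log 2`, and the final `+ 1` absorbs the prefactor `m`.
  refine ⟨Real.exp 2 + S, 2 * (D ^ r * (a + 1 / Real.log 2)) + 1, by positivity, by positivity,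
    fun m hm => ⟨⌈Real.exp 2 * B * m⌉₊, ?_⟩⟩
  have hm0 : 0 < m := by linarith
  have hlogm : Real.log 2 ≤ Real.log m := Real.log_le_log (by norm_num) hm
  have hlogm0 : 0 < Real.log m := by linarith
  set R := (a * Real.log m) ^ (1 / r) with hR
  have hR0 : 0 ≤ R := by positivity
  have hRr : R ^ r = a * Real.log m := by
    rw [hR, ← Real.rpow_mul (by positivity), one_div_mul_cancel hr.ne', Real.rpow_one]
  set k₀ := ⌈Real.exp 2 * B * m⌉₊ with hk₀
  have hk₀1 : Real.exp 2 * B * m ≤ k₀ := Nat.le_ceil _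
  have hk₀2 : (k₀ : ℝ) ≤ D * m := by
    have := (Nat.ceil_lt_add_one (by positivity : 0 ≤ Real.exp 2 * B * m)).le
    rw [← hk₀] at this
    rw [hD]
    nlinarith
  have hmr : 1 ≤ m ^ r := Real.one_le_rpow (by linarith) hr.le
  set L := m ^ r * Real.log m with hL
  have hL0 : 0 ≤ L := by positivity
  have hmL : m ≤ Real.exp L := by
    calc m = Real.exp (Real.log m) := (Real.exp_log hm0).symm
      _ ≤ Real.exp L := by gcongr; nlinarith
  have hmrL : m ^ r ≤ L / Real.log 2 := by
    rw [le_div_iff₀ hlog2, hL]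
    gcongr
  have h1 : m * Real.exp (2 * ((k₀ : ℝ) * (R + 1) + 1) ^ r) ≤
      Real.exp 2 * Real.exp ((2 * (D ^ r * (a + 1 / Real.log 2)) + 1) * L) := by
    have e1 := mul_add_one_rpow_le hr hr1 hR0 (Nat.cast_nonneg k₀)
    have e2 : (k₀ : ℝ) ^ r ≤ D ^ r * m ^ r := by
      rw [← Real.mul_rpow hD0 hm0.le]
      gcongr
    have e3 : m ^ r * (a * Real.log m + 1) ≤ (a + 1 / Real.log 2) * L := by
      have : m ^ r * (a * Real.log m + 1) = a * L + m ^ r := by rw [hL]; ring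
      rw [this, add_mul, one_div_mul_eq_div]
      linarith
    have e4 : ((k₀ : ℝ) * (R + 1) + 1) ^ r ≤ D ^ r * ((a + 1 / Real.log 2) * L) + 1 := by
      refine e1.trans ?_
      rw [hRr]
      have : (k₀ : ℝ) ^ r * (a * Real.log m + 1) ≤ D ^ r * m ^ r * (a * Real.log m + 1) := by gcongr
      have h' : D ^ r * (m ^ r * (a * Real.log m + 1)) ≤ D ^ r * ((a + 1 / Real.log 2) * L) := by
        gcongr
      linarith
    calc m * Real.exp (2 * ((k₀ : ℝ) * (R + 1) + 1) ^ r)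
        ≤ Real.exp L * Real.exp (2 * (D ^ r * ((a + 1 / Real.log 2) * L) + 1)) := by gcongr
      _ = _ := by
        rw [← Real.exp_add, ← Real.exp_add]
        congr 1
        ring
  have h2 : (∑' k : ℕ, if k₀ ≤ k then ENNReal.ofReal
      (Real.exp (2 * (((k + 1 : ℕ) : ℝ) * (R + 1) + 1) ^ r) *
        (m ^ (k + 1) * B ^ k / (k + 1).factorial)) else 0) ≤ ENNReal.ofReal S := by
    have e0 : ∑' j : ℕ, ENNReal.ofReal
        (Real.exp (2 * ((j : ℝ) ^ r * (a * Real.log j + 1)) + 2 - j)) = ENNReal.ofReal S :=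
      (ENNReal.ofReal_tsum_of_nonneg (fun j => (Real.exp_pos _).le) hsum).symm
    rw [← e0]
    refine le_trans (ENNReal.tsum_le_tsum fun k => ?_)
      (ENNReal.tsum_comp_le_tsum_of_injective (add_left_injective 1) _)
    split_ifs with hk
    · refine ENNReal.ofReal_le_ofReal ?_
      set j := k + 1 with hj
      have hkj : (k₀ : ℝ) ≤ j := by exact_mod_cast hk.trans (Nat.le_succ k)
      have hBm : Real.exp 2 * (m * B) ≤ j := by nlinarith
      have hj0 : (0 : ℝ) ≤ j := Nat.cast_nonneg j
      have hmj : m ≤ j := by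
        have : 1 ≤ Real.exp 2 := Real.one_le_exp (by norm_num)
        have h3 : 1 * (m * 1) ≤ Real.exp 2 * (m * B) := by gcongr
        linarith
      have e1 := mul_add_one_rpow_le hr hr1 hR0 hj0
      rw [hRr] at e1
      -- In the tail `m ≤ j`, so `log m` may be replaced by `log j` and the majorant no longer
      -- depends on `m`.
      have e2 : (j : ℝ) ^ r * (a * Real.log m + 1) ≤ (j : ℝ) ^ r * (a * Real.log j + 1) := by
        gcongr
      have e3 : m ^ j * B ^ k / j.factorial ≤ Real.exp (-j) := by
        refine le_trans ?_ (pow_div_factorial_le_exp_neg (by positivity) hBm)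
        rw [mul_pow]
        gcongr
        exact Nat.le_succ k
      calc Real.exp (2 * ((j : ℝ) * (R + 1) + 1) ^ r) * (m ^ j * B ^ k / j.factorial)
          ≤ Real.exp (2 * ((j : ℝ) ^ r * (a * Real.log j + 1)) + 2) * Real.exp (-j) := by
            gcongr
            linarith
        _ = _ := by rw [← Real.exp_add, sub_eq_add_neg]
    · exact zero_le
  rw [truncCoeff, add_mul, ENNReal.ofReal_add (by positivity) (by positivity)]
  refine add_le_add (ENNReal.ofReal_le_ofReal h1) (h2.trans (ENNReal.ofReal_le_ofReal ?_))
  refine le_mul_of_one_le_right hS0 (Real.one_le_exp (by positivity))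

variable {E : Type*} [NormedAddCommGroup E] [InnerProductSpace ℝ E] [FiniteDimensional ℝ E]
  [MeasurableSpace E] [BorelSpace E]

theorem eLpNorm_pow_succ_le {v : E → ℂ} {B : ℝ} (hB : ∀ x, ‖v x‖ ≤ B) (p : ℝ≥0∞) (k : ℕ) :
    eLpNorm (fun x => v x ^ (k + 1)) p volume ≤ ENNReal.ofReal (B ^ k) * eLpNorm v p volume := by
  have h0 : 0 ≤ B := (norm_nonneg _).trans (hB 0)
  refine eLpNorm_le_mul_eLpNorm_of_ae_le_mul (Filter.Eventually.of_forall fun x => ?_) p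
  rw [norm_pow, pow_succ]
  gcongr
  exact hB x

theorem norm_exp_I_mul_ofReal_sub_one_le (y : ℝ) :
    ‖Complex.exp (Complex.I * y) - 1‖ ≤ |y| := by
  have := Real.norm_exp_I_mul_ofReal_sub_one_le (x := y)
  simpa using this

variable {ψ b : 𝓢(E, ℂ)}

/-- Exponentials of band-limited functions. -/
theorem wnorm_exp_sub_one_le_truncCoeff {r : ℝ} (hr : 0 < r) {v : E → ℝ}
    (hv : BddCont fun x => (v x : ℂ)) {R m B : ℝ} (hR : 0 ≤ R) (hm : 0 ≤ m)
    (hB : ∀ x, ‖(v x : ℂ)‖ ≤ B)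
    (hspec : ∀ k : ℕ, HasSpec ψ (fun x => (v x : ℂ) ^ k) 0 (k * (R + 1))) (k₀ : ℕ)
    {p q : ℝ≥0∞} (hp : 1 ≤ p) (hvp : eLpNorm (fun x => (v x : ℂ)) p volume ≠ ⊤)
    (hT : truncCoeff r R m B k₀ ≠ ⊤) {t : ℝ} (ht : |t| ≤ m) :
    wnorm ψ (expWeight r 1) p q (fun x => Complex.exp (Complex.I * ((t * v x : ℝ) : ℂ)) - 1) ≤
      truncCoeff r R m B k₀ * ((eLpNorm (fun x => (v x : ℂ)) p volume * ∫⁻ y, ‖ψ y‖ₑ) *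
        eLpNorm (expWeight r (-1) : E → ℝ≥0∞) q volume) := by
  have hψw := isWindow_schwartz ψ
  set N := (eLpNorm (fun x => (v x : ℂ)) p volume * ∫⁻ y, ‖ψ y‖ₑ) with hN
  have hNt : N ≠ ⊤ := ENNReal.mul_ne_top hvp hψw.int.2.ne
  have hB0 : 0 ≤ B := (norm_nonneg _).trans (hB 0)
  have hg : BddCont fun x => Complex.I * ((t * v x : ℝ) : ℂ) := by
    have := (BddCont.const (Complex.I * t)).mul hv
    simpa only [Complex.ofReal_mul, mul_assoc] using this
  -- The weight is written as `e^{2|ξ|^r} e^{-|ξ|^r}`: the first factor is bounded on a ball, and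
  -- the second supplies the decay in `ξ` needed for the `L^q` norm.
  have hweight : ∀ (ξ : E) (ρ : ℝ), ‖ξ‖ < ρ →
      expWeight r 1 ξ ≤ ENNReal.ofReal (Real.exp (2 * ρ ^ r)) * expWeight r (-1) ξ := by
    intro ξ ρ h
    unfold expWeight
    rw [← ENNReal.ofReal_mul (Real.exp_pos _).le, ← Real.exp_add]
    gcongr
    have : ‖ξ‖ ^ r ≤ ρ ^ r := Real.rpow_le_rpow (norm_nonneg _) h.le hr.le
    linarith
  have hmain : ∀ ξ : E, expWeight r 1 ξ * eLpNorm
      (cv (fun x => Complex.exp (Complex.I * ((t * v x : ℝ) : ℂ)) - 1) (modul ξ ψ)) p volume ≤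
      (truncCoeff r R m B k₀ * N) * expWeight r (-1) ξ := by
    intro ξ
    -- Below the threshold `|e^{itv} - 1| ≤ m|v|` suffices. Above it the series is expanded: the
    -- term with exponent `k + 1` vanishes unless `|ξ| < (k + 1)(R + 1) + 1`, which forces `k₀ ≤ k`.
    by_cases hξ : ‖ξ‖ < (k₀ : ℝ) * (R + 1) + 1
    · have h1 : eLpNorm (fun x => Complex.exp (Complex.I * ((t * v x : ℝ) : ℂ)) - 1) p volume ≤
          ENNReal.ofReal m * eLpNorm (fun x => (v x : ℂ)) p volume := by
        refine eLpNorm_le_mul_eLpNorm_of_ae_le_mul (Filter.Eventually.of_forall fun x => ?_) p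
        refine (norm_exp_I_mul_ofReal_sub_one_le _).trans ?_
        rw [abs_mul, Complex.norm_real, Real.norm_eq_abs]
        gcongr
      have h2 := eLpNorm_cv_le hp hg.exp_sub_one.cont.measurable
        (hψw.modul ξ).cont.measurable
      simp only [enorm_modul] at h2
      have h3 : ENNReal.ofReal m * ENNReal.ofReal (Real.exp (2 * ((k₀ : ℝ) * (R + 1) + 1) ^ r)) ≤
          truncCoeff r R m B k₀ := by
        rw [← ENNReal.ofReal_mul hm]
        exact le_self_add
      calc _ ≤ (ENNReal.ofReal (Real.exp (2 * ((k₀ : ℝ) * (R + 1) + 1) ^ r)) *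
            expWeight r (-1) ξ) * ((ENNReal.ofReal m * eLpNorm (fun x => (v x : ℂ)) p volume) *
              ∫⁻ y, ‖ψ y‖ₑ) := mul_le_mul' (hweight ξ _ hξ) (h2.trans (mul_le_mul' h1 le_rfl))
        _ = ((ENNReal.ofReal m * ENNReal.ofReal (Real.exp (2 * ((k₀ : ℝ) * (R + 1) + 1) ^ r))) * N) *
            expWeight r (-1) ξ := by rw [hN]; ring
        _ ≤ _ := mul_le_mul' (mul_le_mul' h3 le_rfl) le_rfl
    · rw [not_lt] at hξ
      obtain ⟨a, ha, hga, he⟩ := hg.exp_sub_one_eq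
      rw [he]
      have h1 := eLpNorm_cv_tsum_le
        (f := fun k x => (((k + 1).factorial : ℂ))⁻¹ * (Complex.I * ((t * v x : ℝ) : ℂ)) ^ (k + 1))
        (fun k => continuous_const.mul (hg.pow _).cont) hga ha (hψw.modul ξ) hp
      refine (mul_le_mul' le_rfl h1).trans ?_
      rw [← ENNReal.tsum_mul_left]
      have h2 : (∑' k : ℕ, if k₀ ≤ k then ENNReal.ofReal
          (Real.exp (2 * (((k + 1 : ℕ) : ℝ) * (R + 1) + 1) ^ r) *
            (m ^ (k + 1) * B ^ k / (k + 1).factorial)) else 0) ≤ truncCoeff r R m B k₀ :=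
        le_add_self
      refine le_trans ?_ (mul_le_mul' (mul_le_mul' h2 le_rfl) le_rfl)
      rw [← ENNReal.tsum_mul_right, ← ENNReal.tsum_mul_right]
      refine ENNReal.tsum_le_tsum fun k => ?_
      have e1 : (fun x => (((k + 1).factorial : ℂ))⁻¹ * (Complex.I * ((t * v x : ℝ) : ℂ)) ^ (k + 1)) =
          fun x => ((((k + 1).factorial : ℂ))⁻¹ * (Complex.I * t) ^ (k + 1)) * (v x : ℂ) ^ (k + 1) := by
        funext x
        push_cast
        ring
      rw [e1]
      by_cases hξk : ‖ξ‖ < ((k + 1 : ℕ) : ℝ) * (R + 1) + 1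
      · have hk : k₀ ≤ k := by
          by_contra hlt
          have h3 : ((k + 1 : ℕ) : ℝ) ≤ k₀ := by exact_mod_cast (not_le.1 hlt)
          have : ((k + 1 : ℕ) : ℝ) * (R + 1) ≤ k₀ * (R + 1) := by gcongr
          linarith
        rw [if_pos hk, eLpNorm_cv_const_mul]
        have h3 := eLpNorm_cv_le hp (hv.pow (k + 1)).cont.measurable
          (hψw.modul ξ).cont.measurable
        simp only [enorm_modul] at h3
        have h4 : ‖(((k + 1).factorial : ℂ))⁻¹ * (Complex.I * t) ^ (k + 1)‖ₑ ≤
            ENNReal.ofReal (m ^ (k + 1) / (k + 1).factorial) := by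
          rw [← ofReal_norm]
          refine ENNReal.ofReal_le_ofReal ?_
          rw [norm_mul, norm_inv, Complex.norm_natCast, norm_pow, norm_mul, Complex.norm_I, one_mul,
            Complex.norm_real, Real.norm_eq_abs, div_eq_inv_mul]
          gcongr
        calc _ ≤ (ENNReal.ofReal (Real.exp (2 * (((k + 1 : ℕ) : ℝ) * (R + 1) + 1) ^ r)) *
              expWeight r (-1) ξ) * (ENNReal.ofReal (m ^ (k + 1) / (k + 1).factorial) *
                ((ENNReal.ofReal (B ^ k) * eLpNorm (fun x => (v x : ℂ)) p volume) *
                  ∫⁻ y, ‖ψ y‖ₑ)) :=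
              mul_le_mul' (hweight ξ _ hξk) (mul_le_mul' h4
                (h3.trans (mul_le_mul' (eLpNorm_pow_succ_le hB p k) le_rfl)))
          _ = ((ENNReal.ofReal (Real.exp (2 * (((k + 1 : ℕ) : ℝ) * (R + 1) + 1) ^ r)) *
                (ENNReal.ofReal (m ^ (k + 1) / (k + 1).factorial) * ENNReal.ofReal (B ^ k))) * N) *
              expWeight r (-1) ξ := by rw [hN]; ring
          _ = _ := by
              rw [← ENNReal.ofReal_mul (by positivity), ← ENNReal.ofReal_mul (by positivity),
                div_mul_eq_mul_div]
      · have : cv (fun x => (v x : ℂ) ^ (k + 1)) (modul ξ ψ) = 0 := by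
          funext x
          refine hspec (k + 1) ξ x ?_
          rw [sub_zero]
          exact not_lt.1 hξk
        rw [eLpNorm_cv_const_mul, this]
        simp
  refine (eLpNorm_ennreal_mono hmain).trans ((eLpNorm_const_mul_le
    (ENNReal.mul_ne_top hT hNt) _).trans_eq ?_)
  ring

end Truncation

/-! ### Weights at neighbouring frequencies. -/

section WeightShift

variable {E : Type*} [NormedAddCommGroup E]

theorem expWeight_le_of_norm_sub_lt {r : ℝ} (hr : 0 < r) (hr1 : r < 1) {η ξ : E}
    (h : ‖η - ξ‖ < 2) :
    expWeight r 1 η ≤ ENNReal.ofReal (Real.exp (2 ^ r)) * expWeight r 1 ξ := by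
  unfold expWeight
  rw [← ENNReal.ofReal_mul (Real.exp_pos _).le, ← Real.exp_add]
  gcongr
  have e1 := norm_rpow_le_add hr hr1 (η - ξ) ξ
  rw [sub_add_cancel] at e1
  have e2 : ‖η - ξ‖ ^ r ≤ 2 ^ r := Real.rpow_le_rpow (norm_nonneg _) h.le hr.le
  linarith

/-- Lowering the exponent from `δ'` to `δ` above frequency `R` gains `e^{-(δ' - δ)R^r}`. This is
what makes the high-frequency part small in the weaker norm. -/
theorem expWeight_le_of_norm_sub_lt_of_le {r δ δ' R : ℝ} (hr : 0 < r) (hr1 : r < 1) (hδ : 0 ≤ δ)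
    (hδ1 : δ ≤ 1) (hδ' : δ ≤ δ') (hR : 0 ≤ R) {η ξ : E} (h : ‖η - ξ‖ < 2) (hξ : R ≤ ‖ξ‖) :
    expWeight r δ η ≤ ENNReal.ofReal (Real.exp (2 ^ r) * Real.exp (-((δ' - δ) * R ^ r))) *
      expWeight r δ' ξ := by
  unfold expWeight
  rw [← ENNReal.ofReal_mul (by positivity), ← Real.exp_add, ← Real.exp_add]
  gcongr
  have e1 := norm_rpow_le_add hr hr1 (η - ξ) ξ
  rw [sub_add_cancel] at e1
  have e2 : ‖η - ξ‖ ^ r ≤ 2 ^ r := Real.rpow_le_rpow (norm_nonneg _) h.le hr.le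
  have e3 : R ^ r ≤ ‖ξ‖ ^ r := Real.rpow_le_rpow hR hξ hr.le
  have e4 : (δ' - δ) * R ^ r ≤ (δ' - δ) * ‖ξ‖ ^ r := by
    have : 0 ≤ δ' - δ := by linarith
    gcongr
  have e5 : δ * ‖η‖ ^ r ≤ δ * (2 ^ r + ‖ξ‖ ^ r) := by gcongr; linarith
  have e6 : δ * 2 ^ r ≤ 1 * 2 ^ r := by gcongr
  linarith

end WeightShift

/-! ### Growth of the norm of `e^{itu} - 1`. -/

section Nonlinear

variable {E : Type*} [NormedAddCommGroup E] [InnerProductSpace ℝ E] [FiniteDimensional ℝ E]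
  [MeasurableSpace E] [BorelSpace E]

variable {ψ b : 𝓢(E, ℂ)}

theorem eLpNorm_expWeight_neg_lt_top {r δ : ℝ} (hr : 0 < r) (hδ : 0 < δ) {q : ℝ≥0∞} (hq : 1 ≤ q) :
    eLpNorm (expWeight r (-δ) : E → ℝ≥0∞) q volume < ⊤ := by
  have := eLpNorm_exp_neg_rpow_lt_top (E := E) hr hδ hq
  have e : (expWeight r (-δ) : E → ℝ≥0∞) = fun x => ENNReal.ofReal (Real.exp (-(δ * ‖x‖ ^ r))) := by
    funext x
    rw [expWeight, neg_mul]
  rwa [e]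

theorem lintegral_mul_expWeight_lt_top {r δ : ℝ} (hr : 0 < r) (hδ : δ < 1) {q : ℝ≥0∞}
    (hq : 1 ≤ q) {P : E → ℝ≥0∞} (hP : Measurable P)
    (h : eLpNorm (fun ξ => expWeight r 1 ξ * P ξ) q volume < ⊤) :
    ∫⁻ ξ, expWeight r δ ξ * P ξ < ⊤ := by
  have h1 : ∀ ξ, expWeight r δ ξ * P ξ =
      (expWeight r 1 ξ * P ξ) * expWeight r (-(1 - δ)) ξ := by
    intro ξ
    have : expWeight r δ ξ = expWeight r 1 ξ * expWeight r (-(1 - δ)) ξ := by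
      rw [expWeight, expWeight, expWeight, ← ENNReal.ofReal_mul (Real.exp_pos _).le,
        ← Real.exp_add]
      congr 2
      ring
    rw [this]
    ring
  simp_rw [h1]
  refine lt_of_le_of_lt (lintegral_mul_le_eLpNorm_mul hq
    (F := fun ξ => expWeight r 1 ξ * P ξ) ((measurable_expWeight r 1).mul hP).aemeasurable
    (measurable_expWeight r _).aemeasurable) ?_
  exact ENNReal.mul_lt_top h (eLpNorm_expWeight_neg_lt_top hr (by linarith)
    (ENNReal.HolderConjugate.conjExponent hq).symm.one_le)

theorem wnorm_mono {θ : E → ℂ} {W W' : E → ℝ≥0∞} (h : ∀ ξ, W ξ ≤ W' ξ) (p q : ℝ≥0∞) (g : E → ℂ) :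
    wnorm θ W p q g ≤ wnorm θ W' p q g :=
  eLpNorm_ennreal_mono fun ξ => mul_le_mul' (h ξ) le_rfl

/-- The exponential of a real function in the weighted modulation space has a norm growing
at most like `e^{l m^r log m}`. -/
theorem IsBandWindow.exists_wnorm_exp_I_sub_one_le (hψ : IsBandWindow ψ b) {r δ δ' : ℝ}
    (hr : 0 < r) (hr1 : r < 1) (hδ : δ = 2 ^ r - 1) (hδ' : δ < δ') (hδ'1 : δ' < 1)
    {p q : ℝ≥0∞} (hp : 1 ≤ p) (hq : 1 ≤ q) {u : E → ℝ} (hu : BddCont fun x => (u x : ℂ))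
    (hM : wnorm ψ (expWeight r δ') ⊤ 1 (fun x => (u x : ℂ)) < ⊤)
    (hN : wnorm ψ (expWeight r 1) p q (fun x => (u x : ℂ)) < ⊤) :
    ∃ (Z : ℝ≥0∞) (l : ℝ), Z ≠ ⊤ ∧ 0 ≤ l ∧ ∀ t m : ℝ, 2 ≤ m → |t| ≤ m →
      wnorm ψ (expWeight r 1) p q (fun x => Complex.exp (Complex.I * ((t * u x : ℝ) : ℂ)) - 1) ≤
        Z * ENNReal.ofReal (Real.exp (l * (m ^ r * Real.log m))) := by
  have hψw := isWindow_schwartz ψ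
  have hδ0 : 0 ≤ δ := by
    have : (1 : ℝ) ≤ 2 ^ r := Real.one_le_rpow (by norm_num) hr.le
    linarith
  set g : E → ℂ := fun x => (u x : ℂ) with hg
  have hQ : ∫⁻ ξ, eLpNorm (cv g (modul ξ ψ)) ⊤ < ⊤ :=
    lintegral_lt_top_of_wnorm (one_le_expWeight (hδ0.trans hδ'.le)) hM
  have hP : ∫⁻ ξ, eLpNorm (cv g (modul ξ ψ)) p < ⊤ := by
    have := lintegral_mul_expWeight_lt_top hr zero_lt_one hq (measurable_eLpNorm_cv hu hψw p) hN
    simpa [expWeight] using this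
  -- constants
  set cI := ‖(invConst ψ)⁻¹‖ₑ with hcI
  set AP := cI * ∫⁻ ξ, eLpNorm (cv g (modul ξ ψ)) p with hAP
  set AQ := cI * ∫⁻ ξ, eLpNorm (cv g (modul ξ ψ)) ⊤ with hAQ
  have hAPt : AP ≠ ⊤ := ENNReal.mul_ne_top enorm_ne_top hP.ne
  have hAQt : AQ ≠ ⊤ := ENNReal.mul_ne_top enorm_ne_top hQ.ne
  set B := max 1 AQ.toReal with hB
  have hB1 : 1 ≤ B := le_max_left _ _
  -- With this value `(δ' - δ) R^r = log m`, so the gain at high frequencies is exactly `1 / m`.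
  set a := 1 / (δ' - δ) with ha
  have ha0 : 0 < a := by
    have : 0 < δ' - δ := by linarith
    positivity
  obtain ⟨C, l, hC0, hl0, hT⟩ := exists_truncCoeff_le hr hr1 ha0.le hB1
  set K := ENNReal.ofReal (Real.exp (3 ^ r)) with hK
  have hpair1 : IsWeightPair (expWeight r 1 : E → ℝ≥0∞) (expWeight r δ) K :=
    isWeightPair_one hr hr1 hδ.ge
  have hpair2 : IsWeightPair (expWeight r δ : E → ℝ≥0∞) (expWeight r δ) K :=
    isWeightPair_self hr hr1 hδ0 (by linarith)
  set kc := algConst ψ K with hkc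
  have hkct : kc ≠ ⊤ := hψ.algConst_ne_top hpair1.ne_top
  set sψ := ∫⁻ y, ‖ψ y‖ₑ with hsψ
  have hsψt : sψ ≠ ⊤ := hψw.int.2.ne
  set a1 := (AP * sψ) * eLpNorm (expWeight r (-1) : E → ℝ≥0∞) q volume with ha1
  set a2 := (AQ * sψ) * eLpNorm (expWeight r (-1) : E → ℝ≥0∞) 1 volume with ha2
  have ha1t : a1 ≠ ⊤ := ENNReal.mul_ne_top (ENNReal.mul_ne_top hAPt hsψt)
    (eLpNorm_expWeight_neg_lt_top hr one_pos hq).ne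
  have ha2t : a2 ≠ ⊤ := ENNReal.mul_ne_top (ENNReal.mul_ne_top hAQt hsψt)
    (eLpNorm_expWeight_neg_lt_top hr one_pos le_rfl).ne
  set c1 := partConst ψ * ENNReal.ofReal (Real.exp (2 ^ r)) with hc1
  have hc1t : c1 ≠ ⊤ := ENNReal.mul_ne_top (partConst_ne_top ψ) ENNReal.ofReal_ne_top
  set C1 := c1 * wnorm ψ (expWeight r δ') ⊤ 1 g with hC1
  have hC1t : C1 ≠ ⊤ := ENNReal.mul_ne_top hc1t hM.ne
  set eS := expSum (kc * C1) with heS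
  have heSt : eS ≠ ⊤ := expSum_ne_top (ENNReal.mul_ne_top hkct hC1t)
  set a3 := C1 * eS with ha3
  have ha3t : a3 ≠ ⊤ := ENNReal.mul_ne_top hC1t heSt
  set a4 := (c1 * wnorm ψ (expWeight r 1) p q g) * eS with ha4
  have ha4t : a4 ≠ ⊤ := ENNReal.mul_ne_top (ENNReal.mul_ne_top hc1t hN.ne) heSt
  set cC := ENNReal.ofReal C with hcC
  have hcCt : cC ≠ ⊤ := ENNReal.ofReal_ne_top
  refine ⟨kc * (cC * a1 * a3 + cC * a2 * a4) + cC * a1 + a4, l + 1, ?_, by positivity, ?_⟩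
  · have h1 := ENNReal.mul_ne_top hcCt ha1t
    have h2 := ENNReal.mul_ne_top h1 ha3t
    have h3 := ENNReal.mul_ne_top (ENNReal.mul_ne_top hcCt ha2t) ha4t
    exact ENNReal.add_ne_top.2 ⟨ENNReal.add_ne_top.2 ⟨ENNReal.mul_ne_top hkct
      (ENNReal.add_ne_top.2 ⟨h2, h3⟩), h1⟩, ha4t⟩
  intro t m hm htm
  have hm0 : 0 < m := by linarith
  obtain ⟨k₀, hk₀⟩ := hT m hm
  set R := (a * Real.log m) ^ (1 / r) with hR
  have hlogm : 0 < Real.log m := Real.log_pos (by linarith)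
  have hR0 : 0 ≤ R := by positivity
  have hRr : (δ' - δ) * R ^ r = Real.log m := by
    rw [hR, ← Real.rpow_mul (by positivity), one_div_mul_cancel hr.ne', Real.rpow_one, ha]
    have : δ' - δ ≠ 0 := by linarith
    field_simp
  set S := Metric.closedBall (0 : E) R with hS
  have hSm : MeasurableSet S := measurableSet_closedBall
  have hSneg : ∀ ξ, -ξ ∈ S ↔ ξ ∈ S := by simp [hS]
  have hgr : ∀ x, (starRingEnd ℂ) (g x) = g x := fun x => Complex.conj_ofReal _
  set v : E → ℝ := fun x => (spart ψ g S x).re with hv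
  set y : E → ℝ := fun x => (spart ψ g Sᶜ x).re with hy
  have hvs : (fun x => (v x : ℂ)) = spart ψ g S := by
    funext x
    exact Complex.conj_eq_iff_re.1 (hψ.conj_spart hgr hSm hSneg x)
  have hys : (fun x => (y x : ℂ)) = spart ψ g Sᶜ := by
    funext x
    exact Complex.conj_eq_iff_re.1 (hψ.conj_spart hgr hSm.compl (by simp [hS]) x)
  have hvb : BddCont fun x => (v x : ℂ) := hvs ▸ bddCont_spart hu hQ S
  have hyb : BddCont fun x => (y x : ℂ) := hys ▸ bddCont_spart hu hQ Sᶜ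
  have huvy : ∀ x, u x = v x + y x := by
    intro x
    have := hψ.spart_add_compl hu hQ hSm x
    rw [← congrFun hvs x, ← congrFun hys x] at this
    refine Complex.ofReal_injective ?_
    rw [Complex.ofReal_add, this]
  -- low frequencies
  have hvP : eLpNorm (fun x => (v x : ℂ)) p volume ≤ AP := by
    rw [hvs]; exact eLpNorm_spart_le hu hp S
  have hvQ : eLpNorm (fun x => (v x : ℂ)) ⊤ volume ≤ AQ := by
    rw [hvs]; exact eLpNorm_spart_le hu le_top S
  have hvB : ∀ x, ‖(v x : ℂ)‖ ≤ B := by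
    intro x
    refine le_trans ?_ (le_max_right _ _)
    rw [← toReal_enorm]
    exact ENNReal.toReal_mono hAQt ((enorm_le_eLpNorm_top hvb.cont x).trans hvQ)
  have hspec : ∀ k : ℕ, HasSpec ψ (fun x => (v x : ℂ) ^ k) 0 (k * (R + 1)) := by
    intro k
    have := hψ.hasSpec_spart_pow hu hQ (S := S) (R := R) (by simp [hS]) k
    rwa [← hvs] at this
  have hTt : truncCoeff r R m B k₀ ≠ ⊤ := ne_top_of_le_ne_top ENNReal.ofReal_ne_top hk₀
  set T := truncCoeff r R m B k₀ with hTdef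
  set X : E → ℂ := fun x => Complex.exp (Complex.I * ((t * v x : ℝ) : ℂ)) - 1 with hX
  set Y : E → ℂ := fun x => Complex.exp (Complex.I * t * (y x : ℂ)) - 1 with hY
  have hNX : wnorm ψ (expWeight r 1) p q X ≤ T * a1 :=
    (wnorm_exp_sub_one_le_truncCoeff hr hvb hR0 hm0.le hvB hspec k₀ hp
      (ne_top_of_le_ne_top hAPt hvP) hTt htm).trans
      (mul_le_mul' le_rfl (mul_le_mul' (mul_le_mul' hvP le_rfl) le_rfl))
  have hMX : wnorm ψ (expWeight r δ) ⊤ 1 X ≤ T * a2 :=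
    (wnorm_mono (expWeight_mono (by linarith)) _ _ _).trans
      ((wnorm_exp_sub_one_le_truncCoeff hr hvb hR0 hm0.le hvB hspec k₀ le_top
      (ne_top_of_le_ne_top hAQt hvQ) hTt htm).trans
      (mul_le_mul' le_rfl (mul_le_mul' (mul_le_mul' hvQ le_rfl) le_rfl)))
  -- high frequencies
  have hte : ‖Complex.I * (t : ℂ)‖ₑ ≤ ENNReal.ofReal m := by
    rw [← ofReal_norm]
    refine ENNReal.ofReal_le_ofReal ?_
    simpa using htm
  -- The gain `1 / m` cancels `|t| ≤ m`, so this norm, which enters the exponential series, is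
  -- bounded independently of `t`.
  have hMy : wnorm ψ (expWeight r δ) ⊤ 1 (fun x => Complex.I * t * (y x : ℂ)) ≤ C1 := by
    refine (wnorm_const_mul_le _ _ _ _ _).trans ?_
    rw [hys]
    have h1 := hψ.wnorm_spart_le hu hQ (p := ⊤) (q := 1) le_top le_rfl hSm.compl
      (W := expWeight r δ) (W' := expWeight r δ') (measurable_expWeight r δ')
      (K := ENNReal.ofReal (Real.exp (2 ^ r) * Real.exp (-((δ' - δ) * R ^ r))))
      ENNReal.ofReal_ne_top (fun η ξ hξ h => expWeight_le_of_norm_sub_lt_of_le hr hr1 hδ0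
        (by linarith) hδ'.le hR0 h (by
          have : R < ‖ξ‖ := by simpa [hS] using hξ
          exact this.le))
    refine (mul_le_mul' hte h1).trans (le_of_eq ?_)
    have h2 : ENNReal.ofReal m * ENNReal.ofReal (Real.exp (-((δ' - δ) * R ^ r))) = 1 := by
      rw [hRr, Real.exp_neg, Real.exp_log hm0, ← ENNReal.ofReal_mul hm0.le, mul_inv_cancel₀ hm0.ne',
        ENNReal.ofReal_one]
    rw [ENNReal.ofReal_mul (Real.exp_pos _).le, hC1, hc1]
    calc _ = (partConst ψ * ENNReal.ofReal (Real.exp (2 ^ r)) *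
          wnorm ψ (expWeight r δ') ⊤ 1 g) *
          (ENNReal.ofReal m * ENNReal.ofReal (Real.exp (-((δ' - δ) * R ^ r)))) := by ring
      _ = _ := by rw [h2, mul_one]
  have hNy : wnorm ψ (expWeight r 1) p q (fun x => Complex.I * t * (y x : ℂ)) ≤
      ENNReal.ofReal m * (c1 * wnorm ψ (expWeight r 1) p q g) := by
    refine (wnorm_const_mul_le _ _ _ _ _).trans ?_
    rw [hys]
    exact mul_le_mul' hte (hψ.wnorm_spart_le hu hQ hp hq hSm.compl (measurable_expWeight r 1)
      ENNReal.ofReal_ne_top (fun η ξ _ h => expWeight_le_of_norm_sub_lt hr hr1 h))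
  have hyt : BddCont fun x => Complex.I * t * (y x : ℂ) := (BddCont.const _).mul hyb
  have hMyt := lt_of_le_of_lt hMy hC1t.lt_top
  have heS' : expSum (kc * wnorm ψ (expWeight r δ) ⊤ 1 (fun x => Complex.I * t * (y x : ℂ))) ≤ eS :=
    expSum_mono (mul_le_mul' le_rfl hMy)
  have hMY : wnorm ψ (expWeight r δ) ⊤ 1 Y ≤ a3 :=
    (hψ.wnorm_exp_sub_one_le hpair2 hpair2 hyt hMyt le_top le_rfl).trans (mul_le_mul' hMy heS')
  have hNY : wnorm ψ (expWeight r 1) p q Y ≤ ENNReal.ofReal m * a4 := by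
    refine ((hψ.wnorm_exp_sub_one_le hpair1 hpair2 hyt hMyt hp hq).trans
      (mul_le_mul' hNy heS')).trans (le_of_eq ?_)
    rw [ha4]; ring
  have hXb : BddCont X := by
    have := ((BddCont.const (Complex.I * t)).mul hvb).exp_sub_one
    simpa only [hX, Complex.ofReal_mul, mul_assoc] using this
  have hYb : BddCont Y := hyt.exp_sub_one
  -- From `e^{itu} = (1 + X)(1 + Y)` one gets `e^{itu} - 1 = XY + X + Y`.
  have hdec : (fun x => Complex.exp (Complex.I * ((t * u x : ℝ) : ℂ)) - 1) =
      fun x => (X x * Y x + X x) + Y x := by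
    funext x
    have : Complex.exp (Complex.I * ((t * u x : ℝ) : ℂ)) =
        Complex.exp (Complex.I * ((t * v x : ℝ) : ℂ)) * Complex.exp (Complex.I * t * (y x : ℂ)) := by
      rw [← Complex.exp_add, huvy]
      congr 1
      push_cast
      ring
    rw [this]
    simp only [hX, hY]
    ring
  have hmeas := measurable_expWeight (E := E) r 1
  have hXY := hψ.wnorm_mul_le_algConst hpair1 hXb hYb
    (lt_of_le_of_lt hMX (ENNReal.mul_ne_top hTt ha2t).lt_top)
    (lt_of_le_of_lt hMY ha3t.lt_top) hp hq
  set em := ENNReal.ofReal (Real.exp ((l + 1) * (m ^ r * Real.log m))) with hem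
  have hmr : 1 ≤ m ^ r := Real.one_le_rpow (by linarith) hr.le
  have hL0 : 0 ≤ m ^ r * Real.log m := by positivity
  have hmL : m ≤ Real.exp (m ^ r * Real.log m) := by
    calc m = Real.exp (Real.log m) := (Real.exp_log hm0).symm
      _ ≤ _ := by gcongr; nlinarith
  -- Each term of the final sum contains at most one factor `T` and one factor `m`. Since `m ≤
  -- e^{m^r log m}`, the latter only raises `l` to `l + 1`.
  have hTm : T * ENNReal.ofReal m ≤ cC * em := by
    refine (mul_le_mul' hk₀ le_rfl).trans ?_
    rw [hcC, hem, ← ENNReal.ofReal_mul (by positivity), ← ENNReal.ofReal_mul hC0, mul_assoc]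
    refine ENNReal.ofReal_le_ofReal (mul_le_mul_of_nonneg_left ?_ hC0)
    rw [add_mul, Real.exp_add, one_mul]
    gcongr
  have hT1 : T ≤ cC * em := by
    refine le_trans ?_ hTm
    refine le_mul_of_one_le_right' ?_
    rw [ENNReal.one_le_ofReal]
    linarith
  have hm1 : ENNReal.ofReal m ≤ em := by
    refine ENNReal.ofReal_le_ofReal (hmL.trans (Real.exp_le_exp.2 ?_))
    exact le_mul_of_one_le_left hL0 (by linarith)
  rw [hdec]
  calc wnorm ψ (expWeight r 1) p q (fun x => (X x * Y x + X x) + Y x)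
      ≤ (wnorm ψ (expWeight r 1) p q (fun x => X x * Y x) + wnorm ψ (expWeight r 1) p q X) +
          wnorm ψ (expWeight r 1) p q Y :=
        (wnorm_add_le ((hXb.mul hYb).add hXb) hYb hψw hmeas hp hq).trans
          (add_le_add (wnorm_add_le (hXb.mul hYb) hXb hψw hmeas hp hq) le_rfl)
    _ ≤ (kc * ((T * a1) * a3 + (T * a2) * (ENNReal.ofReal m * a4)) + T * a1) +
          ENNReal.ofReal m * a4 :=
        add_le_add (add_le_add (hXY.trans (mul_le_mul' le_rfl (add_le_add (mul_le_mul' hNX hMY)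
          (mul_le_mul' hMX hNY)))) hNX) hNY
    _ = (kc * (T * (a1 * a3) + (T * ENNReal.ofReal m) * (a2 * a4)) + T * a1) +
          ENNReal.ofReal m * a4 := by ring
    _ ≤ (kc * ((cC * em) * (a1 * a3) + (cC * em) * (a2 * a4)) + (cC * em) * a1) + em * a4 :=
        add_le_add (add_le_add (mul_le_mul' le_rfl (add_le_add (mul_le_mul' hT1 le_rfl)
          (mul_le_mul' hTm le_rfl))) (mul_le_mul' hT1 le_rfl)) (mul_le_mul' hm1 le_rfl)
    _ = _ := by ring

end Nonlinear

theorem refl_refl {E : Type*} [NormedAddCommGroup E] (θ : E → ℂ) : refl (refl θ) = θ := by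
  funext t
  simp [refl]

/-! ### Window changes in the weighted norms. -/

section WindowChangeNorm

variable {E : Type*} [NormedAddCommGroup E] [InnerProductSpace ℝ E] [FiniteDimensional ℝ E]
  [MeasurableSpace E] [BorelSpace E]

/-- For `δ ≤ 1` subadditivity gives `e^{δ|ξ|^r} ≤ e^{|ξ - η|^r} e^{δ|η|^r}`, so transporting the
weight through the kernel lowers its rate from `κ` to `κ - 1`. Young's inequality then applies, and
the constant is finite as soon as `κ > 1`. -/
theorem eLpNorm_expWeight_mul_le_of_le_lintegral {r κ D δ : ℝ} (hr : 0 < r) (hr1 : r < 1)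
    (hδ : 0 ≤ δ) (hδ1 : δ ≤ 1) (hD : 0 ≤ D) {F P : E → ℝ≥0∞} (hP : Measurable P)
    {C : ℝ≥0∞} (hC : C ≠ ⊤)
    (h : ∀ ξ, F ξ ≤ C * ∫⁻ η, P η * ENNReal.ofReal (D * Real.exp (-(κ * ‖ξ - η‖ ^ r))))
    {q : ℝ≥0∞} (hq : 1 ≤ q) :
    eLpNorm (fun ξ => expWeight r δ ξ * F ξ) q (volume : Measure E) ≤
      C * (∫⁻ w : E, ENNReal.ofReal (D * Real.exp (-((κ - 1) * ‖w‖ ^ r)))) *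
        eLpNorm (fun ξ => expWeight r δ ξ * P ξ) q (volume : Measure E) := by
  set m' : E → ℝ≥0∞ := fun w => ENNReal.ofReal (D * Real.exp (-((κ - 1) * ‖w‖ ^ r))) with hm'
  have hm'm : Measurable m' := by fun_prop
  set G : E → ℝ≥0∞ := fun ξ => expWeight r δ ξ * P ξ with hG
  have hGm : Measurable G := (measurable_expWeight r δ).mul hP
  have hpt : ∀ ξ, expWeight r δ ξ * F ξ ≤ C * ∫⁻ η, G (ξ - η) * m' η := by
    intro ξ
    refine (mul_le_mul' le_rfl (h ξ)).trans ?_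
    rw [← lintegral_conv_comm G m' ξ, ← mul_assoc, mul_comm (expWeight r δ ξ), mul_assoc]
    refine mul_le_mul' le_rfl ((lintegral_const_mul_le _ _).trans (lintegral_mono fun η => ?_))
    have h1 : expWeight r δ ξ * ENNReal.ofReal (D * Real.exp (-(κ * ‖ξ - η‖ ^ r))) ≤
        expWeight r δ η * m' (ξ - η) := by
      rw [hm']
      beta_reduce
      rw [expWeight, expWeight, ← ENNReal.ofReal_mul (Real.exp_pos _).le,
        ← ENNReal.ofReal_mul (Real.exp_pos _).le, mul_left_comm, mul_left_comm (Real.exp _) D,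
        ← Real.exp_add, ← Real.exp_add]
      refine ENNReal.ofReal_le_ofReal (mul_le_mul_of_nonneg_left (Real.exp_le_exp.2 ?_) hD)
      have e1 := norm_rpow_le_add hr hr1 (ξ - η) η
      rw [sub_add_cancel] at e1
      have e2 : 0 ≤ ‖ξ - η‖ ^ r := by positivity
      have e3 : δ * ‖ξ‖ ^ r ≤ δ * (‖ξ - η‖ ^ r + ‖η‖ ^ r) := by gcongr
      have e4 : δ * ‖ξ - η‖ ^ r ≤ 1 * ‖ξ - η‖ ^ r := by gcongr
      linarith
    calc expWeight r δ ξ * (P η * ENNReal.ofReal (D * Real.exp (-(κ * ‖ξ - η‖ ^ r))))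
        = (expWeight r δ ξ * ENNReal.ofReal (D * Real.exp (-(κ * ‖ξ - η‖ ^ r)))) * P η := by ring
      _ ≤ (expWeight r δ η * m' (ξ - η)) * P η := mul_le_mul' h1 le_rfl
      _ = G η * m' (ξ - η) := by rw [hG]; ring
  refine (eLpNorm_ennreal_mono hpt).trans ((eLpNorm_const_mul_le hC _).trans ?_)
  refine (mul_le_mul' le_rfl (eLpNorm_lconv_le hq (a := G) (b := m') hGm hm'm)).trans (le_of_eq ?_)
  ring

/-- Change of windows in the weighted norms, given a kernel bound. -/
theorem exists_wnorm_window_change {r κ : ℝ} (hr : 0 < r) (hr1 : r < 1) (hκ : 1 < κ)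
    {θ ϑ : E → ℂ} (hθ : IsWindow θ) (hθb : BddCont θ) (h0 : θ ≠ 0) (hϑ : IsWindow ϑ)
    (h1 : ∀ N : ℕ, ∃ C : ℝ, 0 < C ∧ ∀ ξ η y,
      (1 + ‖y‖) ^ N * ‖cv (modul η (refl θ)) (modul ξ ϑ) y‖ ≤ C)
    (h2 : ∃ C : ℝ, ∀ ξ η y, ‖cv (modul η (refl θ)) (modul ξ ϑ) y‖ ≤
      C * Real.exp (-(κ * ‖ξ - η‖ ^ r)))
    {p q : ℝ≥0∞} (hp : 1 ≤ p) (hq : 1 ≤ q) :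
    ∃ C : ℝ≥0∞, C ≠ ⊤ ∧ ∀ g : E → ℂ, BddCont g →
      wnorm ϑ (expWeight r 1) p q g ≤ C * wnorm θ (expWeight r 1) p q g ∧
      ∀ δ, 0 ≤ δ → δ ≤ 1 → wnorm ϑ (expWeight r δ) ⊤ 1 g ≤ C * wnorm θ (expWeight r δ) p 1 g := by
  obtain ⟨C₂, h2⟩ := h2
  -- The midpoint leaves room on both sides: `κ' < κ` for the interpolation of the kernel bounds,
  -- `κ' > 1` for integrability after transporting the weight.
  set κ' := (1 + κ) / 2 with hκ'
  obtain ⟨D, hD, hK⟩ := exists_kernel_bound (V := fun ξ η y => cv (modul η (refl θ)) (modul ξ ϑ) y)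
    (Module.finrank ℝ E) (κ' := κ') (by rw [hκ']; linarith) (by rw [hκ']; linarith) h1 h2
  have hi := (integrable_one_add_norm (E := E) (μ := volume)
    (r := (Module.finrank ℝ E + 1 : ℕ)) (by push_cast; linarith)).lintegral_lt_top
  obtain ⟨C, hC, hCp, hCt⟩ := eLpNorm_window_change hθ hθb h0 hϑ
    (k := fun y => ENNReal.ofReal ((1 + ‖y‖) ^ (-((Module.finrank ℝ E + 1 : ℕ) : ℝ))))
    (m := fun w => ENNReal.ofReal (D * Real.exp (-(κ' * ‖w‖ ^ r))))
    (by fun_prop) (fun _ => ENNReal.ofReal_ne_top) (by fun_prop) (fun x => by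
      rw [ENNReal.ofReal_le_one]
      exact Real.rpow_le_one_of_one_le_of_nonpos (by linarith [norm_nonneg x]) (by
        rw [neg_nonpos]; positivity)) hi hK hp
  have hm1 : ∫⁻ w : E, ENNReal.ofReal (D * Real.exp (-((κ' - 1) * ‖w‖ ^ r))) < ⊤ := by
    have e : ∀ w : E, ENNReal.ofReal (D * Real.exp (-((κ' - 1) * ‖w‖ ^ r))) =
        ENNReal.ofReal D * ENNReal.ofReal (Real.exp (-((κ' - 1) * ‖w‖ ^ r))) :=
      fun w => ENNReal.ofReal_mul hD.le
    simp_rw [e]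
    rw [lintegral_const_mul' _ _ ENNReal.ofReal_ne_top]
    exact ENNReal.mul_lt_top ENNReal.ofReal_lt_top
      (lintegral_exp_neg_rpow_lt_top hr (by rw [hκ']; linarith))
  refine ⟨_, ENNReal.mul_ne_top hC hm1.ne, fun g hg => ⟨?_, fun δ hδ hδ1 => ?_⟩⟩
  · exact eLpNorm_expWeight_mul_le_of_le_lintegral hr hr1 zero_le_one le_rfl hD.le
      (measurable_eLpNorm_cv hg hθ p) hC (hCp g hg) hq
  · exact eLpNorm_expWeight_mul_le_of_le_lintegral hr hr1 hδ hδ1 hD.le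
      (measurable_eLpNorm_cv hg hθ p) hC (hCt g hg) le_rfl

theorem IsBandWindow.refl_eq {ψ b : 𝓢(E, ℂ)} (hψ : IsBandWindow ψ b) : refl ψ = ψ := by
  funext t
  rw [refl, hψ.even, hψ.real]

theorem integral_refl_mul_phase (θ : E → ℂ) (w : E) :
    ∫ t, refl θ t * phase w t = (starRingEnd ℂ) (∫ t, θ t * phase w t) := by
  rw [← integral_neg_eq_self, ← integral_conj]
  refine integral_congr_ae (Filter.Eventually.of_forall fun t => ?_)
  simp only [refl, neg_neg, map_mul, phase_neg_right, phase_neg_left]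

/-- The weighted norm of a real function with respect to a well localised window controls
all powers of exponentials in that norm. -/
theorem exists_wnorm_exp_I_sub_one_le {φ θ : 𝓢(E, ℂ)} (hφθ : ∀ t, θ t = refl φ t) (h0 : θ ≠ 0)
    {r κ C : ℝ} (hr : 0 < r) (hr1 : r < 1) (hκ : 1 < κ)
    (hC : ∀ w : E, ‖∫ t, φ t * phase w t‖ ≤ C * Real.exp (-(κ * ‖w‖ ^ r)))
    {p q : ℝ≥0∞} (hp : 1 ≤ p) (hq : 1 ≤ q) {u : E → ℝ} (hu : BddCont fun x => (u x : ℂ))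
    (hN : wnorm θ (expWeight r 1) p q (fun x => (u x : ℂ)) < ⊤) :
    ∃ (Z : ℝ≥0∞) (l : ℝ), Z ≠ ⊤ ∧ 0 ≤ l ∧ ∀ t m : ℝ, 2 ≤ m → |t| ≤ m →
      wnorm θ (expWeight r 1) p q (fun x => Complex.exp (Complex.I * ((t * u x : ℝ) : ℂ)) - 1) ≤
        Z * ENNReal.ofReal (Real.exp (l * (m ^ r * Real.log m))) := by
  obtain ⟨ψ, b, hψ⟩ := exists_isBandWindow E
  have hψw := isWindow_schwartz ψ
  have hθw := isWindow_schwartz θ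
  have hθφ : refl θ = φ := by
    have : (θ : E → ℂ) = refl φ := funext hφθ
    rw [this, refl_refl]
  have hθC : ∀ w : E, ‖∫ t, θ t * phase w t‖ ≤ C * Real.exp (-(κ * ‖w‖ ^ r)) := by
    intro w
    simp_rw [hφθ]
    rw [integral_refl_mul_phase, RCLike.norm_conj]
    exact hC w
  have hψ0 : (ψ : E → ℂ) ≠ 0 := fun h => hψ.ne_zero (congrFun h 0)
  have hθ0 : (θ : E → ℂ) ≠ 0 := fun h => h0 (DFunLike.coe_injective h)
  obtain ⟨C₁, hC₁, h₁⟩ := exists_wnorm_window_change hr hr1 hκ hθw (bddCont_schwartz θ) hθ0 hψw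
    (by rw [hθφ]; exact norm_cv_modul_modul_le_pow φ ψ)
    (by
      rw [hθφ]
      refine ⟨C * Real.exp κ * ∫ ζ, ‖b ζ‖, fun ξ η y => ?_⟩
      rw [cv_comm]
      have := hψ.norm_cv_modul_modul_le_exp (isWindow_schwartz φ) hr hr1 (by linarith) hC η ξ y
      rwa [norm_sub_rev η ξ] at this) hp hq
  obtain ⟨C₂, hC₂, h₂⟩ := exists_wnorm_window_change hr hr1 hκ hψw (bddCont_schwartz ψ) hψ0 hθw
    (by rw [hψ.refl_eq]; exact norm_cv_modul_modul_le_pow ψ θ)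
    (by
      rw [hψ.refl_eq]
      exact ⟨_, fun ξ η y => hψ.norm_cv_modul_modul_le_exp hθw hr hr1 (by linarith) hθC ξ η y⟩)
    hp hq
  have h2r : (1 : ℝ) ≤ 2 ^ r := Real.one_le_rpow (by norm_num) hr.le
  have h2r' : (2 : ℝ) ^ r < 2 := by
    simpa using Real.rpow_lt_rpow_of_exponent_lt (by norm_num : (1 : ℝ) < 2) hr1
  set δ := (2 : ℝ) ^ r - 1 with hδ
  -- As `2^r < 2`, there is room between `δ` and `1`. That `δ' < 1` lets Hölder pass from `L^q` with
  -- the full weight to `L¹` with exponent `δ'`; that `δ < δ'` yields the gain at high frequencies.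
  set δ' := (1 + δ) / 2 with hδ'
  have hδ'1 : δ' < 1 := by rw [hδ']; linarith
  have hδδ' : δ < δ' := by rw [hδ']; linarith
  have hNψ := lt_of_le_of_lt (h₁ _ hu).1 (ENNReal.mul_lt_top hC₁.lt_top hN)
  have hMψ : wnorm ψ (expWeight r δ') ⊤ 1 (fun x => (u x : ℂ)) < ⊤ := by
    refine lt_of_le_of_lt ((h₁ _ hu).2 δ' (by linarith) hδ'1.le) (ENNReal.mul_lt_top hC₁.lt_top ?_)
    rw [wnorm_one]
    exact lintegral_mul_expWeight_lt_top hr hδ'1 hq (measurable_eLpNorm_cv hu hθw p) hN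
  obtain ⟨Z, l, hZ, hl, H⟩ := hψ.exists_wnorm_exp_I_sub_one_le hr hr1 hδ hδδ' hδ'1 hp hq hu hMψ hNψ
  refine ⟨C₂ * Z, l, ENNReal.mul_ne_top hC₂ hZ, hl, fun t m hm ht => ?_⟩
  have hb : BddCont fun x => Complex.exp (Complex.I * ((t * u x : ℝ) : ℂ)) - 1 := by
    have := ((BddCont.const (Complex.I * t)).mul hu).exp_sub_one
    simpa only [Complex.ofReal_mul, mul_assoc] using this
  refine ((h₂ _ hb).1.trans (mul_le_mul' le_rfl (H t m hm ht))).trans (le_of_eq ?_)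
  rw [mul_assoc]

end WindowChangeNorm

/-! ### The density of a complex measure with respect to its variation. -/

section Density

variable {X : Type*} [MeasurableSpace X]

/-- Real and imaginary parts are absolutely continuous with respect to the variation, so
Radon-Nikodym applies to each. -/
theorem exists_withDensity_variation_eq (μ : ComplexMeasure X) [IsFiniteMeasure μ.variation] :
    ∃ h : X → ℂ, Measurable h ∧ Integrable h μ.variation ∧ μ.variation.withDensityᵥ h = μ := by
  set ν := μ.variation with hν
  have hac : ∀ s, ν s = 0 → μ s = 0 := by
    intro s hs
    have h1 := VectorMeasure.enorm_measure_le_variation μ s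
    rw [← hν, hs] at h1
    simpa using h1
  set μr : SignedMeasure X := ComplexMeasure.re μ
  set μi : SignedMeasure X := ComplexMeasure.im μ
  have hr : ν.withDensityᵥ (μr.rnDeriv ν) = μr := by
    refine SignedMeasure.withDensityᵥ_rnDeriv_eq _ _ (VectorMeasure.AbsolutelyContinuous.mk ?_)
    intro s hs h0
    rw [Measure.toENNRealVectorMeasure_apply_measurable hs] at h0
    change (μ s).re = 0
    rw [hac s h0, Complex.zero_re]
  have hi : ν.withDensityᵥ (μi.rnDeriv ν) = μi := by
    refine SignedMeasure.withDensityᵥ_rnDeriv_eq _ _ (VectorMeasure.AbsolutelyContinuous.mk ?_)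
    intro s hs h0
    rw [Measure.toENNRealVectorMeasure_apply_measurable hs] at h0
    change (μ s).im = 0
    rw [hac s h0, Complex.zero_im]
  have hri := SignedMeasure.integrable_rnDeriv μr ν
  have hii := SignedMeasure.integrable_rnDeriv μi ν
  set h : X → ℂ := fun x => (μr.rnDeriv ν x : ℂ) + (μi.rnDeriv ν x : ℂ) * Complex.I with hh
  have hint : Integrable h ν := hri.ofReal.add (hii.ofReal.mul_const _)
  refine ⟨h, ?_, hint, ?_⟩
  · exact (Complex.measurable_ofReal.comp (SignedMeasure.measurable_rnDeriv _ _)).add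
      ((Complex.measurable_ofReal.comp (SignedMeasure.measurable_rnDeriv _ _)).mul_const _)
  · refine VectorMeasure.ext fun s hs => ?_
    rw [withDensityᵥ_apply hint hs]
    have e1 : ∫ x in s, μr.rnDeriv ν x ∂ν = (μ s).re := by
      rw [← withDensityᵥ_apply hri hs, hr]
      rfl
    have e2 : ∫ x in s, μi.rnDeriv ν x ∂ν = (μ s).im := by
      rw [← withDensityᵥ_apply hii hs, hi]
      rfl
    have i1 : Integrable (fun x => (μr.rnDeriv ν x : ℂ)) (ν.restrict s) := hri.ofReal.restrict
    have i2 : Integrable (fun x => (μi.rnDeriv ν x : ℂ) * Complex.I) (ν.restrict s) :=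
      (hii.ofReal.mul_const _).restrict
    rw [hh, integral_add i1 i2,
      integral_mul_const, integral_complex_ofReal, integral_complex_ofReal, e1, e2]
    exact Complex.re_add_im _

/-- Polar decomposition of a complex measure. -/
theorem exists_density (μ : ComplexMeasure X) [IsFiniteMeasure μ.variation] :
    ∃ h : X → ℂ, Measurable h ∧ (∀ x, ‖h x‖ ≤ 1) ∧
      ∀ f : X → ℂ, Integrable f μ.variation →
        VectorMeasure.integral μ f (ContinuousLinearMap.mul ℝ ℂ) =
          ∫ x, f x * h x ∂μ.variation := by
  obtain ⟨h₀, hm, hint, he⟩ := exists_withDensity_variation_eq μ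
  set ν := μ.variation with hν
  -- The variation of the measure with density `h₀` has density `|h₀|`; here it is `ν` itself.
  have h1 : (fun x => ‖h₀ x‖ₑ) =ᵐ[ν] 1 := by
    refine (withDensity_eq_iff hm.enorm.aemeasurable aemeasurable_one hint.2.ne).1 ?_
    refine ((Measure.variation_withDensityᵥ hint).symm.trans ?_).trans withDensity_one.symm
    rw [he]
  -- Cutting off `h₀` on the null set outside `A` makes the bound hold everywhere.
  set A : Set X := {x | ‖h₀ x‖ ≤ 1} with hA
  have hAm : MeasurableSet A := measurableSet_le hm.norm measurable_const
  set h : X → ℂ := A.indicator h₀ with hh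
  have hhm : Measurable h := hm.indicator hAm
  have hle : ∀ x, ‖h x‖ ≤ 1 := by
    intro x
    by_cases hx : x ∈ A
    · rw [hh, Set.indicator_of_mem hx]; exact hx
    · rw [hh, Set.indicator_of_notMem hx]; simp
  have hae : h =ᵐ[ν] h₀ := by
    filter_upwards [h1] with x hx
    refine Set.indicator_of_mem ?_ _
    change ‖h₀ x‖ ≤ 1
    rw [← toReal_enorm, hx]
    simp
  have hmul : ∀ {f : X → ℂ}, Integrable f ν → Integrable (fun x => f x * h x) ν := fun hf =>
    hf.mul_bdd (c := 1) hhm.aestronglyMeasurable (Filter.Eventually.of_forall hle)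
  refine ⟨h, hhm, hle, fun f hf => ?_⟩
  -- Both sides are additive and continuous in `L¹(ν)`, and they agree on multiples of indicators.
  refine Integrable.induction (μ := ν) (fun f => VectorMeasure.integral μ f
    (ContinuousLinearMap.mul ℝ ℂ) = ∫ x, f x * h x ∂ν) ?_ ?_ ?_ ?_ hf
  · intro c s hs hsf
    rw [VectorMeasure.integral, setToFun_indicator_const _ hs hsf.ne]
    change c * μ s = _
    have e : ∀ x, s.indicator (fun _ => c) x * h x = s.indicator (fun x => c * h x) x := by
      intro x
      by_cases hx : x ∈ s <;> simp [hx]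
    simp_rw [e]
    rw [integral_indicator hs, integral_const_mul,
      setIntegral_congr_ae hs (g := h₀) (hae.mono fun x hx _ => hx), ← withDensityᵥ_apply hint hs,
      he]
  · intro f g _ hf hg h1 h2
    rw [VectorMeasure.integral_add hf hg, h1, h2, ← integral_add (hmul hf) (hmul hg)]
    simp only [Pi.add_apply, add_mul]
  · refine isClosed_eq VectorMeasure.continuous_integral ?_
    refine LipschitzWith.continuous (K := 1) (LipschitzWith.of_dist_le_mul fun f g => ?_)
    rw [dist_eq_norm, ← integral_sub (hmul (L1.integrable_coeFn f)) (hmul (L1.integrable_coeFn g)),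
      NNReal.coe_one, one_mul, L1.dist_eq_integral_dist]
    refine norm_integral_le_of_norm_le ?_ (Filter.Eventually.of_forall fun x => ?_)
    · simpa only [dist_eq_norm, Pi.sub_apply] using ((L1.integrable_coeFn f).sub (L1.integrable_coeFn g)).norm
    · rw [← sub_mul, norm_mul, dist_eq_norm]
      exact mul_le_of_le_one_right (norm_nonneg _) (hle x)
  · intro f g hfg _ h1
    rw [← VectorMeasure.integral_congr_ae hfg, h1]
    exact integral_congr_ae (hfg.mono fun x hx => by simp only [hx])

end Density

/-! ### Moments of the measure and smoothness of its inverse Fourier transform. -/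

section FourierMeasure

variable {μ : ComplexMeasure ℝ} {r : ℝ}

/-- The exponential moment condition on the measure. -/
def HasExpMoments (μ : ComplexMeasure ℝ) (r : ℝ) : Prop :=
  ∀ l : ℝ, 0 < l →
    ∫⁻ ξ : ℝ, ENNReal.ofReal (Real.exp (l * (|ξ| ^ r * Real.log |ξ|))) ∂μ.variation < ⊤

/-- This is `log y ≤ y - 1` at `y = x^{-r}`. The lower bound shows that a single exponential moment
already forces the variation to be finite. -/
theorem neg_inv_le_rpow_mul_log (hr : 0 < r) {x : ℝ} (hx : 0 ≤ x) :
    -(1 / r) ≤ x ^ r * Real.log x := by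
  rcases hx.eq_or_lt with rfl | hx
  · simp; positivity
  have h1 := Real.log_le_sub_one_of_pos (show 0 < x ^ (-r) by positivity)
  rw [Real.log_rpow hx] at h1
  have h2 : x ^ r * x ^ (-r) = 1 := by rw [← Real.rpow_add hx]; simp
  have h3 : 0 < x ^ r := by positivity
  have h4 : x ^ r * (-r * Real.log x) ≤ x ^ r * (x ^ (-r) - 1) := by gcongr
  have h5 : -r * (x ^ r * Real.log x) ≤ 1 := by nlinarith
  rw [neg_le, le_div_iff₀ hr]
  linarith

theorem HasExpMoments.isFiniteMeasure (hμ : HasExpMoments μ r) (hr : 0 < r) :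
    IsFiniteMeasure μ.variation := by
  refine ⟨?_⟩
  have h1 := hμ 1 one_pos
  have h2 : ENNReal.ofReal (Real.exp (-(1 / r))) * μ.variation Set.univ < ⊤ := by
    rw [← lintegral_const]
    refine lt_of_le_of_lt (lintegral_mono fun ξ => ENNReal.ofReal_le_ofReal ?_) h1
    rw [one_mul]
    exact Real.exp_le_exp.2 (neg_inv_le_rpow_mul_log hr (abs_nonneg ξ))
  by_contra h
  rw [not_lt, top_le_iff] at h
  rw [h, ENNReal.mul_top] at h2
  · exact lt_irrefl _ h2
  · simpa using Real.exp_pos _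

theorem HasExpMoments.integrable_pow (hμ : HasExpMoments μ r) (hr : 0 < r) (k : ℕ) :
    Integrable (fun ξ : ℝ => ‖ξ‖ ^ k) μ.variation := by
  have := hμ.isFiniteMeasure hr
  refine ⟨by fun_prop, ?_⟩
  have h1 : ∫⁻ ξ : ℝ, (1 + ENNReal.ofReal (Real.exp ((k + 1 : ℝ) * (|ξ| ^ r * Real.log |ξ|))))
      ∂μ.variation < ⊤ := by
    rw [lintegral_add_left measurable_const, lintegral_one]
    exact ENNReal.add_lt_top.2 ⟨measure_lt_top _ _, hμ _ (by positivity)⟩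
  refine lt_of_le_of_lt (lintegral_mono fun ξ => ?_) h1
  rw [← ofReal_norm, Real.norm_of_nonneg (by positivity)]
  beta_reduce
  rw [Real.norm_eq_abs]
  rcases le_total |ξ| 1 with h | h
  · refine le_add_right ?_
    rw [ENNReal.ofReal_le_one]
    exact pow_le_one₀ (abs_nonneg _) h
  · refine le_add_left (ENNReal.ofReal_le_ofReal ?_)
    have h0 : 0 < |ξ| := by linarith
    have hlog : 0 ≤ Real.log |ξ| := Real.log_nonneg h
    have hpow : 1 ≤ |ξ| ^ r := Real.one_le_rpow h hr.le
    calc |ξ| ^ k = Real.exp (k * Real.log |ξ|) := by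
          rw [Real.exp_nat_mul, Real.exp_log h0]
      _ ≤ _ := by
        refine Real.exp_le_exp.2 ?_
        have : Real.log |ξ| ≤ |ξ| ^ r * Real.log |ξ| := le_mul_of_one_le_left hlog hpow
        have hk : (0 : ℝ) ≤ k := Nat.cast_nonneg k
        nlinarith

/-- The estimate for `e^{itu} - 1` requires `m ≥ 2` and is applied with `m = max 2 |t|`. -/
theorem HasExpMoments.lintegral_max_lt_top (hμ : HasExpMoments μ r) (hr : 0 < r) {l : ℝ}
    (hl : 0 ≤ l) :
    ∫⁻ ξ : ℝ, ENNReal.ofReal (Real.exp (l * ((max 2 |ξ|) ^ r * Real.log (max 2 |ξ|))))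
      ∂μ.variation < ⊤ := by
  have := hμ.isFiniteMeasure hr
  have h1 : ∫⁻ ξ : ℝ, (ENNReal.ofReal (Real.exp (l * (2 ^ r * Real.log 2))) +
      ENNReal.ofReal (Real.exp ((l + 1) * (|ξ| ^ r * Real.log |ξ|)))) ∂μ.variation < ⊤ := by
    rw [lintegral_add_left measurable_const, lintegral_const]
    exact ENNReal.add_lt_top.2 ⟨ENNReal.mul_lt_top ENNReal.ofReal_lt_top (measure_lt_top _ _),
      hμ _ (by positivity)⟩
  refine lt_of_le_of_lt (lintegral_mono fun ξ => ?_) h1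
  rcases le_total |ξ| 2 with h | h
  · rw [max_eq_left h]
    exact le_self_add
  · rw [max_eq_right h]
    refine le_add_left (ENNReal.ofReal_le_ofReal (Real.exp_le_exp.2 ?_))
    have hlog : 0 ≤ Real.log |ξ| := Real.log_nonneg (by linarith)
    have : 0 ≤ |ξ| ^ r * Real.log |ξ| := by positivity
    nlinarith

theorem exists_invFourierMeasure_eq [IsFiniteMeasure μ.variation] :
    ∃ h : ℝ → ℂ, Measurable h ∧ (∀ x, ‖h x‖ ≤ 1) ∧ (μ Set.univ = ∫ ξ, h ξ ∂μ.variation) ∧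
      ∀ t, invFourierMeasure μ t = (((2 * Real.pi) ^ (-(1 : ℝ) / 2) : ℝ) : ℂ) *
        ∫ ξ, Complex.exp (Complex.I * ((ξ * t : ℝ) : ℂ)) * h ξ ∂μ.variation := by
  obtain ⟨h, hm, hle, H⟩ := exists_density μ
  refine ⟨h, hm, hle, ?_, fun t => ?_⟩
  · have h1 := H (fun _ => 1) (integrable_const _)
    rw [VectorMeasure.integral_const] at h1
    simpa using h1
  · rw [invFourierMeasure, H]
    have hc : Continuous fun ξ : ℝ => Complex.exp (Complex.I * ((ξ * t : ℝ) : ℂ)) := by fun_prop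
    refine (integrable_const (1 : ℝ)).mono' hc.aestronglyMeasurable
      (Filter.Eventually.of_forall fun ξ => ?_)
    rw [Complex.norm_exp]
    simp

theorem HasExpMoments.contDiff_invFourierMeasure (hμ : HasExpMoments μ r) (hr : 0 < r) :
    ContDiff ℝ ∞ (invFourierMeasure μ) := by
  have := hμ.isFiniteMeasure hr
  obtain ⟨h, hm, hle, -, H⟩ := exists_invFourierMeasure_eq (μ := μ)
  -- This scaling turns the kernel `e^{-2πi L(ξ, t)}` into `e^{iξt}`. Finite polynomial moments then
  -- allow differentiation to every order.
  set L : ℝ →L[ℝ] ℝ →L[ℝ] ℝ := (-(2 * Real.pi)⁻¹ : ℝ) • ContinuousLinearMap.mul ℝ ℝ with hL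
  have h1 := VectorFourier.contDiff_fourierIntegral L (f := h) (μ := μ.variation) (N := ⊤)
    (fun k _ => by
      refine (hμ.integrable_pow hr k).mono' (by fun_prop) (Filter.Eventually.of_forall fun ξ => ?_)
      rw [Real.norm_of_nonneg (by positivity)]
      exact mul_le_of_le_one_right (by positivity) (hle ξ))
  have h2 : invFourierMeasure μ = fun t => (((2 * Real.pi) ^ (-(1 : ℝ) / 2) : ℝ) : ℂ) *
      VectorFourier.fourierIntegral Real.fourierChar μ.variation L.toLinearMap₁₂ h t := by
    funext t
    rw [H, VectorFourier.fourierIntegral]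
    congr 1
    refine integral_congr_ae (Filter.Eventually.of_forall fun ξ => ?_)
    beta_reduce
    rw [Circle.smul_def, Real.fourierChar_apply, smul_eq_mul]
    congr 2
    have hpi : Real.pi ≠ 0 := Real.pi_ne_zero
    have e : 2 * Real.pi * -((L.toLinearMap₁₂ ξ) t) = ξ * t := by
      change 2 * Real.pi * -(-(2 * Real.pi)⁻¹ * (ξ * t)) = ξ * t
      field_simp
    rw [e, mul_comm]
  rw [h2]
  exact contDiff_const.mul h1

theorem bddCont_invFourierMeasure_comp (hμ : HasExpMoments μ r) (hr : 0 < r) {E : Type*} [TopologicalSpace E]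
    {u : E → ℝ}
    (hu : Continuous u) : BddCont fun x => invFourierMeasure μ (u x) := by
  have := hμ.isFiniteMeasure hr
  obtain ⟨h, hm, hle, -, H⟩ := exists_invFourierMeasure_eq (μ := μ)
  refine ⟨(hμ.contDiff_invFourierMeasure hr).continuous.comp hu,
    ‖(((2 * Real.pi) ^ (-(1 : ℝ) / 2) : ℝ) : ℂ)‖ * ∫ ξ : ℝ, 1 ∂μ.variation, fun x => ?_⟩
  rw [H, norm_mul]
  gcongr
  refine norm_integral_le_of_norm_le (integrable_const _) (Filter.Eventually.of_forall fun ξ => ?_)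
  rw [norm_mul, Complex.norm_exp]
  simpa using hle ξ

end FourierMeasure

/-! ### Norms of superpositions, and the composition estimate. -/

section Superposition

variable {E : Type*} [NormedAddCommGroup E] [InnerProductSpace ℝ E] [FiniteDimensional ℝ E]
  [MeasurableSpace E] [BorelSpace E]

variable {T : Type*} [TopologicalSpace T] [FirstCountableTopology T] {F : T → E → ℂ} {g : E → ℂ} {h : T → ℂ}
  {θ : E → ℂ} {B : ℝ} {c : ℂ}

theorem continuous_cv_modul_param (hFc : Continuous fun z : T × E => F z.1 z.2)
    (hFB : ∀ t x, ‖F t x‖ ≤ B) (hθ : IsWindow θ) :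
    Continuous fun z : E × (T × E) => cv (F z.2.1) (modul z.2.2 θ) z.1 := by
  refine continuous_of_dominated (bound := fun t => B * ‖θ t‖) (fun z => ?_) (fun z => ?_)
    (hθ.int.norm.const_mul B) ?_
  · exact ((hFc.comp (f := fun t => (z.2.1, z.1 - t)) (by fun_prop)).mul
      (hθ.modul z.2.2).cont).aestronglyMeasurable
  · refine Filter.Eventually.of_forall fun t => ?_
    rw [norm_mul, norm_modul]
    exact mul_le_mul_of_nonneg_right (hFB _ _) (norm_nonneg _)
  · refine Filter.Eventually.of_forall fun t => ?_
    exact (hFc.comp (f := fun z : E × (T × E) => (z.2.1, z.1 - t)) (by fun_prop)).mul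
      (continuous_const.mul (continuous_phase (by fun_prop) continuous_const))

variable {T : Type*} [TopologicalSpace T] [SecondCountableTopology T] {F : T → E → ℂ} {h : T → ℂ}
  [MeasurableSpace T] [BorelSpace T] {ν : Measure T}
  [IsFiniteMeasure ν]

theorem enorm_cv_superposition_le (hFc : Continuous fun z : T × E => F z.1 z.2)
    (hFB : ∀ t x, ‖F t x‖ ≤ B) (hm : Measurable h) (hle : ∀ t, ‖h t‖ ≤ 1)
    (hg : ∀ x, g x = c * ∫ t, F t x * h t ∂ν) (hθ : IsWindow θ) (x : E) :
    ‖cv g θ x‖ₑ ≤ ‖c‖ₑ * ∫⁻ t, ‖cv (F t) θ x‖ₑ ∂ν := by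
  have hhi : Integrable h ν := (integrable_const (1 : ℝ)).mono' hm.aestronglyMeasurable
    (Filter.Eventually.of_forall hle)
  have e : cv g θ x = c * ∫ t, cv (F t) θ x * h t ∂ν := by
    have e1 : cv g θ x = c * ∫ y, ∫ t, F t (x - y) * θ y * h t ∂ν := by
      rw [cv, ← integral_const_mul]
      refine integral_congr_ae (Filter.Eventually.of_forall fun y => ?_)
      beta_reduce
      rw [hg, mul_assoc, ← integral_mul_const]
      congr 1
      refine integral_congr_ae (Filter.Eventually.of_forall fun t => ?_)
      beta_reduce
      ring
    rw [e1, integral_integral_swap]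
    · congr 1
      refine integral_congr_ae (Filter.Eventually.of_forall fun t => ?_)
      beta_reduce
      rw [integral_mul_const, cv]
    · have h2 : Integrable (fun z : E × T => θ z.1 * h z.2) (volume.prod ν) :=
        hθ.int.mul_prod hhi
      refine (h2.bdd_mul (c := B) (f := fun z : E × T => F z.2 (x - z.1)) (hFc.comp
        (f := fun z : E × T => (z.2, x - z.1)) (by fun_prop)).aestronglyMeasurable
        (Filter.Eventually.of_forall fun z => hFB _ _)).congr
        (Filter.Eventually.of_forall fun z => ?_)
      simp only [Function.uncurry]
      ring
  rw [e, enorm_mul]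
  refine mul_le_mul' le_rfl ((enorm_integral_le_lintegral_enorm _).trans
    (lintegral_mono fun t => ?_))
  rw [enorm_mul]
  refine mul_le_of_le_one_right' ?_
  rw [← ofReal_norm, ENNReal.ofReal_le_one]
  exact hle t

end Superposition

section Superposition

variable {E : Type*} [NormedAddCommGroup E] [InnerProductSpace ℝ E] [FiniteDimensional ℝ E]
  [MeasurableSpace E] [BorelSpace E] {g : E → ℂ} {θ : E → ℂ} {B : ℝ} {c : ℂ}
  {T : Type*} [TopologicalSpace T] [SecondCountableTopology T] {F : T → E → ℂ} {h : T → ℂ}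
  [MeasurableSpace T] {ν : Measure T} [IsFiniteMeasure ν]

theorem eLpNorm_weight_le_mul_lintegral {W G : E → ℝ≥0∞} (hW : Measurable W) {q c : ℝ≥0∞}
    (hq : 1 ≤ q) (hc : c ≠ ⊤) {P : T × E → ℝ≥0∞} (hP : Measurable P)
    (hG : ∀ ξ, G ξ ≤ c * ∫⁻ t, P (t, ξ) ∂ν) :
    eLpNorm (fun ξ => W ξ * G ξ) q (volume : Measure E) ≤
      c * ∫⁻ t, eLpNorm (fun ξ => W ξ * P (t, ξ)) q (volume : Measure E) ∂ν := by
  have hm : Measurable (Function.uncurry fun (ξ : E) (t : T) => W ξ * P (t, ξ)) :=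
    (hW.comp measurable_fst).mul (hP.comp measurable_swap)
  refine eLpNorm_le_mul_lintegral hq hc hm fun ξ => ?_
  rw [enorm_eq_self, lintegral_const_mul _ (f := fun t => P (t, ξ))
    (hP.comp measurable_prodMk_right), mul_left_comm]
  exact mul_le_mul' le_rfl (hG ξ)

variable [BorelSpace T]

theorem wnorm_superposition_le (hFc : Continuous fun z : T × E => F z.1 z.2)
    (hFB : ∀ t x, ‖F t x‖ ≤ B) (hm : Measurable h) (hle : ∀ t, ‖h t‖ ≤ 1)
    (hg : ∀ x, g x = c * ∫ t, F t x * h t ∂ν) (hθ : IsWindow θ)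
    {W : E → ℝ≥0∞} (hW : Measurable W) {p q : ℝ≥0∞} (hp : 1 ≤ p) (hq : 1 ≤ q) :
    wnorm θ W p q g ≤ ‖c‖ₑ * ∫⁻ t, wnorm θ W p q (F t) ∂ν := by
  have hct : ‖c‖ₑ ≠ ⊤ := enorm_ne_top
  have hjc := continuous_cv_modul_param hFc hFB hθ
  have hin : ∀ ξ, eLpNorm (cv g (modul ξ θ)) p volume ≤
      ‖c‖ₑ * ∫⁻ t, eLpNorm (cv (F t) (modul ξ θ)) p volume ∂ν := by
    intro ξ
    have hm1 : Measurable (Function.uncurry fun (x : E) (t : T) => ‖cv (F t) (modul ξ θ) x‖ₑ) :=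
      (hjc.comp (f := fun z : E × T => (z.1, (z.2, ξ))) (by fun_prop)).measurable.enorm
    have := eLpNorm_le_mul_lintegral (μ := (volume : Measure E)) (ν := ν) hp
      (f := cv g (modul ξ θ)) hct hm1
      (enorm_cv_superposition_le hFc hFB hm hle hg (hθ.modul ξ))
    simpa only [eLpNorm_enorm] using this
  have hm2 : Measurable fun z : T × E => eLpNorm (cv (F z.1) (modul z.2 θ)) p volume := by
    have h1 : Measurable (Function.uncurry fun (x : E) (z : T × E) =>
        ‖cv (F z.1) (modul z.2 θ) x‖ₑ) := hjc.measurable.enorm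
    simpa only [eLpNorm_enorm] using measurable_eLpNorm_section (μ := (volume : Measure E)) h1 p
  have key := eLpNorm_weight_le_mul_lintegral (ν := ν) (W := W) (c := ‖c‖ₑ)
    (G := fun ξ => eLpNorm (cv g (modul ξ θ)) p volume) hW hq hct hm2 hin
  beta_reduce at key
  unfold wnorm
  exact key

/-- Since `μ` has total mass zero, `e^{itu}` may be replaced by `e^{itu} - 1`. The replacement is
essential for `p < ∞`, where nonzero constants have infinite norm for a nonzero window. -/
theorem wnorm_invFourierMeasure_comp_le {μ : ComplexMeasure ℝ} [IsFiniteMeasure μ.variation]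
    (hμ0 : μ Set.univ = 0) {u : E → ℝ} (hu : Continuous u) (hθ : IsWindow θ)
    {W : E → ℝ≥0∞} (hW : Measurable W) {p q : ℝ≥0∞} (hp : 1 ≤ p) (hq : 1 ≤ q) :
    wnorm θ W p q (fun x => invFourierMeasure μ (u x)) ≤
      ‖(((2 * Real.pi) ^ (-(1 : ℝ) / 2) : ℝ) : ℂ)‖ₑ *
        ∫⁻ t, wnorm θ W p q (fun x => Complex.exp (Complex.I * ((t * u x : ℝ) : ℂ)) - 1)
          ∂μ.variation := by
  obtain ⟨h, hm, hle, h0, H⟩ := exists_invFourierMeasure_eq (μ := μ)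
  set F : ℝ → E → ℂ := fun t x => Complex.exp (Complex.I * ((t * u x : ℝ) : ℂ)) - 1 with hF
  have hFc : Continuous fun z : ℝ × E => F z.1 z.2 := by
    simp only [hF]
    fun_prop
  have hF2 : ∀ t x, ‖F t x‖ ≤ 2 := by
    intro t x
    refine (norm_sub_le _ _).trans ?_
    rw [Complex.norm_exp]
    simp
    norm_num
  have hhi : Integrable h μ.variation := (integrable_const (1 : ℝ)).mono' hm.aestronglyMeasurable
    (Filter.Eventually.of_forall hle)
  refine wnorm_superposition_le hFc hF2 hm hle (fun x => ?_) hθ hW hp hq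
  rw [H]
  congr 1
  have e : ∀ t, Complex.exp (Complex.I * ((t * u x : ℝ) : ℂ)) * h t = F t x * h t + h t := by
    intro t
    simp only [hF]
    ring
  simp_rw [e]
  rw [integral_add _ hhi, ← h0, hμ0, add_zero]
  exact hhi.bdd_mul (c := 2) (hFc.comp (f := fun t => (t, x)) (by fun_prop)).aestronglyMeasurable
    (Filter.Eventually.of_forall fun t => hF2 t x)

theorem wnorm_invFourierMeasure_comp_lt_top {φ θ : 𝓢(E, ℂ)} (hφθ : ∀ t, θ t = refl φ t)
    (h0 : θ ≠ 0) {r κ C : ℝ} (hr : 0 < r) (hr1 : r < 1) (hκ : 1 < κ)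
    (hC : ∀ w, ‖∫ t, φ t * phase w t‖ ≤ C * Real.exp (-(κ * ‖w‖ ^ r)))
    {p q : ℝ≥0∞} (hp : 1 ≤ p) (hq : 1 ≤ q) {μ : ComplexMeasure ℝ} (hμ : HasExpMoments μ r)
    (hμ0 : μ Set.univ = 0) {u : E → ℝ} (hu : BddCont fun x => (u x : ℂ))
    (hN : wnorm θ (expWeight r 1) p q (fun x => (u x : ℂ)) < ⊤) :
    wnorm θ (expWeight r 1) p q (fun x => invFourierMeasure μ (u x)) < ⊤ := by
  have := hμ.isFiniteMeasure hr
  obtain ⟨Z, l, hZ, hl, H⟩ := exists_wnorm_exp_I_sub_one_le hφθ h0 hr hr1 hκ hC hp hq hu hN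
  have huc : Continuous u := (Complex.continuous_re.comp hu.cont).congr fun x => by simp
  refine (wnorm_invFourierMeasure_comp_le hμ0 huc (isWindow_schwartz θ)
    (measurable_expWeight r 1) hp hq).trans_lt ?_
  refine ENNReal.mul_lt_top enorm_lt_top (lt_of_le_of_lt (lintegral_mono fun t =>
    H t (max 2 |t|) (le_max_left _ _) (le_max_right _ _)) ?_)
  rw [lintegral_const_mul' _ _ hZ]
  exact ENNReal.mul_lt_top hZ.lt_top (hμ.lintegral_max_lt_top hr hl)

end Superposition

/-! ### Gelfand-Shilov estimates for translations and modulations. -/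

section Estimates

variable {n : ℕ} {s h A : ℝ} {φ χ : EuclideanSpace ℝ (Fin n) → ℂ}

theorem exists_schwartz_of_mem (hφ : φ ∈ gelfandShilov n s) :
    ∃ Φ : 𝓢(EuclideanSpace ℝ (Fin n), ℂ), (Φ : EuclideanSpace ℝ (Fin n) → ℂ) = φ := by
  obtain ⟨hs, h, -, A, H⟩ := hφ
  exact ⟨⟨φ, hs, fun k m => ⟨_, H k m⟩⟩, rfl⟩

theorem IsGSBound.comp_conj_neg (H : IsGSBound s h A φ) : IsGSBound s h A (refl φ) := by
  intro m k x
  have e : ‖iteratedFDeriv ℝ k (refl φ) x‖ = ‖iteratedFDeriv ℝ k φ (-x)‖ := by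
    have h1 := LinearIsometryEquiv.norm_iteratedFDeriv_comp_left (𝕜 := ℝ) Complex.conjLIE
      (fun t => φ (-t)) x k
    have h2 := LinearIsometryEquiv.norm_iteratedFDeriv_comp_right (𝕜 := ℝ)
      (LinearIsometryEquiv.neg ℝ (E := EuclideanSpace ℝ (Fin n))) φ x k
    exact h1.trans h2
  rw [e, ← norm_neg x]
  exact H m k (-x)

theorem refl_mem (hφ : φ ∈ gelfandShilov n s) : refl φ ∈ gelfandShilov n s := by
  obtain ⟨hs, h, h0, A, H⟩ := hφ
  exact ⟨Complex.conjLIE.toContinuousLinearEquiv.contDiff.comp (hs.comp contDiff_neg), h, h0, A,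
    H.comp_conj_neg⟩

/-- Powers of `x` are split by `‖x‖ ≤ ‖x - ζ‖ + ‖ζ‖`: those of `x - ζ` are absorbed by `χ`, those of
`ζ` by the scalar `κ`. With `κ = 1` this controls translates; with `κ = |a ζ|` the decay of `a` pays
for the translation. -/
theorem IsGSBound.mul_norm_iteratedFDeriv_sub_le (H : IsGSBound s h A χ) (h0 : 0 < h)
    {ζ : EuclideanSpace ℝ (Fin n)} {κ M : ℝ} (hκ : 0 ≤ κ)
    (hM : ∀ m : ℕ, ‖ζ‖ ^ m * κ ≤ M * h ^ m * (m.factorial : ℝ) ^ s) (m k : ℕ)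
    (x : EuclideanSpace ℝ (Fin n)) :
    ‖x‖ ^ m * (κ * ‖iteratedFDeriv ℝ k χ (x - ζ)‖) ≤
      2 * A * M * (2 * h) ^ (m + k) * ((m.factorial : ℝ) * (k.factorial : ℝ)) ^ s := by
  have hA := H.nonneg
  have hκM : κ ≤ M := by simpa using hM 0
  set D := ‖iteratedFDeriv ℝ k χ (x - ζ)‖ with hD
  have hD0 : 0 ≤ D := norm_nonneg _
  set a := (m.factorial : ℝ) ^ s
  set b := (k.factorial : ℝ) ^ s
  have hb : 0 < b := by positivity
  have ha : 0 < a := by positivity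
  have hab : ((m.factorial : ℝ) * (k.factorial : ℝ)) ^ s = a * b :=
    Real.mul_rpow (by positivity) (by positivity)
  have h1 : ‖x - ζ‖ ^ m * D ≤ A * h ^ (m + k) * (a * b) := by rw [← hab]; exact H m k (x - ζ)
  have h2 : D ≤ A * h ^ k * b := by simpa using H 0 k (x - ζ)
  have h3 : ‖x‖ ^ m ≤ 2 ^ m * (‖x - ζ‖ ^ m + ‖ζ‖ ^ m) := by
    have ht : ‖x‖ ≤ ‖x - ζ‖ + ‖ζ‖ := by simpa using norm_add_le (x - ζ) ζ
    refine (pow_le_pow_left₀ (norm_nonneg _) ht m).trans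
      ((add_pow_le (norm_nonneg _) (norm_nonneg _) m).trans ?_)
    gcongr
    · norm_num
    · exact Nat.sub_le _ _
  have h4 : ‖x - ζ‖ ^ m * D * κ ≤ A * h ^ (m + k) * (a * b) * M := by gcongr
  have h5 : (‖ζ‖ ^ m * κ) * D ≤ (M * h ^ m * a) * (A * h ^ k * b) := by
    have := hM m
    have : 0 ≤ M * h ^ m * a := le_trans (by positivity) this
    gcongr
  calc ‖x‖ ^ m * (κ * D) ≤ 2 ^ m * (‖x - ζ‖ ^ m + ‖ζ‖ ^ m) * (κ * D) := by gcongr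
    _ = 2 ^ m * (‖x - ζ‖ ^ m * D * κ + (‖ζ‖ ^ m * κ) * D) := by ring
    _ ≤ 2 ^ m * (A * h ^ (m + k) * (a * b) * M + (M * h ^ m * a) * (A * h ^ k * b)) := by gcongr
    _ = 2 ^ m * (2 * A * M * h ^ (m + k) * (a * b)) := by rw [pow_add]; ring
    _ ≤ 2 ^ (m + k) * (2 * A * M * h ^ (m + k) * (a * b)) := by
      have : 0 ≤ M := hκ.trans hκM
      gcongr
      · norm_num
      · exact Nat.le_add_right _ _
    _ = _ := by rw [hab, mul_pow]; ring

theorem pow_le_exp_mul_factorial (hs : 1 ≤ s) (h0 : 0 < h) {t : ℝ} (ht : 0 ≤ t) (m : ℕ) :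
    t ^ m ≤ Real.exp (t / h) * h ^ m * (m.factorial : ℝ) ^ s := by
  have h1 := Real.pow_div_factorial_le_exp (t / h) (by positivity) m
  rw [div_pow, div_div, div_le_iff₀ (by positivity)] at h1
  have h2 : (m.factorial : ℝ) ≤ (m.factorial : ℝ) ^ s :=
    Real.self_le_rpow_of_one_le (by exact_mod_cast Nat.factorial_pos m) hs
  calc t ^ m ≤ Real.exp (t / h) * (h ^ m * m.factorial) := h1
    _ ≤ Real.exp (t / h) * (h ^ m * (m.factorial : ℝ) ^ s) := by gcongr
    _ = _ := by ring

/-- Extra polynomial decay is free up to enlarging `h` by `2^s`, because `(m + N)! ≤ 2^{m + N} m!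
N!`. -/
theorem IsGSBound.pow_mul_norm_le_decay (H : IsGSBound s h A χ) (hs : 0 ≤ s) (h0 : 0 < h) (N : ℕ) :
    ∃ C : ℝ, ∀ (z : EuclideanSpace ℝ (Fin n)) (m : ℕ),
      ‖z‖ ^ m * ‖χ z‖ ≤ C * ((1 + ‖z‖) ^ N)⁻¹ * (2 ^ s * h) ^ m * (m.factorial : ℝ) ^ s := by
  have hA := H.nonneg
  set g := (N.factorial : ℝ) ^ s
  refine ⟨2 ^ N * (A + A * h ^ N * (2 ^ s) ^ N * g), fun z m => ?_⟩
  set a := (m.factorial : ℝ) ^ s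
  have h1 : ‖z‖ ^ m * ‖χ z‖ ≤ A * h ^ m * a := by simpa using H m 0 z
  have h2 : ‖z‖ ^ (m + N) * ‖χ z‖ ≤ A * h ^ (m + N) * ((m + N).factorial : ℝ) ^ s := by
    simpa using H (m + N) 0 z
  have h3 : ((m + N).factorial : ℝ) ^ s ≤ (2 ^ s) ^ (m + N) * (a * g) := by
    have e : ((m + N).factorial : ℝ) ≤ 2 ^ (m + N) * (m.factorial * N.factorial) := by
      have h4 := Nat.add_choose_mul_factorial_mul_factorial m N
      have h5 : (m + N).choose N ≤ 2 ^ (m + N) := Nat.choose_le_two_pow _ _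
      have : (m + N).factorial ≤ 2 ^ (m + N) * (m.factorial * N.factorial) := by
        rw [← h4, mul_assoc]
        exact Nat.mul_le_mul_right _ h5
      exact_mod_cast this
    calc ((m + N).factorial : ℝ) ^ s ≤ (2 ^ (m + N) * (m.factorial * N.factorial : ℝ)) ^ s := by
          gcongr
      _ = _ := by
        rw [Real.mul_rpow (by positivity) (by positivity), Real.mul_rpow (by positivity)
          (by positivity), ← Real.rpow_natCast, ← Real.rpow_mul (by norm_num), mul_comm _ s,
          Real.rpow_mul (by norm_num), Real.rpow_natCast]
  have h6 : (1 + ‖z‖) ^ N ≤ 2 ^ N * (1 + ‖z‖ ^ N) := by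
    refine (add_pow_le zero_le_one (norm_nonneg _) N).trans ?_
    rw [one_pow]
    gcongr
    · norm_num
    · omega
  have h7 : (1 : ℝ) ≤ (2 ^ s) ^ m := one_le_pow₀ (Real.one_le_rpow (by norm_num) hs)
  have key : (1 + ‖z‖) ^ N * (‖z‖ ^ m * ‖χ z‖) ≤
      2 ^ N * (A + A * h ^ N * (2 ^ s) ^ N * g) * (2 ^ s * h) ^ m * a := by
    calc (1 + ‖z‖) ^ N * (‖z‖ ^ m * ‖χ z‖)
        ≤ 2 ^ N * (1 + ‖z‖ ^ N) * (‖z‖ ^ m * ‖χ z‖) := by gcongr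
      _ = 2 ^ N * (‖z‖ ^ m * ‖χ z‖ + ‖z‖ ^ (m + N) * ‖χ z‖) := by rw [pow_add]; ring
      _ ≤ 2 ^ N * (A * h ^ m * a + A * h ^ (m + N) * ((2 ^ s) ^ (m + N) * (a * g))) := by
          exact mul_le_mul_of_nonneg_left (add_le_add h1 (h2.trans (by gcongr))) (by positivity)
      _ ≤ 2 ^ N * (A * h ^ m * a * (2 ^ s) ^ m +
            A * h ^ (m + N) * ((2 ^ s) ^ (m + N) * (a * g))) := by
          exact mul_le_mul_of_nonneg_left (add_le_add_left
            (le_mul_of_one_le_right (by positivity) h7) _) (by positivity)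
      _ = _ := by rw [mul_pow, pow_add, pow_add]; ring
  have hp : 0 < (1 + ‖z‖) ^ N := by positivity
  rw [← mul_le_mul_iff_right₀ hp]
  refine key.trans_eq ?_
  field_simp

theorem IsGSBound.shift (H : IsGSBound s h A χ) (hs : 1 ≤ s) (h0 : 0 < h)
    (z : EuclideanSpace ℝ (Fin n)) :
    IsGSBound s (2 * h) (2 * A * Real.exp (‖z‖ / h)) (fun t => χ (t - z)) := by
  intro m k x
  rw [iteratedFDeriv_comp_sub]
  have := H.mul_norm_iteratedFDeriv_sub_le h0 (ζ := z) zero_le_one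
    (fun m => by simpa using pow_le_exp_mul_factorial hs h0 (norm_nonneg z) m) m k x
  simpa using this

theorem shift_mem (hs : 1 ≤ s) (hχ : χ ∈ gelfandShilov n s) (z : EuclideanSpace ℝ (Fin n)) :
    (fun t => χ (t - z)) ∈ gelfandShilov n s := by
  obtain ⟨hsm, h, h0, A, H⟩ := hχ
  exact ⟨hsm.comp (contDiff_id.sub contDiff_const), 2 * h, by positivity, _, H.shift hs h0 z⟩

theorem rpow_factorial_succ_le (hs : 0 ≤ s) (k : ℕ) :
    ((k + 1).factorial : ℝ) ^ s ≤ (2 ^ s) ^ k * (k.factorial : ℝ) ^ s := by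
  have e : ((k + 1).factorial : ℝ) ≤ 2 ^ k * k.factorial := by
    have : k + 1 ≤ 2 ^ k := Nat.lt_two_pow_self
    rw [Nat.factorial_succ]
    exact_mod_cast Nat.mul_le_mul_right _ this
  refine (Real.rpow_le_rpow (by positivity) e hs).trans_eq ?_
  rw [Real.mul_rpow (by positivity) (by positivity), ← Real.rpow_natCast, ← Real.rpow_mul
    (by norm_num), mul_comm _ s, Real.rpow_mul (by norm_num), Real.rpow_natCast]

/-- The mean value inequality on the ball of radius `R` about `x` costs one derivative, and `(k +
1)! ≤ 2^k k!` lets a larger parameter absorb it. The case `‖x‖ ^ m = 0` is separate because the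
derivative bound divides by this power. -/
theorem IsGSBound.shift_sub_shift (H : IsGSBound s h A χ) (hχ : ContDiff ℝ ∞ χ) (hs : 1 ≤ s)
    (h0 : 0 < h) (R : ℝ) :
    ∃ C : ℝ, ∀ z z₀ : EuclideanSpace ℝ (Fin n), ‖z‖ ≤ R → ‖z₀‖ ≤ R →
      IsGSBound s (2 ^ s * (2 * h)) (C * ‖z - z₀‖) (fun t => χ (t - z) - χ (t - z₀)) := by
  have hA := H.nonneg
  have hs0 : 0 ≤ s := by linarith
  refine ⟨2 * A * Real.exp (R / h) * (2 * h), fun z z₀ hz hz₀ m k x => ?_⟩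
  have hsh : ∀ z, ContDiff ℝ ∞ (fun t => χ (t - z)) := fun z =>
    hχ.comp (contDiff_id.sub contDiff_const)
  have e : iteratedFDeriv ℝ k (fun t => χ (t - z) - χ (t - z₀)) x =
      iteratedFDeriv ℝ k χ (x - z) - iteratedFDeriv ℝ k χ (x - z₀) := by
    have := iteratedFDeriv_sub_apply (𝕜 := ℝ) (i := k) (x := x)
      ((hsh z).contDiffAt.of_le (by exact_mod_cast le_top))
      ((hsh z₀).contDiffAt.of_le (by exact_mod_cast le_top))
    rw [iteratedFDeriv_comp_sub, iteratedFDeriv_comp_sub] at this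
    exact this
  rw [e]
  set K := 2 * A * Real.exp (R / h) * (2 * h) ^ (m + (k + 1)) *
    ((m.factorial : ℝ) * ((k + 1).factorial : ℝ)) ^ s with hK
  have hK0 : 0 ≤ K := by positivity
  rcases eq_or_ne (‖x‖ ^ m) 0 with hx0 | hx0
  · rw [hx0, zero_mul]
    have : 0 ≤ 2 * A * Real.exp (R / h) * (2 * h) * ‖z - z₀‖ := by positivity
    positivity
  have hxp : 0 < ‖x‖ ^ m := lt_of_le_of_ne (by positivity) hx0.symm
  have hb : ∀ y ∈ Metric.closedBall x R,
      ‖fderiv ℝ (iteratedFDeriv ℝ k χ) y‖ ≤ K / ‖x‖ ^ m := by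
    intro y hy
    rw [norm_fderiv_iteratedFDeriv, le_div_iff₀ hxp, mul_comm]
    have hy' : ‖x - y‖ ≤ R := by rwa [mem_closedBall_iff_norm'] at hy
    have := H.mul_norm_iteratedFDeriv_sub_le h0 (ζ := x - y) (M := Real.exp (R / h)) zero_le_one
      (fun m => by
        rw [mul_one]
        refine (pow_le_exp_mul_factorial hs h0 (norm_nonneg (x - y)) m).trans ?_
        gcongr) m (k + 1) x
    simpa using this
  have hmem : ∀ z : EuclideanSpace ℝ (Fin n), ‖z‖ ≤ R → x - z ∈ Metric.closedBall x R := by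
    intro z hz
    rw [mem_closedBall_iff_norm']
    simpa using hz
  have hmv := (convex_closedBall x R).norm_image_sub_le_of_norm_fderiv_le (𝕜 := ℝ)
    (f := iteratedFDeriv ℝ k χ)
    (fun y _ => (hχ.differentiable_iteratedFDeriv (m := k)
      (by exact_mod_cast ENat.natCast_lt_top k)) y) hb (hmem z₀ hz₀) (hmem z hz)
  have hmv' : ‖x‖ ^ m * ‖iteratedFDeriv ℝ k χ (x - z) - iteratedFDeriv ℝ k χ (x - z₀)‖ ≤
      K * ‖z - z₀‖ := by
    refine (mul_le_mul_of_nonneg_left hmv hxp.le).trans_eq ?_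
    have : (x - z) - (x - z₀) = -(z - z₀) := by abel
    rw [this, norm_neg]
    field_simp
  refine hmv'.trans ?_
  have hf : ((m.factorial : ℝ) * ((k + 1).factorial : ℝ)) ^ s ≤
      (2 ^ s) ^ (m + k) * ((m.factorial : ℝ) * (k.factorial : ℝ)) ^ s := by
    rw [Real.mul_rpow (by positivity) (by positivity), Real.mul_rpow (by positivity)
      (by positivity)]
    have h7 : (1 : ℝ) ≤ (2 ^ s) ^ m := one_le_pow₀ (Real.one_le_rpow (by norm_num) hs0)
    calc (m.factorial : ℝ) ^ s * ((k + 1).factorial : ℝ) ^ s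
        ≤ (m.factorial : ℝ) ^ s * ((2 ^ s) ^ k * (k.factorial : ℝ) ^ s) := by
          gcongr
          exact rpow_factorial_succ_le hs0 k
      _ ≤ (2 ^ s) ^ m * ((m.factorial : ℝ) ^ s * ((2 ^ s) ^ k * (k.factorial : ℝ) ^ s)) :=
          le_mul_of_one_le_left (by positivity) h7
      _ = _ := by rw [pow_add]; ring
  calc K * ‖z - z₀‖ ≤ 2 * A * Real.exp (R / h) * (2 * h) ^ (m + (k + 1)) *
        ((2 ^ s) ^ (m + k) * ((m.factorial : ℝ) * (k.factorial : ℝ)) ^ s) * ‖z - z₀‖ := by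
        rw [hK]; gcongr
    _ = _ := by rw [mul_pow, ← add_assoc, pow_succ]; ring

theorem norm_exp_neg_I_sub_one_le (r : ℝ) : ‖Complex.exp (-(Complex.I * (r : ℂ))) - 1‖ ≤ |r| := by
  have := Real.norm_exp_I_mul_ofReal_sub_one_le (x := -r)
  rw [Real.norm_eq_abs, abs_neg] at this
  convert this using 4
  push_cast
  ring

theorem norm_iteratedFDeriv_phase_sub_one_le (w t : EuclideanSpace ℝ (Fin n)) (hw : ‖w‖ ≤ 1) (k : ℕ) :
    ‖iteratedFDeriv ℝ k (fun t : EuclideanSpace ℝ (Fin n) =>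
      Complex.exp (-(Complex.I * (inner ℝ t w : ℝ))) - 1) t‖ ≤ ‖w‖ * (1 + ‖t‖) := by
  rcases k with _ | k
  · rw [norm_iteratedFDeriv_zero]
    refine (norm_exp_neg_I_sub_one_le _).trans ((abs_real_inner_le_norm _ _).trans ?_)
    nlinarith [norm_nonneg w, norm_nonneg t]
  · have e := iteratedFDeriv_sub_apply (𝕜 := ℝ) (i := k + 1) (x := t)
      ((contDiff_phase w).contDiffAt.of_le (by exact_mod_cast le_top))
      (contDiffAt_const (c := (1 : ℂ)))
    rw [iteratedFDeriv_const_of_ne (by omega), Pi.zero_apply, sub_zero] at e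
    have e' : iteratedFDeriv ℝ (k + 1) (fun t : EuclideanSpace ℝ (Fin n) =>
        Complex.exp (-(Complex.I * (inner ℝ t w : ℝ))) - 1) t = _ := e
    rw [e']
    refine (norm_iteratedFDeriv_phase_le w t (k + 1)).trans ?_
    have h1 : ‖w‖ ^ (k + 1) ≤ ‖w‖ := pow_le_of_le_one (norm_nonneg _) hw (by omega)
    nlinarith [norm_nonneg w, norm_nonneg t]

/-- Every derivative of `e^{-it·w} - 1` is at most `‖w‖ (1 + ‖t‖)`. The additional power of `t` is
absorbed by passing from `m` to `m + 1` in the bound for `χ`. -/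
theorem IsGSBound.phase_sub_one_mul (H : IsGSBound s h A χ) (hχ : ContDiff ℝ ∞ χ) (hs : 0 ≤ s)
    (h0 : 0 < h) :
    ∃ h' C : ℝ, 0 < h' ∧ ∀ w : EuclideanSpace ℝ (Fin n), ‖w‖ ≤ 1 →
      IsGSBound s h' (C * ‖w‖)
        (fun t => (Complex.exp (-(Complex.I * (inner ℝ t w : ℝ))) - 1) * χ t) := by
  have hA := H.nonneg
  set g : ℝ := 2 ^ s with hg
  have hg1 : 1 ≤ g := Real.one_le_rpow (by norm_num) hs
  refine ⟨g * (1 + h), A * (1 + h), by positivity, fun w hw m k x => ?_⟩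
  have hph : ContDiff ℝ ∞ (fun t : EuclideanSpace ℝ (Fin n) =>
    Complex.exp (-(Complex.I * (inner ℝ t w : ℝ))) - 1) := (contDiff_phase w).sub contDiff_const
  have hprod := norm_iteratedFDeriv_mul_le hph hχ x (n := k) (by exact_mod_cast le_top)
  set a := (m.factorial : ℝ) ^ s
  set b := (k.factorial : ℝ) ^ s
  have hb : 0 < b := by positivity
  have ha : 0 < a := by positivity
  have hab : ((m.factorial : ℝ) * (k.factorial : ℝ)) ^ s = a * b :=
    Real.mul_rpow (by positivity) (by positivity)
  have hD : ∀ j, j ≤ k → ‖x‖ ^ m * ((1 + ‖x‖) * ‖iteratedFDeriv ℝ j χ x‖) ≤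
      A * (1 + h) * (g * h) ^ m * h ^ j * (a * b) := by
    intro j hj
    have hjb : (j.factorial : ℝ) ^ s ≤ b :=
      Real.rpow_le_rpow (by positivity) (by exact_mod_cast Nat.factorial_le hj) hs
    have h1 : ‖x‖ ^ m * ‖iteratedFDeriv ℝ j χ x‖ ≤ A * h ^ (m + j) * (a * b) := by
      refine (H m j x).trans ?_
      rw [Real.mul_rpow (by positivity) (by positivity)]
      gcongr
    have h2 : ‖x‖ ^ (m + 1) * ‖iteratedFDeriv ℝ j χ x‖ ≤ A * h ^ (m + 1 + j) * (g ^ m * a * b) := by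
      refine (H (m + 1) j x).trans ?_
      rw [Real.mul_rpow (by positivity) (by positivity)]
      have := rpow_factorial_succ_le hs m
      gcongr
    have h7 : (1 : ℝ) ≤ g ^ m := one_le_pow₀ hg1
    calc ‖x‖ ^ m * ((1 + ‖x‖) * ‖iteratedFDeriv ℝ j χ x‖)
        = ‖x‖ ^ m * ‖iteratedFDeriv ℝ j χ x‖ + ‖x‖ ^ (m + 1) * ‖iteratedFDeriv ℝ j χ x‖ := by ring
      _ ≤ A * h ^ (m + j) * (a * b) * g ^ m + A * h ^ (m + 1 + j) * (g ^ m * a * b) :=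
          add_le_add (h1.trans (le_mul_of_one_le_right (by positivity) h7)) h2
      _ = _ := by rw [mul_pow, pow_add, pow_add, pow_add]; ring
  calc ‖x‖ ^ m * ‖iteratedFDeriv ℝ k
        (fun t => (Complex.exp (-(Complex.I * (inner ℝ t w : ℝ))) - 1) * χ t) x‖
      ≤ ‖x‖ ^ m * ∑ j ∈ Finset.range (k + 1), (k.choose j : ℝ) * (‖w‖ * (1 + ‖x‖)) *
          ‖iteratedFDeriv ℝ (k - j) χ x‖ := by
        refine mul_le_mul_of_nonneg_left (hprod.trans ?_) (by positivity)
        refine Finset.sum_le_sum fun j _ => ?_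
        exact mul_le_mul_of_nonneg_right (mul_le_mul_of_nonneg_left
          (norm_iteratedFDeriv_phase_sub_one_le w x hw j) (by positivity)) (norm_nonneg _)
    _ = ∑ j ∈ Finset.range (k + 1), (k.choose j : ℝ) * ‖w‖ *
          (‖x‖ ^ m * ((1 + ‖x‖) * ‖iteratedFDeriv ℝ (k - j) χ x‖)) := by
        rw [Finset.mul_sum]
        exact Finset.sum_congr rfl fun j _ => by ring
    _ ≤ ∑ j ∈ Finset.range (k + 1), (k.choose j : ℝ) * ‖w‖ *
          (A * (1 + h) * (g * h) ^ m * h ^ (k - j) * (a * b)) := by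
        refine Finset.sum_le_sum fun j _ => ?_
        exact mul_le_mul_of_nonneg_left (hD _ (Nat.sub_le _ _)) (by positivity)
    _ = A * (1 + h) * ‖w‖ * (g * h) ^ m * (1 + h) ^ k * (a * b) := by
        rw [add_pow 1 h k, Finset.mul_sum, Finset.sum_mul]
        refine Finset.sum_congr rfl fun j _ => ?_
        rw [one_pow]
        ring
    _ ≤ A * (1 + h) * ‖w‖ * (g * (1 + h)) ^ m * (g * (1 + h)) ^ k * (a * b) := by
        have h1 : (g * h) ^ m ≤ (g * (1 + h)) ^ m := by gcongr; linarith
        have h2 : (1 + h) ^ k ≤ (g * (1 + h)) ^ k := by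
          gcongr
          exact le_mul_of_one_le_left (by positivity) hg1
        refine mul_le_mul_of_nonneg_right ?_ (by positivity)
        exact mul_le_mul (mul_le_mul_of_nonneg_left h1 (by positivity)) h2 (by positivity)
          (by positivity)
    _ = _ := by rw [hab, pow_add]; ring

end Estimates

/-! ### Differentiation of convolutions under the integral. -/

section ConvolutionDerivative

variable {E F : Type*} [NormedAddCommGroup E] [InnerProductSpace ℝ E] [FiniteDimensional ℝ E]
  [MeasurableSpace E] [BorelSpace E] [NormedAddCommGroup F] [NormedSpace ℂ F]

theorem integrable_smul_comp_sub {a : E → ℂ} (ha : IsWindow a) {G : E → F}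
    (hG : Continuous G) {B : ℝ} (hB : ∀ x, ‖G x‖ ≤ B) (x : E) :
    Integrable fun z => a z • G (x - z) := by
  refine Integrable.mono' (ha.int.norm.mul_const B) (ha.cont.smul
    (hG.comp (by fun_prop))).aestronglyMeasurable (Filter.Eventually.of_forall fun z => ?_)
  rw [norm_smul]
  exact mul_le_mul_of_nonneg_left (hB _) (norm_nonneg _)

variable [NormedSpace ℝ F] [SMulCommClass ℝ ℂ F]

theorem hasFDerivAt_integral_smul_comp_sub {a : E → ℂ} (ha : IsWindow a) {G : E → F}
    {G' : E → E →L[ℝ] F} (hG : ∀ x, HasFDerivAt G (G' x) x) (hG' : Continuous G') {B B' : ℝ}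
    (hB : ∀ x, ‖G x‖ ≤ B) (hB' : ∀ x, ‖G' x‖ ≤ B') (x : E) :
    HasFDerivAt (fun x => ∫ z, a z • G (x - z)) (∫ z, a z • G' (x - z)) x := by
  have hGc : Continuous G := continuous_iff_continuousAt.2 fun x => (hG x).continuousAt
  refine hasFDerivAt_integral_of_dominated_of_fderiv_le (s := Set.univ)
    (F := fun x z => a z • G (x - z)) (F' := fun x z => a z • G' (x - z)) (bound := fun z => ‖a z‖ * B') Filter.univ_mem
    (Filter.Eventually.of_forall fun x => (integrable_smul_comp_sub ha hGc hB x).1)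
    (integrable_smul_comp_sub ha hGc hB x) (integrable_smul_comp_sub ha hG' hB' x).1
    (Filter.Eventually.of_forall fun z y _ => ?_) (ha.int.norm.mul_const B')
    (Filter.Eventually.of_forall fun z y _ => ?_)
  · rw [norm_smul]
    exact mul_le_mul_of_nonneg_left (hB' _) (norm_nonneg _)
  · have h1 : HasFDerivAt (fun y => y - z) (ContinuousLinearMap.id ℝ E) y :=
      (hasFDerivAt_id y).sub_const z
    exact ((hG (y - z)).comp y h1).const_smul (a z)

/-- The formal Taylor series of the convolution `cv g a`. -/
noncomputable def cvSeries (a g : E → ℂ) : E → FormalMultilinearSeries ℝ E ℂ :=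
  fun x j => ∫ z, a z • iteratedFDeriv ℝ j g (x - z)

theorem hasFTaylorSeriesUpTo_cv {a g : E → ℂ} (ha : IsWindow a) (hg : ContDiff ℝ ∞ g)
    (hB : ∀ j : ℕ, ∃ B : ℝ, ∀ x, ‖iteratedFDeriv ℝ j g x‖ ≤ B) :
    HasFTaylorSeriesUpTo ∞ (cv g a) (cvSeries a g) := by
  have hc : ∀ j : ℕ, Continuous (iteratedFDeriv ℝ j g) := fun j =>
    hg.continuous_iteratedFDeriv (by exact_mod_cast le_top)
  refine (hasFTaylorSeriesUpTo_top_iff' le_rfl).2 ⟨fun x => ?_, fun j x => ?_⟩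
  · obtain ⟨B, hB⟩ := hB 0
    rw [ContinuousMultilinearMap.curry0, cvSeries, ContinuousMultilinearMap.integral_apply
      (integrable_smul_comp_sub ha (hc 0) hB x), cv]
    refine integral_congr_ae (Filter.Eventually.of_forall fun z => ?_)
    beta_reduce
    rw [smul_apply, iteratedFDeriv_zero_apply, smul_eq_mul, mul_comm]
  · obtain ⟨B, hB0⟩ := hB j
    obtain ⟨B', hB'⟩ := hB (j + 1)
    have h1 := hasFDerivAt_integral_smul_comp_sub ha (G := iteratedFDeriv ℝ j g)
      (G' := fun x => (iteratedFDeriv ℝ (j + 1) g x).curryLeft) (fun x => ?_) ?_ hB0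
      (B' := B') (fun x => ?_) x
    · have hcl : Continuous fun x => (iteratedFDeriv ℝ (j + 1) g x).curryLeft :=
        (continuousMultilinearCurryLeftEquiv ℝ (fun _ : Fin (j + 1) => E) ℂ).continuous.comp
          (hc (j + 1))
      have hi := integrable_smul_comp_sub (F := E →L[ℝ] E [×j]→L[ℝ] ℂ) ha
        (G := fun x => (iteratedFDeriv ℝ (j + 1) g x).curryLeft) hcl (B := B') (fun x => by
        rw [ContinuousMultilinearMap.curryLeft_norm]
        exact hB' x) x
      have e : (cvSeries a g x (j + 1)).curryLeft =
          ∫ z, a z • (iteratedFDeriv ℝ (j + 1) g (x - z)).curryLeft := by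
        ext v w
        rw [ContinuousMultilinearMap.curryLeft_apply, cvSeries,
          ContinuousMultilinearMap.integral_apply (integrable_smul_comp_sub ha (hc (j + 1)) hB' x),
          ContinuousLinearMap.integral_apply hi,
          ContinuousMultilinearMap.integral_apply (hi.apply_continuousLinearMap v)]
        rfl
      exact (congrArg (fun L => HasFDerivAt (fun y => cvSeries a g y j) L x) e).mpr h1
    · exact (hg.differentiable_iteratedFDeriv (m := j)
        (by exact_mod_cast ENat.natCast_lt_top j) x).hasFDerivAt
    · exact (continuousMultilinearCurryLeftEquiv ℝ (fun _ : Fin (j + 1) => E) ℂ).continuous.comp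
        (hc (j + 1))
    · rw [ContinuousMultilinearMap.curryLeft_norm]
      exact hB' x

end ConvolutionDerivative

/-! ### Test functions as bounded families of derivatives. -/

section SequenceSpace

variable {n : ℕ} {s h A : ℝ}

/-- Bounded families of multilinear maps indexed by the seminorm parameters `m, k, x`. -/
abbrev GSCoord (n : ℕ) : Type :=
  lp (fun i : ℕ × ℕ × EuclideanSpace ℝ (Fin n) =>
    (EuclideanSpace ℝ (Fin n)) [×i.2.1]→L[ℝ] ℂ) ∞

/-- The normalising factor of the Gelfand-Shilov norm. -/
noncomputable def gsFactor (s h : ℝ) {n : ℕ} (i : ℕ × ℕ × EuclideanSpace ℝ (Fin n)) : ℝ :=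
  ‖i.2.2‖ ^ i.1 / (h ^ (i.1 + i.2.1) * ((i.1.factorial : ℝ) * (i.2.1.factorial : ℝ)) ^ s)

/-- The family of normalised derivatives of `ψ`. -/
noncomputable def gsCoord (s h : ℝ) {n : ℕ} (ψ : EuclideanSpace ℝ (Fin n) → ℂ)
    (i : ℕ × ℕ × EuclideanSpace ℝ (Fin n)) : (EuclideanSpace ℝ (Fin n)) [×i.2.1]→L[ℝ] ℂ :=
  gsFactor s h i • iteratedFDeriv ℝ i.2.1 ψ i.2.2

theorem isGSBound_iff (h0 : 0 < h) {ψ : EuclideanSpace ℝ (Fin n) → ℂ} :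
    IsGSBound s h A ψ ↔ ∀ i, ‖gsCoord s h ψ i‖ ≤ A := by
  have key : ∀ (m k : ℕ) (x : EuclideanSpace ℝ (Fin n)), ‖gsCoord s h ψ (m, k, x)‖ ≤ A ↔
      ‖x‖ ^ m * ‖iteratedFDeriv ℝ k ψ x‖ ≤
        A * h ^ (m + k) * ((m.factorial : ℝ) * (k.factorial : ℝ)) ^ s := by
    intro m k x
    have hp : 0 < h ^ (m + k) * ((m.factorial : ℝ) * (k.factorial : ℝ)) ^ s := by positivity
    rw [gsCoord, norm_smul, gsFactor, Real.norm_of_nonneg (by positivity), div_mul_eq_mul_div,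
      div_le_iff₀ hp, mul_assoc A]
  exact ⟨fun H i => (key _ _ _).2 (H _ _ _), fun H m k x => (key _ _ _).1 (H _)⟩

theorem gsCoord_zero_zero (s h : ℝ) (ψ : EuclideanSpace ℝ (Fin n) → ℂ)
    (x : EuclideanSpace ℝ (Fin n)) : gsCoord s h ψ (0, 0, x) 0 = ψ x := by
  simp [gsCoord, gsFactor]

theorem gsCoord_add {ψ ψ' : EuclideanSpace ℝ (Fin n) → ℂ} (hψ : ContDiff ℝ ∞ ψ)
    (hψ' : ContDiff ℝ ∞ ψ') (i : ℕ × ℕ × EuclideanSpace ℝ (Fin n)) :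
    gsCoord s h (ψ + ψ') i = gsCoord s h ψ i + gsCoord s h ψ' i := by
  rw [gsCoord, iteratedFDeriv_add_apply (hψ.contDiffAt.of_le (by exact_mod_cast le_top))
        (hψ'.contDiffAt.of_le (by exact_mod_cast le_top)), smul_add]
  rfl

theorem gsCoord_smul {ψ : EuclideanSpace ℝ (Fin n) → ℂ} (hψ : ContDiff ℝ ∞ ψ) (c : ℂ)
    (i : ℕ × ℕ × EuclideanSpace ℝ (Fin n)) :
    gsCoord s h (c • ψ) i = c • gsCoord s h ψ i := by
  rw [gsCoord, iteratedFDeriv_const_smul_apply (hψ.contDiffAt.of_le (by exact_mod_cast le_top)),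
    smul_comm]
  rfl

/-- A functional of the Gelfand-Shilov space extends continuously to families of derivatives. -/
theorem exists_clm_gsCoord (U : GSDistribution n s) (h0 : 0 < h) :
    ∃ Λ : GSCoord n →L[ℂ] ℂ, ∀ (ψ : gelfandShilov n s) (y : GSCoord n),
      (∀ i, y i = gsCoord s h (ψ : EuclideanSpace ℝ (Fin n) → ℂ) i) → U.toLinearMap ψ = Λ y := by
  let p : Submodule ℂ (GSCoord n) :=
    { carrier := {y | ∃ ψ : gelfandShilov n s, ∀ i,
        y i = gsCoord s h (ψ : EuclideanSpace ℝ (Fin n) → ℂ) i}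
      zero_mem' := ⟨0, fun i => by
        rw [gsCoord, show ((0 : gelfandShilov n s) : EuclideanSpace ℝ (Fin n) → ℂ) = 0 from rfl]
        simp⟩
      add_mem' := by
        rintro y y' ⟨ψ, h1⟩ ⟨ψ', h2⟩
        exact ⟨ψ + ψ', fun i => by
          rw [Submodule.coe_add, gsCoord_add ψ.2.1 ψ'.2.1, ← h1, ← h2]; rfl⟩
      smul_mem' := by
        rintro c y ⟨ψ, h1⟩
        exact ⟨c • ψ, fun i => by rw [Submodule.coe_smul, gsCoord_smul ψ.2.1, ← h1]; rfl⟩ }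
  -- The coordinate `(0, 0, x)` recovers `ψ x`, so a family determines its function and `U` descends
  -- to the subspace `p`.
  have hinj : ∀ (ψ ψ' : gelfandShilov n s), (∀ i, gsCoord s h (ψ : EuclideanSpace ℝ (Fin n) → ℂ) i
      = gsCoord s h (ψ' : EuclideanSpace ℝ (Fin n) → ℂ) i) → ψ = ψ' := by
    intro ψ ψ' H
    refine Subtype.ext (funext fun x => ?_)
    rw [← gsCoord_zero_zero s h (ψ : EuclideanSpace ℝ (Fin n) → ℂ), H, gsCoord_zero_zero]
  choose r hr using fun y : p => y.2
  let f : p →ₗ[ℂ] ℂ :=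
    { toFun := fun y => U.toLinearMap (r y)
      map_add' := fun y y' => by
        rw [← map_add]
        congr 1
        refine hinj _ _ fun i => ?_
        rw [Submodule.coe_add, gsCoord_add (r y).2.1 (r y').2.1, ← hr y, ← hr y', ← hr (y + y')]
        rfl
      map_smul' := fun c y => by
        rw [← map_smul]
        congr 1
        refine hinj _ _ fun i => ?_
        rw [RingHom.id_apply, Submodule.coe_smul, gsCoord_smul (r y).2.1, ← hr y, ← hr (c • y)]
        rfl }
  obtain ⟨C, hC⟩ := U.bound h h0
  -- The supremum norm on `p` is the Gelfand-Shilov norm with parameter `h`, on which `U` is bounded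
  -- by assumption; Hahn-Banach extends it.
  obtain ⟨Λ, hΛ, -⟩ := exists_extension_norm_eq p (f.mkContinuous C fun y => by
    refine hC _ _ ((isGSBound_iff h0).2 fun i => ?_)
    rw [← hr]
    exact lp.norm_apply_le_norm (by simp) (y : GSCoord n) i)
  refine ⟨Λ, fun ψ y hy => ?_⟩
  have h1 := hΛ ⟨y, ψ, hy⟩
  rw [h1]
  change _ = U.toLinearMap (r _)
  congr 1
  refine hinj _ _ fun i => ?_
  rw [← hy, ← hr]

/-- The family of normalised derivatives as an element of the sequence space. -/
noncomputable def IsGSBound.toCoord {ψ : EuclideanSpace ℝ (Fin n) → ℂ} (H : IsGSBound s h A ψ)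
    (h0 : 0 < h) : GSCoord n :=
  ⟨gsCoord s h ψ, memℓp_infty ⟨A, by rintro _ ⟨i, rfl⟩; exact (isGSBound_iff h0).1 H i⟩⟩

/-- The value of `U` on `ψ`, with the default value `0` outside the Gelfand-Shilov space. -/
noncomputable def GSDistribution.eval (U : GSDistribution n s)
    (ψ : EuclideanSpace ℝ (Fin n) → ℂ) : ℂ :=
  open Classical in if hψ : ψ ∈ gelfandShilov n s then U.toLinearMap ⟨ψ, hψ⟩ else 0

theorem GSDistribution.eval_of_mem (U : GSDistribution n s) {ψ : EuclideanSpace ℝ (Fin n) → ℂ}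
    (hψ : ψ ∈ gelfandShilov n s) : U.eval ψ = U.toLinearMap ⟨ψ, hψ⟩ := dif_pos hψ

end SequenceSpace

variable {n : ℕ} {s : ℝ}

theorem isWindow_of_mem {φ : EuclideanSpace ℝ (Fin n) → ℂ} (hφ : φ ∈ gelfandShilov n s) :
    IsWindow φ := by
  obtain ⟨Φ, rfl⟩ := exists_schwartz_of_mem hφ
  exact isWindow_schwartz Φ

/-- Translates of an element of the Gelfand-Shilov space depend continuously on the translation,
and grow slower than any prescribed element of the space decays. -/
theorem exists_coord_family (hs : 1 ≤ s) {χ a : EuclideanSpace ℝ (Fin n) → ℂ}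
    (hχ : χ ∈ gelfandShilov n s) (ha : a ∈ gelfandShilov n s) :
    ∃ h : ℝ, 0 < h ∧ ∃ Y : EuclideanSpace ℝ (Fin n) → GSCoord n,
      (∀ z i, Y z i = gsCoord s h (fun t => χ (t - z)) i) ∧ Continuous Y ∧
      Integrable fun z => a z • Y z := by
  have hs0 : 0 ≤ s := by linarith
  have hac := (isWindow_of_mem ha).cont
  obtain ⟨hχs, h₁, h₁0, A₁, H₁⟩ := hχ
  obtain ⟨has, h₂, h₂0, A₂, H₂⟩ := ha
  have hg : (1 : ℝ) ≤ 2 ^ s := Real.one_le_rpow (by norm_num) hs0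
  set h₃ := max h₁ h₂ with hh₃
  have h₃0 : 0 < h₃ := lt_max_of_lt_left h₁0
  -- At this parameter `a` has the surplus decay of order `n + 1`, and `χ` is relaxed to the same
  -- parameter so that both can enter one estimate.
  set h₀ := 2 ^ s * h₃ with hh₀
  have h₀0 : 0 < h₀ := by positivity
  have h30 : h₃ ≤ h₀ := le_mul_of_one_le_left h₃0.le hg
  obtain ⟨C, hC⟩ := (H₂.mono h₂0.le (le_max_right h₁ h₂)).pow_mul_norm_le_decay hs0 h₃0 (n + 1)
  have H := (H₁.mono h₁0.le (le_max_left h₁ h₂)).mono h₃0.le h30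
  have hA := H.nonneg
  set h := 2 ^ s * (2 * h₀) with hh
  have h0 : 0 < h := by positivity
  have h20 : 2 * h₀ ≤ h := le_mul_of_one_le_left (by positivity) hg
  have Hsh : ∀ z, IsGSBound s h (2 * A₁ * Real.exp (‖z‖ / h₀)) (fun t => χ (t - z)) := fun z =>
    (H.shift hs h₀0 z).mono (by positivity) h20
  have hsm : ∀ z, ContDiff ℝ ∞ (fun t => χ (t - z)) := fun z =>
    hχs.comp (contDiff_id.sub contDiff_const)
  set Y : EuclideanSpace ℝ (Fin n) → GSCoord n := fun z => (Hsh z).toCoord h0 with hY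
  have hYi : ∀ z i, Y z i = gsCoord s h (fun t => χ (t - z)) i := fun z i => rfl
  have hYc : Continuous Y := by
    rw [continuous_iff_continuousAt]
    intro z₀
    obtain ⟨C', hC'⟩ := H.shift_sub_shift hχs hs h₀0 (‖z₀‖ + 1)
    rw [ContinuousAt, tendsto_iff_norm_sub_tendsto_zero]
    have hlim : Filter.Tendsto (fun z => C' * ‖z - z₀‖) (nhds z₀) (nhds 0) := by
      have : Continuous fun z => C' * ‖z - z₀‖ := by fun_prop
      simpa using this.tendsto z₀
    refine squeeze_zero' (Filter.Eventually.of_forall fun z => norm_nonneg _) ?_ hlim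
    filter_upwards [Metric.ball_mem_nhds z₀ one_pos] with z hz
    have hz' : ‖z‖ ≤ ‖z₀‖ + 1 := by
      have := norm_sub_norm_le z z₀
      rw [mem_ball_iff_norm] at hz
      linarith
    have hb := hC' z z₀ hz' (by linarith)
    refine lp.norm_le_of_forall_le hb.nonneg fun i => ?_
    have := (isGSBound_iff h0).1 hb i
    have e : (fun t => χ (t - z) - χ (t - z₀)) =
        (fun t => χ (t - z)) + (-1 : ℂ) • (fun t => χ (t - z₀)) := by
      funext t
      simp [sub_eq_add_neg]
    have e2 : ∀ a b : (EuclideanSpace ℝ (Fin n)) [×i.2.1]→L[ℝ] ℂ, a + (-1 : ℂ) • b = a - b := by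
      intro a b
      ext v
      simp [sub_eq_add_neg]
    rw [e, gsCoord_add (ψ' := (-1 : ℂ) • fun t => χ (t - z₀)) (hsm z)
      ((hsm z₀).const_smul (-1 : ℂ)), gsCoord_smul (hsm z₀), e2] at this
    exact this
  refine ⟨h, h0, Y, hYi, hYc, ?_⟩
  have hint : Integrable fun z : EuclideanSpace ℝ (Fin n) =>
      2 * A₁ * (C * ((1 + ‖z‖) ^ (n + 1))⁻¹) := by
    refine Integrable.const_mul (Integrable.const_mul ?_ _) _
    have := integrable_one_add_norm (E := EuclideanSpace ℝ (Fin n)) (μ := volume)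
      (r := ((n + 1 : ℕ) : ℝ)) (by rw [finrank_euclideanSpace_fin]; push_cast; linarith)
    refine this.congr (Filter.Eventually.of_forall fun z => ?_)
    beta_reduce
    rw [Real.rpow_neg (by positivity), Real.rpow_natCast]
  refine hint.mono' (hac.smul hYc).aestronglyMeasurable (Filter.Eventually.of_forall fun z => ?_)
  have hM0 : 0 ≤ C * ((1 + ‖z‖) ^ (n + 1))⁻¹ := by
    have := hC z 0
    simp only [pow_zero, one_mul, Nat.factorial_zero, Nat.cast_one, Real.one_rpow, mul_one] at this
    exact (norm_nonneg _).trans this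
  -- The growth `e^{‖z‖ / h₀}` of the translates alone is in general too fast for the subexponential
  -- decay of `a`. Estimating each coordinate of the product instead lets powers of `z` be absorbed
  -- by `a`, with the integrable surplus left over.
  refine lp.norm_le_of_forall_le (by positivity) fun i => ?_
  have hb := H.mul_norm_iteratedFDeriv_sub_le h₀0 (ζ := z) (norm_nonneg (a z)) (hC z) i.1 i.2.1 i.2.2
  have hb' : gsFactor s (2 * h₀) i * (‖a z‖ * ‖iteratedFDeriv ℝ i.2.1 χ (i.2.2 - z)‖) ≤
      2 * A₁ * (C * ((1 + ‖z‖) ^ (n + 1))⁻¹) := by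
    rw [gsFactor, div_mul_eq_mul_div, div_le_iff₀ (by positivity), ← mul_assoc (2 * A₁ * _)]
    exact hb
  have hf : gsFactor s h i ≤ gsFactor s (2 * h₀) i := by
    unfold gsFactor
    gcongr
  have hf0 : 0 ≤ gsFactor s h i := by unfold gsFactor; positivity
  calc ‖(a z • Y z) i‖ = gsFactor s h i * (‖a z‖ * ‖iteratedFDeriv ℝ i.2.1 χ (i.2.2 - z)‖) := by
        change ‖a z • gsCoord s h (fun t => χ (t - z)) i‖ = _
        rw [gsCoord, norm_smul, norm_smul, iteratedFDeriv_comp_sub, Real.norm_of_nonneg hf0]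
        ring
    _ ≤ _ := le_trans (by gcongr) hb'

/-- The Bochner integral of `a z • Y z` in the sequence space has as coordinates the normalised
derivatives of `cv χ a`. This shows membership, and applying the continuous extension of `U` moves
`U` inside the integral. -/
theorem cv_mem (hs : 1 ≤ s) {χ a : EuclideanSpace ℝ (Fin n) → ℂ}
    (hχ : χ ∈ gelfandShilov n s) (ha : a ∈ gelfandShilov n s) : cv χ a ∈ gelfandShilov n s ∧
      ∀ U : GSDistribution n s, (Continuous fun z => U.eval fun t => χ (t - z)) ∧
        (Integrable fun z => a z * U.eval fun t => χ (t - z)) ∧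
        U.eval (cv χ a) = ∫ z, a z * U.eval fun t => χ (t - z) := by
  obtain ⟨h, h0, Y, hYi, hYc, hYint⟩ := exists_coord_family hs hχ ha
  have haw := isWindow_of_mem ha
  have hB : ∀ j : ℕ, ∃ B : ℝ, ∀ x, ‖iteratedFDeriv ℝ j χ x‖ ≤ B := by
    obtain ⟨-, h₁, -, A₁, H₁⟩ := hχ
    exact fun j => ⟨_, fun x => by simpa using H₁ 0 j x⟩
  have hT := hasFTaylorSeriesUpTo_cv haw hχ.1 hB
  have hsm : ContDiff ℝ ∞ (cv χ a) := HasFTaylorSeriesUpTo.contDiff (n := ⊤) hT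
  set J : GSCoord n := ∫ z, a z • Y z with hJ
  have hcoord : ∀ i, J i = gsCoord s h (cv χ a) i := by
    intro i
    have h1 := (lp.evalCLM ℂ (fun i : ℕ × ℕ × EuclideanSpace ℝ (Fin n) =>
      (EuclideanSpace ℝ (Fin n)) [×i.2.1]→L[ℝ] ℂ) ∞ i).integral_comp_comm hYint
    have h2 : J i = ∫ z, a z • gsCoord s h (fun t => χ (t - z)) i := by
      refine Eq.trans ?_ (h1.symm.trans (integral_congr_ae (Filter.Eventually.of_forall fun z => ?_)))
      · rfl
      · exact congrArg (a z • ·) (hYi z i)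
    rw [h2, gsCoord, ← hT.eq_iteratedFDeriv (by exact_mod_cast le_top), cvSeries, ← integral_smul]
    refine integral_congr_ae (Filter.Eventually.of_forall fun z => ?_)
    beta_reduce
    rw [gsCoord, iteratedFDeriv_comp_sub, smul_comm]
  have hmem : cv χ a ∈ gelfandShilov n s := ⟨hsm, h, h0, ‖J‖, (isGSBound_iff h0).2 fun i => by
    rw [← hcoord]
    exact lp.norm_apply_le_norm (by simp) J i⟩
  refine ⟨hmem, fun U => ?_⟩
  obtain ⟨Λ, hΛ⟩ := exists_clm_gsCoord U h0
  have hz : ∀ z, (U.eval fun t => χ (t - z)) = Λ (Y z) := fun z => by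
    rw [U.eval_of_mem (shift_mem hs hχ z)]
    exact hΛ _ _ (hYi z)
  have hi : ∀ z, (a z * U.eval fun t => χ (t - z)) = Λ (a z • Y z) := fun z => by
    rw [hz, map_smul, smul_eq_mul]
  refine ⟨?_, ?_, ?_⟩
  · simp_rw [hz]
    exact Λ.continuous.comp hYc
  · simp_rw [hi]
    exact Λ.integrable_comp hYint
  · simp_rw [hi]
    rw [Λ.integral_comp_comm hYint, U.eval_of_mem hmem]
    exact hΛ _ _ hcoord

/-! ### The short-time Fourier transform of a distribution. -/

section STFT

variable {n : ℕ} {s : ℝ} {φ χ : EuclideanSpace ℝ (Fin n) → ℂ}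

theorem GSDistribution.eval_const_mul (U : GSDistribution n s) (hχ : χ ∈ gelfandShilov n s) (c : ℂ) :
    (U.eval fun t => c * χ t) = c * U.eval χ := by
  have hm : (fun t => c * χ t) ∈ gelfandShilov n s := (gelfandShilov n s).smul_mem c hχ
  rw [U.eval_of_mem hχ, U.eval_of_mem hm, ← smul_eq_mul, ← map_smul]
  rfl

theorem GSDistribution.eval_sub (U : GSDistribution n s) {ψ : EuclideanSpace ℝ (Fin n) → ℂ}
    (hχ : χ ∈ gelfandShilov n s) (hψ : ψ ∈ gelfandShilov n s) :
    (U.eval fun t => χ t - ψ t) = U.eval χ - U.eval ψ := by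
  have hm : (fun t => χ t - ψ t) ∈ gelfandShilov n s := (gelfandShilov n s).sub_mem hχ hψ
  rw [U.eval_of_mem hχ, U.eval_of_mem hψ, U.eval_of_mem hm, ← map_sub]
  rfl

theorem conjShift_eq (φ : EuclideanSpace ℝ (Fin n) → ℂ) (x ξ t : EuclideanSpace ℝ (Fin n)) :
    conjShift φ x ξ t = phase (-ξ) t * (starRingEnd ℂ) (φ (t - x)) := by
  simp only [conjShift, phase, inner_neg_right]
  push_cast
  ring_nf

theorem conjShift_zero_sub (φ : EuclideanSpace ℝ (Fin n) → ℂ) (w ξ t : EuclideanSpace ℝ (Fin n)) :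
    conjShift φ 0 ξ (t - w) = phase ξ w * conjShift φ w ξ t := by
  rw [conjShift_eq, conjShift_eq, sub_zero, sub_eq_add_neg, phase_add_right, phase_neg_right,
    neg_neg, ← sub_eq_add_neg]
  ring

/-- The short-time Fourier transform up to a phase factor and normalisation. -/
noncomputable def GSDistribution.convSTFT (U : GSDistribution n s)
    (φ : EuclideanSpace ℝ (Fin n) → ℂ) (ξ w : EuclideanSpace ℝ (Fin n)) : ℂ :=
  U.eval fun t => conjShift φ 0 ξ (t - w)

theorem GSDistribution.convSTFT_eq (U : GSDistribution n s) (hs : 1 < s)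
    (hφ : φ ∈ gelfandShilov n s) (ξ w : EuclideanSpace ℝ (Fin n)) :
    U.convSTFT φ ξ w = phase ξ w * U.eval (conjShift φ w ξ) := by
  rw [convSTFT]
  simp_rw [conjShift_zero_sub]
  exact U.eval_const_mul (conjShift_mem hs hφ w ξ) _

theorem GSDistribution.continuous_convSTFT (U : GSDistribution n s) (hs : 1 < s)
    (hφ : φ ∈ gelfandShilov n s) (ξ : EuclideanSpace ℝ (Fin n)) :
    Continuous (U.convSTFT φ ξ) :=
  ((cv_mem hs.le (conjShift_mem hs hφ 0 ξ) hφ).2 U).1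

theorem GSDistribution.continuous_eval_conjShift (U : GSDistribution n s) (hs : 1 < s)
    (hφ : φ ∈ gelfandShilov n s) (w : EuclideanSpace ℝ (Fin n)) :
    Continuous fun ξ => U.eval (conjShift φ w ξ) := by
  rw [continuous_iff_continuousAt]
  intro ξ₀
  obtain ⟨hsm, h, h0, A, H⟩ := conjShift_mem hs hφ w ξ₀
  obtain ⟨h', C, h'0, hC⟩ := H.phase_sub_one_mul hsm (by linarith) h0
  obtain ⟨D, hD⟩ := U.bound h' h'0
  rw [ContinuousAt, tendsto_iff_norm_sub_tendsto_zero]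
  have hlim : Filter.Tendsto (fun ξ => D * (C * ‖ξ - ξ₀‖)) (nhds ξ₀) (nhds 0) := by
    have : Continuous fun ξ => D * (C * ‖ξ - ξ₀‖) := by fun_prop
    simpa using this.tendsto ξ₀
  refine squeeze_zero' (Filter.Eventually.of_forall fun z => norm_nonneg _) ?_ hlim
  filter_upwards [Metric.ball_mem_nhds ξ₀ one_pos] with ξ hξ
  rw [mem_ball_iff_norm] at hξ
  have hb := hC (ξ - ξ₀) hξ.le
  have e : (fun t => (Complex.exp (-(Complex.I * (inner ℝ t (ξ - ξ₀) : ℝ))) - 1) *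
      conjShift φ w ξ₀ t) = fun t => conjShift φ w ξ t - conjShift φ w ξ₀ t := by
    funext t
    rw [sub_one_mul, conjShift, conjShift, ← mul_assoc, ← Complex.exp_add, inner_sub_right]
    congr 3
    push_cast
    ring
  rw [e] at hb
  have hm := conjShift_mem hs hφ w ξ
  have hm₀ := conjShift_mem hs hφ w ξ₀
  rw [← U.eval_sub hm hm₀, U.eval_of_mem (ψ := fun t => conjShift φ w ξ t - conjShift φ w ξ₀ t)
    ((gelfandShilov n s).sub_mem hm hm₀)]
  exact hD _ _ hb

theorem measurable_uncurry_swap {X Y Z : Type*} [MeasurableSpace X] [MeasurableSpace Y]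
    [MeasurableSpace Z] {f : X → Y → Z} (h : Measurable (Function.uncurry fun y x => f x y)) :
    Measurable (Function.uncurry f) := h.comp measurable_swap

/-- Continuity in each variable separately already gives joint measurability. -/
theorem GSDistribution.measurable_convSTFT (U : GSDistribution n s) (hs : 1 < s)
    (hφ : φ ∈ gelfandShilov n s) :
    Measurable (Function.uncurry (U.convSTFT φ)) := by
  refine measurable_uncurry_swap (measurable_uncurry_of_continuous_of_measurable
    (fun ξ => U.continuous_convSTFT hs hφ ξ) fun w => Continuous.measurable ?_)
  simp_rw [U.convSTFT_eq hs hφ]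
  exact (continuous_phase continuous_id continuous_const).mul (U.continuous_eval_conjShift hs hφ w)

/-- The normalisation constant of the Fourier transform. -/
noncomputable def fourierConst (n : ℕ) : ℂ := (((2 * Real.pi) ^ (-(n : ℝ) / 2) : ℝ) : ℂ)

theorem fourierConst_ne_zero (n : ℕ) : fourierConst n ≠ 0 := by
  rw [fourierConst, Complex.ofReal_ne_zero]
  positivity

theorem stft_eq (hs : 1 < s) (φ : gelfandShilov n s) (U : GSDistribution n s)
    (x ξ : EuclideanSpace ℝ (Fin n)) :
    stft hs φ U x ξ = fourierConst n * (phase (-ξ) x * U.convSTFT φ ξ x) := by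
  rw [U.convSTFT_eq hs φ.2, ← mul_assoc (phase _ _), mul_comm (phase (-ξ) x), phase_mul_neg, one_mul,
    U.eval_of_mem (conjShift_mem hs φ.2 x ξ)]
  rfl

theorem eLpNorm_stft (hs : 1 < s) (φ : gelfandShilov n s) (U : GSDistribution n s) (p : ℝ≥0∞)
    (ξ : EuclideanSpace ℝ (Fin n)) :
    eLpNorm (fun x => stft hs φ U x ξ) p volume =
      ‖fourierConst n‖ₑ * eLpNorm (U.convSTFT φ ξ) p volume := by
  rw [← eLpNorm_const_smul]
  refine eLpNorm_congr_norm_ae (Filter.Eventually.of_forall fun x => ?_)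
  rw [stft_eq, norm_mul, norm_mul, norm_phase, one_mul, Pi.smul_apply, norm_smul]

theorem gmNorm_eq (hs : 1 < s) (φ : gelfandShilov n s) (U : GSDistribution n s) (p q : ℝ≥0∞) :
    gmNorm hs φ p q U = eLpNorm (fun ξ => ‖fourierConst n‖ₑ *
      (expWeight (1 / s) 1 ξ * eLpNorm (U.convSTFT φ ξ) p volume)) q volume := by
  rw [gmNorm]
  congr 1
  funext ξ
  rw [eLpNorm_stft, expWeight, one_mul, mul_left_comm]

end STFT

/-! ### Representation by bounded continuous functions. -/

section Representation

variable {n : ℕ} {s : ℝ}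

/-- Hölder in frequency: `e^{-|ξ|^{1/s}}` lies in the dual Lebesgue space, so the full weight can be
traded for integrability. -/
theorem lintegral_eLpNorm_convSTFT_lt_top (hs : 1 < s) (φ : gelfandShilov n s) {p q : ℝ≥0∞}
    (hq : 1 ≤ q) {U : GSDistribution n s} (hU : U ∈ gevreyModulation hs φ p q) :
    ∫⁻ ξ, eLpNorm (U.convSTFT φ ξ) p volume < ⊤ := by
  have hm : Measurable fun ξ => eLpNorm (U.convSTFT φ ξ) p volume := by
    have h1 : Measurable (Function.uncurry fun x ξ => ‖U.convSTFT φ ξ x‖ₑ) :=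
      ((U.measurable_convSTFT hs φ.2).comp measurable_swap).enorm
    simpa only [eLpNorm_enorm] using
      measurable_eLpNorm_section (μ := (volume : Measure (EuclideanSpace ℝ (Fin n)))) h1 p
  set c := ‖fourierConst n‖ₑ with hc
  have hc0 : c ≠ 0 := by simpa [hc] using fourierConst_ne_zero n
  have hct : c ≠ ⊤ := enorm_ne_top
  have hU' : gmNorm hs φ p q U < ⊤ := hU
  rw [gmNorm_eq] at hU'
  have h1 : eLpNorm (fun ξ => expWeight (1 / s) 1 ξ * (c * eLpNorm (U.convSTFT φ ξ) p volume)) q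
      volume < ⊤ := by
    simpa only [mul_left_comm] using hU'
  have h2 := lintegral_mul_expWeight_lt_top (r := 1 / s) (δ := 0) (by positivity) zero_lt_one hq
    (hm.const_mul c) h1
  simp only [expWeight, zero_mul, Real.exp_zero, ENNReal.ofReal_one, one_mul] at h2
  rw [lintegral_const_mul c hm] at h2
  exact ENNReal.lt_top_of_mul_ne_top_right h2.ne hc0

/-- The autocorrelation of the window, modulated. -/
noncomputable def autoCorr (φ : EuclideanSpace ℝ (Fin n) → ℂ) (ξ : EuclideanSpace ℝ (Fin n)) :
    EuclideanSpace ℝ (Fin n) → ℂ :=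
  cv (conjShift φ 0 ξ) (conjShift (refl φ) 0 ξ)

theorem autoCorr_eq_modul (φ : EuclideanSpace ℝ (Fin n) → ℂ) (ξ : EuclideanSpace ℝ (Fin n)) :
    autoCorr φ ξ = modul (-ξ) (autoCorr φ 0) := by
  rw [autoCorr, autoCorr, modul_cv]
  have : ∀ θ : EuclideanSpace ℝ (Fin n) → ℂ, conjShift θ 0 ξ = modul (-ξ) (conjShift θ 0 0) := by
    intro θ
    funext t
    rw [modul, conjShift_eq, conjShift_eq, neg_zero, phase_zero_left]
    ring
  rw [← this, ← this]

theorem autoCorr_zero_zero (φ : EuclideanSpace ℝ (Fin n) → ℂ) :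
    autoCorr φ 0 0 = ((∫ t, ‖φ t‖ ^ 2 : ℝ) : ℂ) := by
  rw [autoCorr, cv, ← integral_complex_ofReal, ← integral_neg_eq_self]
  refine integral_congr_ae (Filter.Eventually.of_forall fun t => ?_)
  beta_reduce
  rw [conjShift_eq, conjShift_eq, neg_zero, phase_zero_left, phase_zero_left]
  simp only [refl, sub_zero, neg_neg, Complex.conj_conj, one_mul, sub_neg_eq_add, zero_add]
  rw [mul_comm, Complex.mul_conj, Complex.normSq_eq_norm_sq]

theorem autoCorr_mem (hs : 1 < s) {φ : EuclideanSpace ℝ (Fin n) → ℂ}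
    (hφ : φ ∈ gelfandShilov n s) (ξ : EuclideanSpace ℝ (Fin n)) :
    autoCorr φ ξ ∈ gelfandShilov n s :=
  (cv_mem hs.le (conjShift_mem hs hφ 0 ξ) (conjShift_mem hs (refl_mem hφ) 0 ξ)).1

/-- Moving `U` inside the autocorrelation integral expresses this value as the short-time Fourier
transform convolved with the modulated window. Hölder then bounds it by the `L^p` norm of the
transform. -/
theorem GSDistribution.eval_autoCorr_shift (U : GSDistribution n s) (hs : 1 < s)
    {φ : EuclideanSpace ℝ (Fin n) → ℂ} (hφ : φ ∈ gelfandShilov n s)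
    (ξ y : EuclideanSpace ℝ (Fin n)) :
    (U.eval fun t => autoCorr φ ξ (t - y)) = cv (U.convSTFT φ ξ) (modul ξ φ) y := by
  have hm := conjShift_mem hs hφ 0 ξ
  have e : (fun t => autoCorr φ ξ (t - y)) =
      cv (fun t => conjShift φ 0 ξ (t - y)) (conjShift (refl φ) 0 ξ) := by
    funext t
    rw [autoCorr, cv, cv]
    refine integral_congr_ae (Filter.Eventually.of_forall fun r => ?_)
    beta_reduce
    congr 2
    abel
  rw [e, ((cv_mem hs.le (shift_mem hs.le hm y) (conjShift_mem hs (refl_mem hφ) 0 ξ)).2 U).2.2, cv,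
    ← integral_neg_eq_self]
  refine integral_congr_ae (Filter.Eventually.of_forall fun r => ?_)
  beta_reduce
  rw [mul_comm, GSDistribution.convSTFT]
  congr 1
  · congr 1
    funext t
    congr 1
    abel
  · rw [conjShift_eq, modul, phase_neg_right, neg_neg, refl, sub_zero, neg_neg, Complex.conj_conj,
      mul_comm]

/-- A distribution with integrable short-time Fourier transform is a bounded continuous function. -/
theorem GSDistribution.exists_bddCont (U : GSDistribution n s) (hs : 1 < s)
    {φ : EuclideanSpace ℝ (Fin n) → ℂ} (hφ : φ ∈ gelfandShilov n s) (h0 : φ ≠ 0) {p : ℝ≥0∞}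
    (hp : 1 ≤ p) (hU : ∫⁻ ξ, eLpNorm (U.convSTFT φ ξ) p volume < ⊤) :
    ∃ v : EuclideanSpace ℝ (Fin n) → ℂ, BddCont v ∧
      ∀ χ ∈ gelfandShilov n s, U.eval χ = ∫ t, v t * χ t := by
  have hφw := isWindow_of_mem hφ
  set B : EuclideanSpace ℝ (Fin n) → EuclideanSpace ℝ (Fin n) → ℂ :=
    fun ξ y => cv (U.convSTFT φ ξ) (modul ξ φ) y with hB
  have hBm : Measurable (Function.uncurry B) := by
    have h1 : Measurable fun z : (EuclideanSpace ℝ (Fin n) × EuclideanSpace ℝ (Fin n)) ×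
        EuclideanSpace ℝ (Fin n) => U.convSTFT φ z.1.1 (z.1.2 - z.2) * modul z.1.1 φ z.2 := by
      refine ((U.measurable_convSTFT hs hφ).comp (g := Function.uncurry (U.convSTFT φ))
        (f := fun z : (EuclideanSpace ℝ (Fin n) × EuclideanSpace ℝ (Fin n)) ×
          EuclideanSpace ℝ (Fin n) => (z.1.1, z.1.2 - z.2)) (by fun_prop)).mul ?_
      exact ((hφw.cont.comp continuous_snd).mul
        (continuous_phase (by fun_prop) continuous_snd)).measurable
    exact h1.stronglyMeasurable.integral_prod_right'.measurable
  have hBc : ∀ ξ, Continuous (B ξ) := fun ξ => by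
    simp only [hB]
    simp_rw [← U.eval_autoCorr_shift hs hφ]
    exact ((cv_mem hs.le (autoCorr_mem hs hφ ξ) hφ).2 U).1
  obtain ⟨Φ, hΦ⟩ := exists_schwartz_of_mem hφ
  set K : ℝ≥0∞ := eLpNorm φ p.conjExponent volume with hK
  have hKt : K ≠ ⊤ := by
    rw [hK, ← hΦ]
    exact (Φ.memLp p.conjExponent volume).eLpNorm_ne_top
  have hBb : ∀ ξ y, ‖B ξ y‖ₑ ≤ eLpNorm (U.convSTFT φ ξ) p volume * K := by
    intro ξ y
    refine (enorm_cv_le_mul hp (U.continuous_convSTFT hs hφ ξ).measurable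
      (hφw.modul ξ).cont.measurable y).trans_eq ?_
    congr 1
    exact eLpNorm_congr_norm_ae (Filter.Eventually.of_forall fun t => norm_modul ξ φ t)
  have hPm : Measurable fun ξ => eLpNorm (U.convSTFT φ ξ) p volume := by
    have h1 : Measurable (Function.uncurry fun x ξ => ‖U.convSTFT φ ξ x‖ₑ) :=
      ((U.measurable_convSTFT hs hφ).comp measurable_swap).enorm
    simpa only [eLpNorm_enorm] using
      measurable_eLpNorm_section (μ := (volume : Measure (EuclideanSpace ℝ (Fin n)))) h1 p
  set β : EuclideanSpace ℝ (Fin n) → ℝ≥0∞ := fun ξ => eLpNorm (U.convSTFT φ ξ) p volume * K with hβ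
  have hβm : Measurable β := hPm.mul_const K
  have hβi : ∫⁻ ξ, β ξ < ⊤ := by
    rw [hβ, lintegral_mul_const K hPm]
    exact ENNReal.mul_lt_top hU hKt.lt_top
  have hβr : Integrable fun ξ => (β ξ).toReal := integrable_toReal_of_lintegral_ne_top
    hβm.aemeasurable hβi.ne
  have hβf : ∀ᵐ ξ, β ξ < ⊤ := ae_lt_top hβm hβi.ne
  have hBβ : ∀ᵐ ξ, ∀ y, ‖B ξ y‖ ≤ (β ξ).toReal := by
    filter_upwards [hβf] with ξ hξ y
    rw [← toReal_enorm]
    exact ENNReal.toReal_mono hξ.ne (hBb ξ y)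
  set c : ℂ := (((2 * Real.pi) ^ Module.finrank ℝ (EuclideanSpace ℝ (Fin n)) : ℝ) : ℂ) *
    autoCorr φ 0 0 with hc
  have hc0 : c ≠ 0 := by
    rw [hc, autoCorr_zero_zero]
    refine mul_ne_zero (by rw [Complex.ofReal_ne_zero]; positivity) ?_
    rw [Complex.ofReal_ne_zero]
    obtain ⟨t₀, ht₀⟩ := Function.ne_iff.1 h0
    have h2 : MemLp φ 2 volume := by
      rw [← hΦ]
      exact Φ.memLp 2 volume
    refine (integral_pos_of_integrable_nonneg_nonzero (x := t₀) (by have := hφw.cont; fun_prop)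
      (h2.integrable_norm_pow (by norm_num)) (fun t => by positivity) ?_).ne'
    simpa using ht₀
  -- `B ξ y` is `U` tested on the autocorrelation, modulated by `-ξ` and translated by `y`.
  -- Integrating the modulations over `ξ` formally yields `c` times the point mass at `y`, so `v` is
  -- the candidate for `U`.
  set v : EuclideanSpace ℝ (Fin n) → ℂ := fun y => c⁻¹ * ∫ ξ, B ξ y with hv
  refine ⟨v, ⟨?_, ‖c⁻¹‖ * ∫ ξ, (β ξ).toReal, fun y => ?_⟩, fun χ hχ => ?_⟩
  · refine continuous_const.mul (continuous_of_dominated (fun y => ?_) (fun y => ?_) hβr ?_)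
    · exact (hBm.comp (measurable_id.prodMk measurable_const)).aestronglyMeasurable
    · filter_upwards [hBβ] with ξ hξ using hξ y
    · exact Filter.Eventually.of_forall hBc
  · rw [hv, norm_mul]
    exact mul_le_mul_of_nonneg_left (norm_integral_le_of_norm_le hβr
      (hBβ.mono fun ξ hξ => hξ y)) (norm_nonneg _)
  · have hχw := isWindow_of_mem hχ
    -- `H 0` is `autoCorr φ 0 0 * U χ`, and Fourier inversion at the origin recovers it from the
    -- Fourier transform of `H`.
    set H : EuclideanSpace ℝ (Fin n) → ℂ :=
      fun z => autoCorr φ 0 z * U.eval fun t => χ (t - z) with hH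
    obtain ⟨-, hχU⟩ := cv_mem hs.le hχ (autoCorr_mem hs hφ 0)
    have hHc : Continuous H := (isWindow_of_mem (autoCorr_mem hs hφ 0)).cont.mul (hχU U).1
    have hHi : Integrable H := (hχU U).2.1
    -- Both sides are `U` applied to the convolution of `χ` with the modulated autocorrelation,
    -- expanded with the roles of the two factors exchanged.
    have hF : ∀ ξ, ∫ z, H z * phase (-ξ) z = ∫ y, χ y * B ξ y := by
      intro ξ
      have h1 := ((cv_mem hs.le hχ (autoCorr_mem hs hφ ξ)).2 U).2.2
      have h2 := ((cv_mem hs.le (autoCorr_mem hs hφ ξ) hχ).2 U).2.2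
      have e : cv χ (autoCorr φ ξ) = cv (autoCorr φ ξ) χ := funext fun x => cv_comm _ _ x
      rw [e, h2] at h1
      simp_rw [U.eval_autoCorr_shift hs hφ] at h1
      refine Eq.trans ?_ h1.symm
      refine integral_congr_ae (Filter.Eventually.of_forall fun z => ?_)
      beta_reduce
      rw [autoCorr_eq_modul, modul, hH]
      ring
    have hprod : Integrable (fun z : EuclideanSpace ℝ (Fin n) × EuclideanSpace ℝ (Fin n) =>
        χ z.2 * B z.1 z.2) (volume.prod volume) := by
      refine (hβr.mul_prod hχw.int.norm).mono' ?_ ?_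
      · exact ((hχw.cont.measurable.comp measurable_snd).mul hBm).aestronglyMeasurable
      · have : ∀ᵐ z : EuclideanSpace ℝ (Fin n) × EuclideanSpace ℝ (Fin n) ∂(volume.prod volume),
            ∀ y, ‖B z.1 y‖ ≤ (β z.1).toReal :=
          Measure.quasiMeasurePreserving_fst.ae hBβ
        filter_upwards [this] with z hz
        rw [norm_mul, mul_comm]
        exact mul_le_mul_of_nonneg_right (hz z.2) (norm_nonneg _)
    have hFi : Integrable fun ξ => ∫ z, H z * phase ξ z := by
      have h1 : Integrable fun ξ => ∫ z, H z * phase (-ξ) z := by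
        simp_rw [hF]
        exact hprod.integral_prod_left
      simpa using h1.comp_neg
    have hinv := integral_integral_mul_phase hHc hHi hFi
    rw [← integral_neg_eq_self] at hinv
    simp_rw [hF] at hinv
    rw [integral_integral_swap hprod] at hinv
    have e0 : H 0 = autoCorr φ 0 0 * U.eval χ := by simp [hH]
    rw [e0, ← mul_assoc, ← hc] at hinv
    rw [← mul_right_inj' hc0, ← hinv, ← integral_const_mul]
    refine integral_congr_ae (Filter.Eventually.of_forall fun y => ?_)
    beta_reduce
    rw [hv, integral_const_mul]
    field_simp

end Representation

/-! ### Uniqueness of the representing function. -/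

section Uniqueness

/-- An integrable function with vanishing Fourier transform vanishes almost everywhere. -/
theorem ae_eq_zero_of_integral_mul_phase {E : Type*} [NormedAddCommGroup E] [InnerProductSpace ℝ E]
    [FiniteDimensional ℝ E] [MeasurableSpace E] [BorelSpace E] {g : E → ℂ} (hg : Integrable g)
    (h : ∀ ξ, ∫ t, g t * phase (-ξ) t = 0) : ∀ᵐ t, g t = 0 := by
  refine ae_eq_zero_of_integral_contDiff_smul_eq_zero hg.locallyIntegrable fun b hb hbc => ?_
  have hbc' : HasCompactSupport fun x => (b x : ℂ) := hbc.comp_left Complex.ofReal_zero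
  have hb' : ContDiff ℝ ∞ fun x => (b x : ℂ) := Complex.ofRealCLM.contDiff.comp hb
  set β : 𝓢(E, ℂ) := hbc'.toSchwartzMap hb' with hβ
  have hβa : ∀ x, β x = (b x : ℂ) := fun x => rfl
  set η : 𝓢(E, ℂ) := FourierTransformInv.fourierInv β with hη
  have hηβ : FourierTransform.fourier η = β := FourierTransform.fourier_fourierInv_eq β
  -- The test bump is the Fourier transform of `η`; the exchange formula moves the transform onto
  -- `g`, where it vanishes.
  have h1 := VectorFourier.integral_fourierIntegral_smul_eq_flip (μ := (volume : Measure E))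
    (ν := (volume : Measure E)) (L := innerₗ E) Real.continuous_fourierChar continuous_inner
    η.integrable hg
  have h2 : ∀ x, VectorFourier.fourierIntegral Real.fourierChar volume (innerₗ E) η x = (b x : ℂ) := by
    intro x
    rw [← hβa, ← hηβ]
    rfl
  simp_rw [h2] at h1
  have h3 : ∀ x, VectorFourier.fourierIntegral Real.fourierChar volume (innerₗ E).flip g x = 0 := by
    intro x
    rw [← h ((2 * Real.pi) • x), VectorFourier.fourierIntegral]
    refine integral_congr_ae (Filter.Eventually.of_forall fun t => ?_)
    beta_reduce
    rw [Circle.smul_def, Real.fourierChar_apply, smul_eq_mul, mul_comm, phase, inner_neg_right,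
      inner_smul_right]
    congr 2
    simp only [LinearMap.flip_apply, innerₗ_apply_apply, real_inner_comm]
    push_cast
    ring
  simp_rw [h3, smul_zero, integral_zero] at h1
  simpa [Complex.real_smul] using h1

variable {n : ℕ} {s : ℝ}

/-- No density of test functions is needed. Testing on the time-frequency shifts of `φ` shows that
the product of `w` with a conjugated translate of `φ` has zero Fourier transform, hence vanishes
almost everywhere. Countably many translates suffice, since `φ` is nonzero on an open set. -/
theorem ae_eq_zero_of_forall_integral_mul_eq_zero (hs : 1 < s) {φ w : EuclideanSpace ℝ (Fin n) → ℂ}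
    (hφ : φ ∈ gelfandShilov n s) (h0 : φ ≠ 0) (hw : MemLp w ⊤ volume)
    (h : ∀ χ ∈ gelfandShilov n s, ∫ t, w t * χ t = 0) : ∀ᵐ t, w t = 0 := by
  have hφw := isWindow_of_mem hφ
  have h1 : ∀ x, ∀ᵐ t, w t * (starRingEnd ℂ) (φ (t - x)) = 0 := by
    intro x
    have hi : Integrable fun t => (starRingEnd ℂ) (φ (t - x)) :=
      Complex.conjCLE.toContinuousLinearMap.integrable_comp (hφw.int.comp_sub_right x)
    refine ae_eq_zero_of_integral_mul_phase (hi.essSup_smul hw.1.aemeasurable.aestronglyMeasurable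
      hw.2.ne) fun ξ => ?_
    rw [← h _ (conjShift_mem hs hφ x ξ)]
    refine integral_congr_ae (Filter.Eventually.of_forall fun t => ?_)
    beta_reduce
    rw [conjShift_eq]
    ring
  have h2 := ae_all_iff.2 fun k : ℕ => h1 (TopologicalSpace.denseSeq _ k)
  filter_upwards [h2] with t ht
  obtain ⟨t₀, ht₀⟩ := Function.ne_iff.1 h0
  have hopen : IsOpen {x | φ (t - x) ≠ 0} :=
    isOpen_ne_fun (hφw.cont.comp (continuous_const.sub continuous_id)) continuous_const
  obtain ⟨k, hx⟩ := (TopologicalSpace.denseRange_denseSeq _).exists_mem_open hopen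
    ⟨t - t₀, by simpa using ht₀⟩
  exact (mul_eq_zero.1 (ht k)).resolve_right (by simpa using hx)

end Uniqueness

/-! ### Distributions given by bounded continuous functions. -/

section Functions

variable {n : ℕ} {s : ℝ}

theorem exists_integral_norm_le_of_isGSBound (s h : ℝ) :
    ∃ C : ℝ, ∀ (A : ℝ) (ψ : EuclideanSpace ℝ (Fin n) → ℂ), IsGSBound s h A ψ →
      ∫ t, ‖ψ t‖ ≤ C * A := by
  set N := n + 1
  set D : ℝ := 2 ^ N * (1 + h ^ N * (N.factorial : ℝ) ^ s) with hD
  have hint : Integrable fun z : EuclideanSpace ℝ (Fin n) => ((1 + ‖z‖) ^ N)⁻¹ := by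
    have := integrable_one_add_norm (E := EuclideanSpace ℝ (Fin n)) (μ := volume)
      (r := (N : ℝ)) (by rw [finrank_euclideanSpace_fin]; push_cast [N]; linarith)
    refine this.congr (Filter.Eventually.of_forall fun z => ?_)
    beta_reduce
    rw [Real.rpow_neg (by positivity), Real.rpow_natCast]
  refine ⟨D * ∫ z : EuclideanSpace ℝ (Fin n), ((1 + ‖z‖) ^ N)⁻¹, fun A ψ H => ?_⟩
  have hA := H.nonneg
  have hb : ∀ t, ‖ψ t‖ ≤ A * D * ((1 + ‖t‖) ^ N)⁻¹ := by
    intro t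
    have h1 : ‖ψ t‖ ≤ A := by simpa using H 0 0 t
    have h2 : ‖t‖ ^ N * ‖ψ t‖ ≤ A * h ^ N * (N.factorial : ℝ) ^ s := by simpa using H N 0 t
    have h6 : (1 + ‖t‖) ^ N ≤ 2 ^ N * (1 + ‖t‖ ^ N) := by
      refine (add_pow_le zero_le_one (norm_nonneg _) N).trans ?_
      rw [one_pow]
      gcongr
      · norm_num
      · exact Nat.sub_le _ _
    rw [← div_eq_mul_inv, le_div_iff₀ (by positivity)]
    calc ‖ψ t‖ * (1 + ‖t‖) ^ N ≤ ‖ψ t‖ * (2 ^ N * (1 + ‖t‖ ^ N)) := by gcongr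
      _ = 2 ^ N * (‖ψ t‖ + ‖t‖ ^ N * ‖ψ t‖) := by ring
      _ ≤ 2 ^ N * (A + A * h ^ N * (N.factorial : ℝ) ^ s) := by gcongr
      _ = A * D := by rw [hD]; ring
  calc ∫ t, ‖ψ t‖ ≤ ∫ t, A * D * ((1 + ‖t‖) ^ N)⁻¹ :=
        integral_mono_of_nonneg (Filter.Eventually.of_forall fun t => norm_nonneg _)
          (hint.const_mul _) (Filter.Eventually.of_forall hb)
    _ = _ := by rw [integral_const_mul]; ring

/-- The distribution given by a bounded continuous function. -/
theorem exists_distribution (s : ℝ) {v : EuclideanSpace ℝ (Fin n) → ℂ} (hv : BddCont v) :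
    ∃ U : GSDistribution n s, ∀ ψ : gelfandShilov n s,
      U.toLinearMap ψ = ∫ t, v t * (ψ : EuclideanSpace ℝ (Fin n) → ℂ) t := by
  obtain ⟨B, hB⟩ := hv.bdd
  have hi : ∀ ψ : gelfandShilov n s,
      Integrable fun t => v t * (ψ : EuclideanSpace ℝ (Fin n) → ℂ) t := fun ψ =>
    (isWindow_of_mem ψ.2).int.bdd_mul hv.cont.aestronglyMeasurable (Filter.Eventually.of_forall hB)
  refine ⟨⟨⟨⟨fun ψ => ∫ t, v t * (ψ : EuclideanSpace ℝ (Fin n) → ℂ) t, fun ψ ψ' => ?_⟩,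
    fun c ψ => ?_⟩, fun h h0 => ?_⟩, fun ψ => rfl⟩
  · rw [← integral_add (hi ψ) (hi ψ')]
    refine integral_congr_ae (Filter.Eventually.of_forall fun t => ?_)
    exact mul_add _ _ _
  · rw [smul_eq_mul, ← integral_const_mul]
    refine integral_congr_ae (Filter.Eventually.of_forall fun t => ?_)
    exact mul_left_comm _ _ _
  · obtain ⟨C, hC⟩ := exists_integral_norm_le_of_isGSBound (n := n) s h
    refine ⟨B * C, fun A ψ H => ?_⟩
    have hB0 : 0 ≤ B := (norm_nonneg _).trans (hB 0)
    refine (norm_integral_le_of_norm_le ((isWindow_of_mem ψ.2).int.norm.const_mul B)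
      (Filter.Eventually.of_forall fun t => ?_)).trans ?_
    · rw [norm_mul]
      exact mul_le_mul_of_nonneg_right (hB t) (norm_nonneg _)
    · rw [integral_const_mul, mul_assoc]
      exact mul_le_mul_of_nonneg_left (hC A _ H) hB0

/-- This links the norm of distributions to `wnorm`: for functions the transform is a convolution
with the modulated reflected window. -/
theorem GSDistribution.convSTFT_eq_cv (U : GSDistribution n s) (hs : 1 < s)
    {φ v : EuclideanSpace ℝ (Fin n) → ℂ} (hφ : φ ∈ gelfandShilov n s)
    (hU : ∀ ψ : gelfandShilov n s,
      U.toLinearMap ψ = ∫ t, v t * (ψ : EuclideanSpace ℝ (Fin n) → ℂ) t)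
    (ξ : EuclideanSpace ℝ (Fin n)) :
    U.convSTFT φ ξ = cv v (modul ξ (refl φ)) := by
  funext w
  rw [convSTFT, U.eval_of_mem (shift_mem hs.le (conjShift_mem hs hφ 0 ξ) w), hU, cv,
    ← integral_sub_left_eq_self _ _ w]
  refine integral_congr_ae (Filter.Eventually.of_forall fun r => ?_)
  change v (w - r) * conjShift φ 0 ξ (w - r - w) = v (w - r) * modul ξ (refl φ) r
  rw [sub_sub_cancel_left, conjShift_eq, modul, phase_neg_right, neg_neg, refl, sub_zero, mul_comm
    (phase ξ r)]

theorem gmNorm_lt_top_iff (hs : 1 < s) (φ : gelfandShilov n s) {U : GSDistribution n s}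
    {v : EuclideanSpace ℝ (Fin n) → ℂ} (p q : ℝ≥0∞)
    (hU : ∀ ψ : gelfandShilov n s,
      U.toLinearMap ψ = ∫ t, v t * (ψ : EuclideanSpace ℝ (Fin n) → ℂ) t) :
    gmNorm hs φ p q U < ⊤ ↔ wnorm (refl φ) (expWeight (1 / s) 1) p q v < ⊤ := by
  set c := ‖fourierConst n‖ₑ with hc
  have hc0 : c ≠ 0 := by simpa [hc] using fourierConst_ne_zero n
  have hct : c ≠ ⊤ := enorm_ne_top
  rw [gmNorm_eq]
  simp_rw [U.convSTFT_eq_cv hs φ.2 hU]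
  set F : EuclideanSpace ℝ (Fin n) → ℝ≥0∞ := fun ξ =>
    expWeight (1 / s) 1 ξ * eLpNorm (cv v (modul ξ (refl φ))) p volume with hF
  change eLpNorm (fun ξ => c * F ξ) q volume < ⊤ ↔ eLpNorm F q volume < ⊤
  refine ⟨fun h => ?_, fun h => (eLpNorm_const_mul_le hct F).trans_lt
    (ENNReal.mul_lt_top hct.lt_top h)⟩
  have e : F = fun ξ => c⁻¹ * (c * F ξ) := by
    funext ξ
    rw [← mul_assoc, ENNReal.inv_mul_cancel hc0 hct, one_mul]
  rw [e]
  exact (eLpNorm_const_mul_le (ENNReal.inv_ne_top.2 hc0) _).trans_lt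
    (ENNReal.mul_lt_top (ENNReal.inv_ne_top.2 hc0).lt_top h)

theorem norm_integral_mul_phase_le {φ : gelfandShilov n s} {κ C : ℝ}
    (hC : ∀ ξ, ‖fourierTransform (φ : EuclideanSpace ℝ (Fin n) → ℂ) ξ‖ ≤
      C * Real.exp (-(κ * ‖ξ‖ ^ (1 / s)))) (w : EuclideanSpace ℝ (Fin n)) :
    ‖∫ t, (φ : EuclideanSpace ℝ (Fin n) → ℂ) t * phase w t‖ ≤
      ‖fourierConst n‖⁻¹ * C * Real.exp (-(κ * ‖w‖ ^ (1 / s))) := by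
  have h1 := hC (-w)
  have h0 : 0 < ‖fourierConst n‖ := norm_pos_iff.2 (fourierConst_ne_zero n)
  have e : fourierTransform (φ : EuclideanSpace ℝ (Fin n) → ℂ) (-w) =
      fourierConst n * ∫ t, (φ : EuclideanSpace ℝ (Fin n) → ℂ) t * phase w t := by
    rw [fourierTransform, fourierConst]
    congr 1
    refine integral_congr_ae (Filter.Eventually.of_forall fun t => ?_)
    simp [phase]
  rw [e, norm_mul, norm_neg] at h1
  rw [mul_assoc, ← div_eq_inv_mul, le_div_iff₀' h0]
  exact h1

end Functions

/-! ### The composition theorem. -/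

section Main

variable {n : ℕ} {s : ℝ} {p q : ℝ≥0∞}

theorem exists_bddCont_representation (hs : 1 < s) (hp : 1 ≤ p) (hq : 1 ≤ q) {φ : gelfandShilov n s}
    (hφ : φ ≠ 0) {U : GSDistribution n s} (hU : U ∈ gevreyModulation hs φ p q) :
    ∃ v : EuclideanSpace ℝ (Fin n) → ℂ, BddCont v ∧ IsRepresentedBy U v := by
  have hφ0 : (φ : EuclideanSpace ℝ (Fin n) → ℂ) ≠ 0 := fun h => hφ (Subtype.ext h)
  obtain ⟨v, hv, H⟩ := U.exists_bddCont hs φ.2 hφ0 hp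
    (lintegral_eLpNorm_convSTFT_lt_top hs φ hq hU)
  obtain ⟨B, hB⟩ := hv.bdd
  refine ⟨v, hv, memLp_top_of_bound hv.cont.aestronglyMeasurable B (Filter.Eventually.of_forall hB),
    fun ψ => ?_⟩
  rw [← H _ ψ.2, U.eval_of_mem ψ.2]

/-- The given `u` is known only up to null sets, while the estimates need a bounded continuous real
function. By uniqueness `u` agrees almost everywhere with the real part `u'` of the continuous
representative, and composition preserves this equality. -/
theorem isGMFunction_comp (hs : 1 < s) (hp : 1 ≤ p) (hq : 1 ≤ q) {φ : gelfandShilov n s}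
    (hφ : IsAdmissibleWindow φ) {μ : ComplexMeasure ℝ} (hμ : HasExpMoments μ (1 / s))
    (hμ0 : μ Set.univ = 0) {u : EuclideanSpace ℝ (Fin n) → ℝ}
    (hu : IsGMFunction hs φ p q fun x => (u x : ℂ)) :
    IsGMFunction hs φ p q fun x => invFourierMeasure μ (u x) := by
  obtain ⟨hφ1, κ, hκ, C, hC⟩ := hφ
  have hφ0 : (φ : EuclideanSpace ℝ (Fin n) → ℂ) ≠ 0 := fun h => hφ1 (Subtype.ext h)
  obtain ⟨U, hU, huL, hUu⟩ := hu
  obtain ⟨v, hv, hvL, hUv⟩ := exists_bddCont_representation hs hp hq hφ1 hU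
  have hr : 0 < 1 / s := by positivity
  have hr1 : 1 / s < 1 := by rw [div_lt_one (by linarith)]; exact hs
  have hint : ∀ {w : EuclideanSpace ℝ (Fin n) → ℂ} {ψ : EuclideanSpace ℝ (Fin n) → ℂ},
      MemLp w ⊤ volume → ψ ∈ gelfandShilov n s → Integrable fun t => w t * ψ t := fun hw hψ =>
    (isWindow_of_mem hψ).int.essSup_smul hw.1.aemeasurable.aestronglyMeasurable hw.2.ne
  have hae : ∀ᵐ t, (u t : ℂ) - v t = 0 := by
    refine ae_eq_zero_of_forall_integral_mul_eq_zero hs φ.2 hφ0 (huL.sub hvL) fun χ hχ => ?_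
    simp only [sub_mul]
    rw [integral_sub (hint huL hχ) (hint hvL hχ), ← hUu ⟨χ, hχ⟩, ← hUv ⟨χ, hχ⟩, sub_self]
  set u' : EuclideanSpace ℝ (Fin n) → ℝ := fun x => (v x).re with hu'
  have huu' : ∀ᵐ t, u t = u' t := by
    filter_upwards [hae] with t ht
    change u t = (v t).re
    rw [← sub_eq_zero.1 ht, Complex.ofReal_re]
  have hu'c : Continuous u' := Complex.continuous_re.comp hv.cont
  obtain ⟨B, hB⟩ := hv.bdd
  have hu'b : BddCont fun x => (u' x : ℂ) := ⟨Complex.continuous_ofReal.comp hu'c, B, fun x => by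
    rw [Complex.norm_real]
    exact (Complex.abs_re_le_norm _).trans (hB x)⟩
  have hUu' : ∀ ψ : gelfandShilov n s,
      U.toLinearMap ψ = ∫ t, (u' t : ℂ) * (ψ : EuclideanSpace ℝ (Fin n) → ℂ) t := by
    intro ψ
    rw [hUu]
    refine integral_congr_ae ?_
    filter_upwards [huu'] with t ht
    rw [ht]
  obtain ⟨Φ, hΦ⟩ := exists_schwartz_of_mem φ.2
  obtain ⟨θ, hθ⟩ := exists_schwartz_of_mem (refl_mem φ.2)
  have hθ0 : θ ≠ 0 := by
    intro h
    apply hφ0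
    rw [← refl_refl (φ : EuclideanSpace ℝ (Fin n) → ℂ), ← hθ, h]
    funext t
    simp [refl]
  have hN := (gmNorm_lt_top_iff hs φ p q hUu').1 hU
  have hC' := norm_integral_mul_phase_le hC
  rw [← hΦ] at hC'
  rw [← hθ] at hN
  have key := wnorm_invFourierMeasure_comp_lt_top (φ := Φ) (θ := θ) (fun t => by rw [hθ, hΦ]) hθ0
    hr hr1 hκ hC' hp hq hμ hμ0 hu'b hN
  have hg := bddCont_invFourierMeasure_comp hμ hr hu'c
  obtain ⟨V, hV⟩ := exists_distribution s hg
  obtain ⟨D, hD⟩ := hg.bdd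
  have hgae : (fun x => invFourierMeasure μ (u x)) =ᵐ[volume] fun x => invFourierMeasure μ (u' x) := by
    filter_upwards [huu'] with t ht
    rw [ht]
  refine ⟨V, (gmNorm_lt_top_iff hs φ p q hV).2 (by rwa [← hθ]), ?_, fun ψ => ?_⟩
  · exact (memLp_congr_ae hgae).2 (memLp_top_of_bound hg.cont.aestronglyMeasurable D
      (Filter.Eventually.of_forall hD))
  · rw [hV]
    refine integral_congr_ae ?_
    filter_upwards [hgae] with t ht
    rw [ht]

end Main

end GevreyModulation

theorem theorem3p17 (n : ℕ) (s : ℝ) (hs : 1 < s) (p q : ENNReal) (hp : 1 ≤ p) (hq : 1 ≤ q)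
    (φ : gelfandShilov n s) (hφ : IsAdmissibleWindow φ)
    (μ : ComplexMeasure ℝ)
    (hμ : ∀ l : ℝ, 0 < l →
      ∫⁻ ξ : ℝ, ENNReal.ofReal (Real.exp (l * (|ξ| ^ (1 / s) * Real.log |ξ|))) ∂μ.variation < ⊤)
    (hμ0 : μ Set.univ = 0)
    (f : ℝ → ℂ) (hf : f = invFourierMeasure μ) :
    ContDiff ℝ ∞ f ∧
    (∀ U ∈ gevreyModulation hs φ p q, ∃ v : EuclideanSpace ℝ (Fin n) → ℂ, IsRepresentedBy U v) ∧
    (∀ u : EuclideanSpace ℝ (Fin n) → ℝ,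
      IsGMFunction hs φ p q (fun x => (u x : ℂ)) →
      IsGMFunction hs φ p q (fun x => f (u x))) := by
  have hr : 0 < 1 / s := by positivity
  have hμ' : HasExpMoments μ (1 / s) := hμ
  subst hf
  refine ⟨hμ'.contDiff_invFourierMeasure hr, fun U hU => ?_, fun u hu =>
    isGMFunction_comp hs hp hq hφ hμ' hμ0 hu⟩
  obtain ⟨v, -, hv⟩ := exists_bddCont_representation hs hp hq hφ.1 hU
  exact ⟨v, hv⟩
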